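/- **Setting.** Let $S$ be a finite set and let $X=(X(t):t\ge 0)$ be an $S$-valued Markov jump process, with right-continuous paths having finitely many jumps in bounded intervals and arbitrary initial distribution, whose transition matrices $P(s,t)$, $0\le s\le t$, are stochastic matrices satisfying the Kolmogorov backward and forward integral equations $$P(s,t)=I+\int_s^t Q(u)P(u,t)\,du,\qquad P(s,t)=I+\int_s^t P(s,u)Q(u)\,du$$ for given rate matrices $Q(t)=(Q(t,x,y))_{x,y\in S}$. Let $T_j$ be the $j$-th jump time of $X$, $T_0=0$, $Y_j=X(T_j)$, and let $J(t)$ be the number of jumps in $[0,t]$. Given $X$, let $N$ be a Poisson counting process with intensity $\beta(t,X(t))$ and event times $\Lambda_1<\Lambda_2<\cdots$. Let $0=t_0<t_1<t_2<\cdots$ be deterministic times with $t_i\to\infty$, and $n(t)=\sup\{i:t_i\le t\}$. Given $X$ and $N$, let the lump-sum rewards $\mathcal G_j$ (for the jumps of $X$), $\mathcal H_i$ (at the times $t_i$), $\mathcal K_k$ (for the events of $N$), $i,j,k\ge 1$, be independent with cdf's $G(T_j,Y_{j-1},Y_j,\cdot)$, $H(t_i,X(t_i),\cdot)$ and $K(\Lambda_k,X(\Lambda_k),\cdot)$,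 respectively. The cumulative reward is $$R(t)=\int_0^t r(s,X(s))\,ds+\sum_{j=1}^{J(t)}\mathcal G_j+\sum_{i=1}^{n(t)}\mathcal H_i+\sum_{k=1}^{N(t)}\mathcal K_k .$$ **Assumptions.** - (A1) For all $x,y\in S$, $z\in\mathbb R$, the functions $Q(\cdot,x,y)$, $r(\cdot,x)$, $G(\cdot,x,y,z)$, $K(\cdot,x,z)$, $\beta(\cdot,x)$ are measurable. - (A2) Each $Q(t)$ is a rate matrix (non-negative off-diagonal entries, zero row sums), the set $\mathcal B=\{(x,y):Q(t,x,y)>0\}$ does not depend on $t$, and $Q(1)$ is irreducible. - (A3) $0<\inf_{t}Q(t,x,y)\le\sup_{t}Q(t,x,y)<\infty$ for each $(x,y)\in\mathcal B$. - (A4) $r\ge 0$ and $\beta\ge 0$, with $\sup_t r(t,x)<\infty$ and $\sup_t\beta(t,x)<\infty$ for each $x$. There is a finite function $c$ on $S$ such that, for all $t,x,y$, the distributions $G(t,x,y,\cdot)$, $H(t,x,\cdot)$, $K(t,x,\cdot)$ are concentrated on $[0,c(x)]$. Moreover $\inf_t r(t,x)+\inf_t\gamma(t,x)>0$ for each $x$,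 where $$\gamma(t,x)=\sum_{y:(x,y)\in\mathcal B}Q(t,x,y)\int_0^\infty z\,G(t,x,y,dz)+\beta(t,x)\int_0^\infty z\,K(t,x,dz).$$ - (A5) $\inf_{i\ge1}(t_i-t_{i-1})>0$. **Notation.** Put $\tilde r=r+\gamma$, $\tilde r_c(t,x)=\tilde r(t,x)-\mathbb E\,\tilde r(t,X(t))$, $h(t,x)=\int_0^\infty z\,H(t,x,dz)$, $h_c(t,x)=h(t,x)-\mathbb E\,h(t,X(t))$, and $\mathbb E_{t,x}f(X(u))=\sum_{y}P(t,u,x,y)f(y)$ for $u\ge t$. Define $\nu=\nu_1+\nu_2$ with $$\nu_1(t,x)=\int_0^\infty\mathbb E_{t,x}\,\tilde r_c(t+u,X(t+u))\,du,\qquad \nu_2(t,x)=\sum_{i:\,t_i>t}\mathbb E_{t,x}\,h_c(t_i,X(t_i)).$$ Let $\mathcal F_t$ be the history up to time $t$: the $\sigma$-algebra generated by $X(s)$, $N(s)$, $\sum_{j\le J(s)}\mathcal G_j$, $\sum_{i\le n(s)}\mathcal H_i$ and $\sum_{k\le N(s)}\mathcal K_k$ for $0\le s\le t$. **Theorem.**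 Assume (A1)–(A5). Then, for all $t\ge0$ and $x\in S$, the integral defining $\nu_1(t,x)$ and the series defining $\nu_2(t,x)$ converge absolutely, and $$\sup\{|\nu(t,x)|:t\ge 0,\ x\in S\}<\infty .$$ Moreover $R(t)$ is integrable for each $t\ge 0$, and $M(t)=R(t)-\mathbb E R(t)+\nu(t,X(t))$, $t\ge 0$, is a martingale with respect to the filtration $(\mathcal F_t)_{t\ge0}$. -/

import Mathlib

open MeasureTheory Filter Topology
open scoped NNReal

/-- Lebesgue measure on the time axis `ℝ≥0`. -/
noncomputable def leb : Measure ℝ≥0 := (volume : Measure ℝ).comap ((↑) : ℝ≥0 → ℝ)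

/-- Data of a non-stationary reward model on the finite state space `S`; time is `ℝ≥0`.
The cdf's of the lump-sum rewards are represented by the corresponding probability measures
on `ℝ`, so that `G(t, x, y, z) = cdf (G t x y) z`. -/
structure RewardModel (S : Type*) where
  /-- rate matrices -/
  Q : ℝ≥0 → Matrix S S ℝ
  /-- reward rates -/
  r : ℝ≥0 → S → ℝ
  /-- intensity of the external rewards -/
  β : ℝ≥0 → S → ℝ
  /-- law of the reward for a jump from `x` to `y` at time `t` -/
  G : ℝ≥0 → S → S → ProbabilityMeasure ℝ
  /-- law of a scheduled reward collected at time `t` in state `x` -/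
  H : ℝ≥0 → S → ProbabilityMeasure ℝ
  /-- law of an external reward collected at time `t` in state `x` -/
  K : ℝ≥0 → S → ProbabilityMeasure ℝ
  /-- the deterministic times `0 = t_0 < t_1 < t_2 < ...` of the scheduled rewards -/
  τ : ℕ → ℝ≥0
  τ_zero : τ 0 = 0
  τ_strictMono : StrictMono τ
  τ_tendsto : Tendsto τ atTop atTop

/-- A rate matrix: non-negative off-diagonal entries and zero row sums. -/
def IsRateMatrix {S : Type*} [Fintype S] (A : Matrix S S ℝ) : Prop :=
  (∀ x y, x ≠ y → 0 ≤ A x y) ∧ ∀ x, ∑ y, A x y = 0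

/-- Irreducibility of a rate matrix: every state can be reached from every other one through
transitions of positive rate. -/
def IsIrreducibleRate {S : Type*} (A : Matrix S S ℝ) : Prop :=
  ∀ x y, Relation.ReflTransGen (fun a b => 0 < A a b) x y

/-- Stochastic matrices `P s t`, `s ≤ t`, solving the Kolmogorov backward and forward integral
equations for the rate matrices `Q`. -/
structure IsTransitionFamily {S : Type*} [Fintype S] [DecidableEq S]
    (Q : ℝ≥0 → Matrix S S ℝ) (P : ℝ≥0 → ℝ≥0 → Matrix S S ℝ) : Prop where
  stochastic : ∀ s t, s ≤ t → P s t ∈ Matrix.rowStochastic ℝ S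
  backward : ∀ s t, s ≤ t → ∀ x y,
    IntegrableOn (fun u => (Q u * P u t) x y) (Set.Ioc s t) leb ∧
      P s t x y = (1 : Matrix S S ℝ) x y + ∫ u in Set.Ioc s t, (Q u * P u t) x y ∂leb
  forward : ∀ s t, s ≤ t → ∀ x y,
    IntegrableOn (fun u => (P s u * Q u) x y) (Set.Ioc s t) leb ∧
      P s t x y = (1 : Matrix S S ℝ) x y + ∫ u in Set.Ioc s t, (P s u * Q u) x y ∂leb

namespace RewardModel

variable {S : Type*}

/-- The set of pairs `(x, y)` with `Q(1, x, y) > 0`. -/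
def B (m : RewardModel S) : Set (S × S) := {p | 0 < m.Q 1 p.1 p.2}

open scoped Classical in
/-- `γ₁(t, x) = ∑_{(x, y) ∈ B} Q(t, x, y) ∫_0^∞ z G(t, x, y, dz)`. -/
noncomputable def gamma1 [Fintype S] (m : RewardModel S) (t : ℝ≥0) (x : S) : ℝ :=
  ∑ y with (x, y) ∈ m.B, m.Q t x y * ∫ z in Set.Ici (0 : ℝ), z ∂(m.G t x y : Measure ℝ)

/-- `γ₂(t, x) = β(t, x) ∫_0^∞ z K(t, x, dz)`. -/
noncomputable def gamma2 (m : RewardModel S) (t : ℝ≥0) (x : S) : ℝ :=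
  m.β t x * ∫ z in Set.Ici (0 : ℝ), z ∂(m.K t x : Measure ℝ)

/-- `γ = γ₁ + γ₂`. -/
noncomputable def gamma [Fintype S] (m : RewardModel S) (t : ℝ≥0) (x : S) : ℝ :=
  m.gamma1 t x + m.gamma2 t x

/-- `r̃ = r + γ`. -/
noncomputable def rTilde [Fintype S] (m : RewardModel S) (t : ℝ≥0) (x : S) : ℝ :=
  m.r t x + m.gamma t x

/-- Mean scheduled reward `h(t, x) = ∫_0^∞ z H(t, x, dz)`. -/
noncomputable def h (m : RewardModel S) (t : ℝ≥0) (x : S) : ℝ :=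
  ∫ z in Set.Ici (0 : ℝ), z ∂(m.H t x : Measure ℝ)

/-- Assumption A1: measurability in time. -/
structure A1 (m : RewardModel S) : Prop where
  Q : ∀ x y, Measurable fun t => m.Q t x y
  r : ∀ x, Measurable fun t => m.r t x
  G : ∀ x y z, Measurable fun t => ProbabilityTheory.cdf (m.G t x y : Measure ℝ) z
  K : ∀ x z, Measurable fun t => ProbabilityTheory.cdf (m.K t x : Measure ℝ) z
  β : ∀ x, Measurable fun t => m.β t x

/-- Assumption A2: irreducible rate matrices with a set of possible transitions that does not
depend on time. -/
structure A2 [Fintype S] (m : RewardModel S) : Prop where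
  rate : ∀ t, IsRateMatrix (m.Q t)
  indep : ∀ t, {p : S × S | 0 < m.Q t p.1 p.2} = m.B
  irreducible : IsIrreducibleRate (m.Q 1)

/-- Assumption A3: the positive rates are bounded above and bounded away from zero. -/
def A3 (m : RewardModel S) : Prop :=
  ∀ x y, (x, y) ∈ m.B → 0 < (⨅ t, m.Q t x y) ∧ BddAbove (Set.range fun t => m.Q t x y)

/-- Assumption A4: rewards are non-negative and bounded, and the infimal rates of reward accrual
are positive. `G(t, x, y, 0-)` is the mass of `Iio 0`. -/
structure A4 [Fintype S] (m : RewardModel S) : Prop where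
  r_nonneg : ∀ t x, 0 ≤ m.r t x
  r_bdd : ∀ x, BddAbove (Set.range fun t => m.r t x)
  β_nonneg : ∀ t x, 0 ≤ m.β t x
  β_bdd : ∀ x, BddAbove (Set.range fun t => m.β t x)
  lump : ∃ c : S → ℝ,
    (∀ t x y, (m.G t x y : Measure ℝ) (Set.Iio 0) = 0 ∧
      (m.G t x y : Measure ℝ) (Set.Iic (c x)) = 1) ∧
    (∀ t x, (m.H t x : Measure ℝ) (Set.Iio 0) = 0 ∧
      (m.H t x : Measure ℝ) (Set.Iic (c x)) = 1) ∧
    (∀ t x, (m.K t x : Measure ℝ) (Set.Iio 0) = 0 ∧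
      (m.K t x : Measure ℝ) (Set.Iic (c x)) = 1)
  accrual : ∀ x, 0 < (⨅ t, m.r t x) + ⨅ t, m.gamma t x

/-- Assumption A5: the gaps between scheduled times are bounded away from zero. -/
def A5 (m : RewardModel S) : Prop :=
  0 < ⨅ i : ℕ, ((m.τ (i + 1) : ℝ) - (m.τ i : ℝ))

/-- `n(t) = sup {i : t_i ≤ t}`. -/
noncomputable def numScheduled (m : RewardModel S) (t : ℝ≥0) : ℕ := sSup {i | m.τ i ≤ t}

end RewardModel

/-- The random objects: the jump process `X`, the counting process `N` of external events, the
reward `jumpReward j` of the `j`-th jump of `X`, the reward `schedReward i` collected at the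
scheduled time `t_i` and the reward `extReward k` collected at the `k`-th event of `N`
(`i, j, k ≥ 1`). -/
structure RewardProcess (Ω S : Type*) where
  X : ℝ≥0 → Ω → S
  N : ℝ≥0 → Ω → ℕ
  jumpReward : ℕ → Ω → ℝ
  schedReward : ℕ → Ω → ℝ
  extReward : ℕ → Ω → ℝ

namespace RewardProcess

variable {Ω S : Type*}

/-- `J(t)`: the number of jumps of `X` in `[0, t]`. (There is no jump at time `0`, because
`𝓝[<] 0 = ⊥` in `ℝ≥0`.) -/
noncomputable def J (p : RewardProcess Ω S) (t : ℝ≥0) (ω : Ω) : ℕ :=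
  {u | u ≤ t ∧ ¬ ∀ᶠ s in 𝓝[<] u, p.X s ω = p.X u ω}.ncard

/-- `T_j`: the time of the `j`-th jump of `X` (meaningful if there are at least `j` jumps);
`T_0 = 0`. -/
noncomputable def T (p : RewardProcess Ω S) (j : ℕ) (ω : Ω) : ℝ≥0 := sInf {t | j ≤ p.J t ω}

/-- `Y_j = X(T_j)`, and in particular `Y_0 = X(0)`. -/
noncomputable def Y (p : RewardProcess Ω S) (j : ℕ) (ω : Ω) : S := p.X (p.T j ω) ω

/-- `Λ_k`: the time of the `k`-th event of `N` (meaningful if there are at least `k` events). -/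
noncomputable def eventTime (p : RewardProcess Ω S) (k : ℕ) (ω : Ω) : ℝ≥0 :=
  sInf {t | k ≤ p.N t ω}

/-- `σ(X(s) : s ≤ t)`. -/
abbrev sigmaXUpTo [MeasurableSpace S] (p : RewardProcess Ω S) (t : ℝ≥0) : MeasurableSpace Ω :=
  ⨆ s ∈ Set.Iic t, MeasurableSpace.comap (p.X s) inferInstance

/-- `σ(X)`. -/
abbrev sigmaX [MeasurableSpace S] (p : RewardProcess Ω S) : MeasurableSpace Ω :=
  ⨆ s, MeasurableSpace.comap (p.X s) inferInstance

/-- `σ(X, N)`. -/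
abbrev sigmaXN [MeasurableSpace S] (p : RewardProcess Ω S) : MeasurableSpace Ω :=
  p.sigmaX ⊔ ⨆ s, MeasurableSpace.comap (p.N s) inferInstance

/-- `X` is a right-continuous jump process (finitely many jumps in bounded intervals, that is,
right-continuous with left limits in the discrete space `S`) with the Markov property, whose
transition matrices are `P`. Its initial distribution is arbitrary. -/
structure IsMarkovJump [MeasurableSpace S] [MeasurableSpace Ω]
    (p : RewardProcess Ω S) (P : ℝ≥0 → ℝ≥0 → Matrix S S ℝ) (Pr : Measure Ω) : Prop where
  measurable : ∀ t, Measurable (p.X t)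
  right_cont : ∀ t ω, ∀ᶠ s in 𝓝[>] t, p.X s ω = p.X t ω
  left_lim : ∀ t ω, ∃ x, ∀ᶠ s in 𝓝[<] t, p.X s ω = x
  markov : ∀ s t, s ≤ t → ∀ y,
    Pr[(p.X t ⁻¹' {y}).indicator (fun _ => (1 : ℝ)) | p.sigmaXUpTo s]
      =ᵐ[Pr] fun ω => P s t (p.X s ω) y

/-- Given `X`, the process `N` is a Poisson counting process with intensity `β(t, X(t))`: its
increments over disjoint intervals `(s, t]` are conditionally independent and Poisson distributed
with means `∫_s^t β(u, X(u)) du`. -/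
structure IsCoxCounting [MeasurableSpace S] [MeasurableSpace Ω]
    (p : RewardProcess Ω S) (β : ℝ≥0 → S → ℝ) (Pr : Measure Ω) : Prop where
  measurable : ∀ t, Measurable (p.N t)
  zero : ∀ ω, p.N 0 ω = 0
  mono : ∀ ω, Monotone fun t => p.N t ω
  right_cont : ∀ t ω, ∀ᶠ s in 𝓝[>] t, p.N s ω = p.N t ω
  unit_jumps : ∀ t ω, ∀ᶠ s in 𝓝[<] t, p.N t ω ≤ p.N s ω + 1
  poisson : ∀ (n : ℕ) (s : ℕ → ℝ≥0), Monotone s → ∀ k : ℕ → ℕ,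
    Pr[({ω | ∀ i < n, p.N (s (i + 1)) ω = p.N (s i) ω + k i}).indicator
        (fun _ => (1 : ℝ)) | p.sigmaX]
      =ᵐ[Pr] fun ω => ∏ i ∈ Finset.range n,
        (Real.exp (-∫ u in Set.Ioc (s i) (s (i + 1)), β u (p.X u ω) ∂leb) *
          (∫ u in Set.Ioc (s i) (s (i + 1)), β u (p.X u ω) ∂leb) ^ k i / (k i).factorial)

/-- Given `X` and `N`, the lump-sum rewards are independent; the reward of the `j`-th jump has
law `G(T_j, Y_{j-1}, Y_j, ·)`, the `i`-th scheduled reward has law `H(t_i, X(t_i), ·)` and the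
reward of the `k`-th external event has law `K(Λ_k, X(Λ_k), ·)`. The condition on the first `a`
jump rewards and the first `c` external rewards is imposed only where there are at least `a` jumps
and `c` external events. -/
structure HasLumpLaws [MeasurableSpace S] [MeasurableSpace Ω]
    (p : RewardProcess Ω S) (m : RewardModel S) (Pr : Measure Ω) : Prop where
  measurable_jump : ∀ j, Measurable (p.jumpReward j)
  measurable_sched : ∀ i, Measurable (p.schedReward i)
  measurable_ext : ∀ k, Measurable (p.extReward k)
  law : ∀ (a b c : ℕ) (u v w : ℕ → ℝ), ∀ᵐ ω ∂Pr,
    (∃ t, a ≤ p.J t ω) → (∃ t, c ≤ p.N t ω) →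
    (Pr[({ω | (∀ j < a, p.jumpReward (j + 1) ω ≤ u j) ∧
          (∀ i < b, p.schedReward (i + 1) ω ≤ v i) ∧
          (∀ k < c, p.extReward (k + 1) ω ≤ w k)}).indicator (fun _ => (1 : ℝ)) | p.sigmaXN]) ω
      = (∏ j ∈ Finset.range a, ProbabilityTheory.cdf
            (m.G (p.T (j + 1) ω) (p.Y j ω) (p.Y (j + 1) ω) : Measure ℝ) (u j)) *
        (∏ i ∈ Finset.range b, ProbabilityTheory.cdf
            (m.H (m.τ (i + 1)) (p.X (m.τ (i + 1)) ω) : Measure ℝ) (v i)) *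
        (∏ k ∈ Finset.range c, ProbabilityTheory.cdf
            (m.K (p.eventTime (k + 1) ω) (p.X (p.eventTime (k + 1) ω) ω) : Measure ℝ) (w k))

/-- Jump rewards collected in `[0, t]`. -/
noncomputable def jumpSum (p : RewardProcess Ω S) (t : ℝ≥0) (ω : Ω) : ℝ :=
  ∑ j ∈ Finset.Icc 1 (p.J t ω), p.jumpReward j ω

/-- Scheduled rewards collected in `[0, t]`. -/
noncomputable def schedSum (p : RewardProcess Ω S) (m : RewardModel S) (t : ℝ≥0) (ω : Ω) : ℝ :=
  ∑ i ∈ Finset.Icc 1 (m.numScheduled t), p.schedReward i ω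

/-- External rewards collected in `[0, t]`. -/
noncomputable def extSum (p : RewardProcess Ω S) (t : ℝ≥0) (ω : Ω) : ℝ :=
  ∑ k ∈ Finset.Icc 1 (p.N t ω), p.extReward k ω

/-- The cumulative reward `R(t)`. -/
noncomputable def R (p : RewardProcess Ω S) (m : RewardModel S) (t : ℝ≥0) (ω : Ω) : ℝ :=
  (∫ s in Set.Ioc 0 t, m.r s (p.X s ω) ∂leb) + p.jumpSum t ω + p.schedSum m t ω + p.extSum t ω

/-- The history up to time `t`: the σ-algebra generated by `X`, `N` and the three processes of
collected lump-sum rewards on `[0, t]`. -/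
noncomputable abbrev history [MeasurableSpace S] (p : RewardProcess Ω S) (m : RewardModel S) (t : ℝ≥0) :
    MeasurableSpace Ω :=
  ⨆ s ∈ Set.Iic t,
    MeasurableSpace.comap (p.X s) inferInstance ⊔ MeasurableSpace.comap (p.N s) inferInstance ⊔
    MeasurableSpace.comap (p.jumpSum s) inferInstance ⊔
    MeasurableSpace.comap (p.schedSum m s) inferInstance ⊔
    MeasurableSpace.comap (p.extSum s) inferInstance

variable [Fintype S] [MeasurableSpace Ω]

/-- `E_{t,x} f(X(u))` for `t ≤ u`. -/
def condMean (P : ℝ≥0 → ℝ≥0 → Matrix S S ℝ) (t : ℝ≥0) (x : S) (u : ℝ≥0) (f : S → ℝ) : ℝ :=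
  ∑ y, P t u x y * f y

/-- `r̃_c(t, x) = r̃(t, x) - E r̃(t, X(t))`. -/
noncomputable def rTildeC (p : RewardProcess Ω S) (m : RewardModel S) (Pr : Measure Ω)
    (t : ℝ≥0) (x : S) : ℝ :=
  m.rTilde t x - ∫ ω, m.rTilde t (p.X t ω) ∂Pr

/-- The mean of the centered scheduled reward in state `x`:
`h_c(t, x) = h(t, x) - E h(t, X(t))`. -/
noncomputable def hC (p : RewardProcess Ω S) (m : RewardModel S) (Pr : Measure Ω)
    (t : ℝ≥0) (x : S) : ℝ :=
  m.h t x - ∫ ω, m.h t (p.X t ω) ∂Pr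

/-- The integrand `E_{t,x} r̃_c(t+u, X(t+u))` of `ν₁`. -/
noncomputable def nu1Integrand (p : RewardProcess Ω S) (m : RewardModel S)
    (P : ℝ≥0 → ℝ≥0 → Matrix S S ℝ) (Pr : Measure Ω) (t : ℝ≥0) (x : S) (u : ℝ≥0) : ℝ :=
  condMean P t x (t + u) (p.rTildeC m Pr (t + u))

/-- The term `E_{t,x} ℋ_c(t_i, X(t_i))` of `ν₂`, for `t < t_i`. -/
noncomputable def nu2Term (p : RewardProcess Ω S) (m : RewardModel S)
    (P : ℝ≥0 → ℝ≥0 → Matrix S S ℝ) (Pr : Measure Ω) (t : ℝ≥0) (x : S)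
    (i : {i : ℕ // t < m.τ i}) : ℝ :=
  condMean P t x (m.τ i) (p.hC m Pr (m.τ i))

/-- `ν₁(t, x) = ∫_0^∞ E_{t,x} r̃_c(t+u, X(t+u)) du`. -/
noncomputable def nu1 (p : RewardProcess Ω S) (m : RewardModel S)
    (P : ℝ≥0 → ℝ≥0 → Matrix S S ℝ) (Pr : Measure Ω) (t : ℝ≥0) (x : S) : ℝ :=
  ∫ u : ℝ≥0, p.nu1Integrand m P Pr t x u ∂leb

/-- `ν₂(t, x) = ∑_{i : t_i > t} E_{t,x} ℋ_c(t_i, X(t_i))`. -/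
noncomputable def nu2 (p : RewardProcess Ω S) (m : RewardModel S)
    (P : ℝ≥0 → ℝ≥0 → Matrix S S ℝ) (Pr : Measure Ω) (t : ℝ≥0) (x : S) : ℝ :=
  ∑' i : {i : ℕ // t < m.τ i}, p.nu2Term m P Pr t x i

/-- `ν = ν₁ + ν₂`. -/
noncomputable def nu (p : RewardProcess Ω S) (m : RewardModel S)
    (P : ℝ≥0 → ℝ≥0 → Matrix S S ℝ) (Pr : Measure Ω) (t : ℝ≥0) (x : S) : ℝ :=
  p.nu1 m P Pr t x + p.nu2 m P Pr t x

/-- `M(t) = R(t) - E R(t) + ν(t, X(t))`. -/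
noncomputable def M (p : RewardProcess Ω S) (m : RewardModel S)
    (P : ℝ≥0 → ℝ≥0 → Matrix S S ℝ) (Pr : Measure Ω) (t : ℝ≥0) (ω : Ω) : ℝ :=
  p.R m t ω - (∫ ω', p.R m t ω' ∂Pr) + p.nu m P Pr t (p.X t ω)

end RewardProcess

/-! The theorem rests on two facts. The first is ergodicity. The possible transitions have rates
bounded below and connect all states, so over some fixed time `L` every transition probability is at
least some `δ > 0`, uniformly in the starting time (`exists_minorization`). By Dobrushin's
contraction, conditional means of a bounded centred function decay exponentially in the lag
(`exists_exp_bound`, `exists_centered_bound`). This dominates the integrand of `ν₁` by an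
exponential and, the gaps between scheduled times being bounded below, the terms of `ν₂` by a
geometric series. Convergence and boundedness follow (`exists_nu_bounds`).

The second is the compensator of `R`: for `A` in the history at `s`, the mean of `R t - R s` on `A`
is the integral over `(s, t]` of the mean of `r̃(u, X u)` on `A`, plus the means of `h` at the
scheduled times in `(s, t]` (`R_increment`). On the other hand `ν(t, X t)` is the expected future
excess, so its mean on `A` drops between `s` and `t` by the same expression with `r̃` and `h`
centred (`setIntegral_nu_sub`). Subtracting `P(A)` times the case `A = Ω` centres the former, and
the two changes cancel.

The labour lies in the compensator, as `X`, `N` and the rewards are given only by conditional laws.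
For `X` and `N`, a count over a short interval has its expected mean up to a quadratic error;
summation over partitions gives mean counts on intervals (`integral_transitions`,
`integral_points`), and Campbell's formula extends them to weights depending on time. For the
rewards, the history is contained in the σ-algebra generated by a π-system of cells: an event of `X`
and `N` up to `s` with fixed counts, and upper bounds on the rewards already collected. The
conditional probability of a cell given `X` and `N` depends only on their past
(`measurable_cellWeight`), so identities for the past of `X` and `N` carry over to cells and thence
to the history (`setLIntegral_history_congr`). -/

/-! ### Lebesgue measure on the time axis -/

theorem map_coe_leb : leb.map ((↑) : ℝ≥0 → ℝ) = volume.restrict (Set.Ici 0) := by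
  have h : MeasurableEmbedding ((↑) : ℝ≥0 → ℝ) := MeasurableEmbedding.subtype_coe measurableSet_Ici
  rw [leb, h.map_comap]
  congr 1
  ext x
  simp

theorem measurableEmbedding_nnrealCoe : MeasurableEmbedding ((↑) : ℝ≥0 → ℝ) :=
  MeasurableEmbedding.subtype_coe measurableSet_Ici

theorem leb_preimage (A : Set ℝ) (hA : MeasurableSet A) :
    leb (((↑) : ℝ≥0 → ℝ) ⁻¹' A) = volume (A ∩ Set.Ici 0) := by
  rw [← measurableEmbedding_nnrealCoe.map_apply, map_coe_leb, Measure.restrict_apply hA]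

theorem leb_Ioc (a b : ℝ≥0) : leb (Set.Ioc a b) = ENNReal.ofReal (b - a) := by
  have : Set.Ioc a b = ((↑) : ℝ≥0 → ℝ) ⁻¹' (Set.Ioc (a : ℝ) b) := by ext; simp
  rw [this, leb_preimage _ measurableSet_Ioc, Set.inter_eq_left.2, Real.volume_Ioc]
  intro x hx
  exact a.2.trans hx.1.le

theorem leb_Iic (b : ℝ≥0) : leb (Set.Iic b) = ENNReal.ofReal b := by
  have : Set.Iic b = ((↑) : ℝ≥0 → ℝ) ⁻¹' (Set.Iic (b : ℝ)) := by ext; simp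
  rw [this, leb_preimage _ measurableSet_Iic]
  have : Set.Iic (b : ℝ) ∩ Set.Ici 0 = Set.Icc 0 (b : ℝ) := by ext; simp [and_comm]
  rw [this, Real.volume_Icc, sub_zero]

/-- Serves the theorems of Fubini and Tonelli, where time and sample point are exchanged. -/
instance : SigmaFinite leb :=
  ⟨⟨{ set := fun n => Set.Iic (n : ℝ≥0)
      set_mem := fun _ => trivial
      finite := fun n => by rw [leb_Iic]; exact ENNReal.ofReal_lt_top
      spanning := Set.eq_univ_of_forall fun x => Set.mem_iUnion.2 (exists_nat_ge x) }⟩⟩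

theorem leb_real_Ioc {a b : ℝ≥0} (h : a ≤ b) : leb.real (Set.Ioc a b) = b - a := by
  rw [Measure.real, leb_Ioc, ENNReal.toReal_ofReal (sub_nonneg.2 (by exact_mod_cast h))]

theorem leb_Ioc_lt_top (a b : ℝ≥0) : leb (Set.Ioc a b) < ⊤ := by
  rw [leb_Ioc]; exact ENNReal.ofReal_lt_top

instance (a b : ℝ≥0) : IsFiniteMeasure (leb.restrict (Set.Ioc a b)) :=
  ⟨by rw [Measure.restrict_apply_univ]; exact leb_Ioc_lt_top a b⟩

/-- Set integrals over `leb` as integrals over the real line. -/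
theorem setIntegral_leb_Ioc (a b : ℝ≥0) (f : ℝ → ℝ) :
    ∫ u in Set.Ioc a b, f u ∂leb = ∫ u in Set.Ioc (a : ℝ) b, f u := by
  have h1 : Set.Ioc a b = ((↑) : ℝ≥0 → ℝ) ⁻¹' (Set.Ioc (a : ℝ) b) := by ext; simp
  rw [h1, ← measurableEmbedding_nnrealCoe.setIntegral_map, map_coe_leb, Measure.restrict_restrict measurableSet_Ioc,
    Set.inter_eq_left.2]
  intro x hx
  exact a.2.trans hx.1.le

theorem norm_setIntegral_leb_Ioc_le {a b : ℝ≥0} (hab : a ≤ b) {f : ℝ≥0 → ℝ} {C : ℝ}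
    (hf : ∀ u ∈ Set.Ioc a b, |f u| ≤ C) : |∫ u in Set.Ioc a b, f u ∂leb| ≤ C * (b - a) := by
  have := norm_setIntegral_le_of_norm_le_const (μ := leb) (f := f) (leb_Ioc_lt_top a b) hf
  rwa [leb_real_Ioc hab] at this

/-- Translation invariance of `leb`. -/
theorem map_add_leb (t : ℝ≥0) : leb.map (fun u => t + u) = leb.restrict (Set.Ici t) := by
  have hm : Measurable (fun u : ℝ≥0 => t + u) := measurable_const_add t
  apply Measure.ext
  intro A hA
  obtain ⟨A', hA', rfl⟩ : ∃ A', MeasurableSet A' ∧ ((↑) : ℝ≥0 → ℝ) ⁻¹' A' = A :=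
    ⟨_, measurableEmbedding_nnrealCoe.measurableSet_image.2 hA,
      Set.preimage_image_eq _ NNReal.coe_injective⟩
  rw [Measure.map_apply hm hA, Measure.restrict_apply hA]
  have e1 : (fun u : ℝ≥0 => t + u) ⁻¹' (((↑) : ℝ≥0 → ℝ) ⁻¹' A') =
      ((↑) : ℝ≥0 → ℝ) ⁻¹' ((fun u : ℝ => (t : ℝ) + u) ⁻¹' A') := by ext; simp
  have e2 : ((↑) : ℝ≥0 → ℝ) ⁻¹' A' ∩ Set.Ici t = ((↑) : ℝ≥0 → ℝ) ⁻¹' (A' ∩ Set.Ici (t : ℝ)) := by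
    ext; simp
  rw [e1, e2, leb_preimage _ (measurable_const_add _ hA'), leb_preimage _ (hA'.inter measurableSet_Ici)]
  have e3 : A' ∩ Set.Ici (t : ℝ) ∩ Set.Ici 0 = A' ∩ Set.Ici (t : ℝ) := by
    rw [Set.inter_eq_left]
    intro x hx
    exact t.2.trans hx.2
  have e4 : ((fun u : ℝ => (t : ℝ) + u) ⁻¹' A') ∩ Set.Ici 0 =
      (fun u : ℝ => (t : ℝ) + u) ⁻¹' (A' ∩ Set.Ici (t : ℝ)) := by ext; simp
  rw [e3, e4, measure_preimage_add]

/-- Splitting of set integrals over consecutive intervals. -/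
theorem setIntegral_leb_Ioc_add {a b c : ℝ≥0} (hab : a ≤ b) (hbc : b ≤ c) {f : ℝ≥0 → ℝ}
    (hf : IntegrableOn f (Set.Ioc a c) leb) :
    ∫ u in Set.Ioc a c, f u ∂leb =
      (∫ u in Set.Ioc a b, f u ∂leb) + ∫ u in Set.Ioc b c, f u ∂leb := by
  rw [← Set.Ioc_union_Ioc_eq_Ioc hab hbc] at hf ⊢
  exact setIntegral_union (Set.Ioc_disjoint_Ioc_of_le le_rfl) measurableSet_Ioc
    (hf.mono_set Set.subset_union_left) (hf.mono_set Set.subset_union_right)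
theorem integrableOn_leb_Ioc_of_bound {a b : ℝ≥0} {f : ℝ≥0 → ℝ} (hf : Measurable f) {C : ℝ}
    (hC : ∀ u, |f u| ≤ C) : IntegrableOn f (Set.Ioc a b) leb :=
  Integrable.of_bound hf.aestronglyMeasurable C (ae_of_all _ hC)
set_option linter.unusedSectionVars false
-- Partitions of an interval and additive interval functions
/-- The `i`-th point of the partition of `[a, b]` into `n` intervals of equal length. -/
noncomputable def grid (a b : ℝ≥0) (n i : ℕ) : ℝ≥0 := a + (b - a) * i / n

theorem grid_zero (a b : ℝ≥0) (n : ℕ) : grid a b n 0 = a := by simp [grid]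

theorem grid_self {a b : ℝ≥0} (h : a ≤ b) {n : ℕ} (hn : n ≠ 0) : grid a b n n = b := by
  have : (n : ℝ≥0) ≠ 0 := by exact_mod_cast hn
  rw [grid, mul_div_assoc, div_self this, mul_one, add_tsub_cancel_of_le h]

theorem grid_mono (a b : ℝ≥0) (n : ℕ) : Monotone (grid a b n) := by
  intro i j hij
  unfold grid
  gcongr

theorem grid_succ_sub {a b : ℝ≥0} (h : a ≤ b) (n i : ℕ) :
    (grid a b n (i + 1) : ℝ) - grid a b n i = (b - a) / n := by
  simp only [grid, NNReal.coe_add, NNReal.coe_div, NNReal.coe_mul, NNReal.coe_sub h,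
    NNReal.coe_natCast]
  push_cast
  ring

theorem left_le_grid (a b : ℝ≥0) (n i : ℕ) : a ≤ grid a b n i := le_self_add

theorem grid_le_right {a b : ℝ≥0} (h : a ≤ b) {n i : ℕ} (hi : i ≤ n) : grid a b n i ≤ b := by
  rcases Nat.eq_zero_or_pos n with rfl | hn
  · simpa [grid] using h
  · exact (grid_mono a b n hi).trans_eq (grid_self h hn.ne')

/-- An additive interval function agrees with the sums over fine partitions of any interval
function which agrees with it locally. -/
theorem eventually_sum_grid_eq {V F : ℝ≥0 → ℝ≥0 → ℝ}
    (hV : ∀ c d e, c ≤ d → d ≤ e → V c e = V c d + V d e)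
    (hF : ∀ u, ∃ U ∈ 𝓝 u, ∀ c ∈ U, ∀ d ∈ U, c ≤ d → F c d = V c d) {a b : ℝ≥0} (hab : a ≤ b) :
    ∀ᶠ n : ℕ in atTop, ∑ i ∈ Finset.range n, F (grid a b n i) (grid a b n (i + 1)) = V a b := by
  choose U hU hFU using hF
  -- Once the mesh is below a Lebesgue number of the cover, neighbouring grid points lie in a common
  -- `U y`, so `F` and `V` agree on every interval of the partition and additivity sums them up.
  obtain ⟨δ, hδ, hball⟩ := lebesgue_number_lemma_of_metric (isCompact_Icc (a := a) (b := b))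
    (c := fun u => interior (U u)) (fun _ => isOpen_interior)
    (fun u _ => Set.mem_iUnion.2 ⟨u, mem_interior_iff_mem_nhds.2 (hU u)⟩)
  obtain ⟨n0, hn0⟩ := exists_nat_gt (((b : ℝ) - a) / δ)
  have hab' : (a : ℝ) ≤ b := by exact_mod_cast hab
  filter_upwards [eventually_ge_atTop (n0 + 1)] with n hn
  have hnpos : (0 : ℝ) < n := by exact_mod_cast (by omega : 0 < n)
  have hlt : ((b : ℝ) - a) / n < δ := by
    rw [div_lt_iff₀ hδ] at hn0
    rw [div_lt_iff₀ hnpos]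
    have : (n0 : ℝ) ≤ n := by exact_mod_cast (by omega : n0 ≤ n)
    nlinarith
  have key : ∀ k ≤ n, ∑ i ∈ Finset.range k, F (grid a b n i) (grid a b n (i + 1))
      = V a (grid a b n k) := by
    intro k
    induction k with
    | zero =>
      intro _
      -- Additivity on the degenerate interval gives `V a a = 0`.
      have := hV a a a le_rfl le_rfl
      simp [grid_zero]
      linarith
    | succ k ih =>
      intro hk
      rw [Finset.sum_range_succ, ih (by omega),
        hV a (grid a b n k) _ (left_le_grid _ _ _ _) (grid_mono a b n k.le_succ)]
      congr 1
      obtain ⟨y, hy⟩ := hball (grid a b n k) ⟨left_le_grid _ _ _ _, grid_le_right hab (by omega)⟩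
      refine hFU y _ (interior_subset (hy (Metric.mem_ball_self hδ))) _ (interior_subset (hy ?_)) (grid_mono a b n k.le_succ)
      rw [Metric.mem_ball, NNReal.dist_eq, grid_succ_sub hab, abs_of_nonneg]
      · exact hlt
      · exact div_nonneg (sub_nonneg.2 hab') hnpos.le
  rw [key n le_rfl, grid_self hab (by omega)]

/-! ### Jump paths, counting paths and hitting times of levels -/

section Paths

variable {S : Type*}

/-- Paths that are right-continuous with left limits for the discrete topology. -/
structure IsJumpPath (x : ℝ≥0 → S) : Prop where
  right_cont : ∀ t, ∀ᶠ s in 𝓝[>] t, x s = x t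
  left_lim : ∀ t, ∃ y, ∀ᶠ s in 𝓝[<] t, x s = y

/-- Packs both one-sided conditions into one neighbourhood of `u`, the form that local arguments
over partitions need. -/
theorem IsJumpPath.eventually_nhds {x : ℝ≥0 → S} (hx : IsJumpPath x) (u : ℝ≥0) :
    ∃ y, ∀ᶠ v in 𝓝 u, (v < u → x v = y) ∧ (u ≤ v → x v = x u) := by
  obtain ⟨y, hy⟩ := hx.left_lim u
  refine ⟨y, (eventually_nhdsWithin_iff.1 hy).and ?_⟩
  filter_upwards [eventually_nhdsWithin_iff.1 (hx.right_cont u)] with v hv huv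
  rcases huv.eq_or_lt with rfl | h
  · rfl
  · exact hv h

/-- The jump times of a path. -/
def jumpTimes (x : ℝ≥0 → S) : Set ℝ≥0 := {u | ¬ ∀ᶠ s in 𝓝[<] u, x s = x u}

/-- The number of jumps in `[0, t]`. -/
noncomputable def jumpCount (x : ℝ≥0 → S) (t : ℝ≥0) : ℕ := {u | u ≤ t ∧ u ∈ jumpTimes x}.ncard

/-- On each side of `u`, close to it, the path is constant, so jump times cannot accumulate at `u`.
-/
theorem IsJumpPath.eventually_notMem_jumpTimes {x : ℝ≥0 → S} (hx : IsJumpPath x) (u : ℝ≥0) :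
    ∀ᶠ v in 𝓝 u, v ∈ jumpTimes x → v = u := by
  obtain ⟨y, hy⟩ := hx.eventually_nhds u
  filter_upwards [hy.eventually_nhds, hy] with v hv hv0 hvJ
  by_contra hne
  apply hvJ
  rcases lt_or_gt_of_ne hne with h | h
  · filter_upwards [nhdsWithin_le_nhds hv, self_mem_nhdsWithin] with w hw hwv
    rw [hw.1 (lt_trans hwv h), hv0.1 h]
  · filter_upwards [nhdsWithin_le_nhds hv, nhdsWithin_le_nhds (lt_mem_nhds h)] with w hw hwv
    rw [hw.2 (le_of_lt hwv), hv0.2 h.le]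

/-- A set without accumulation points meets a compact interval in finitely many points. Hence
`ncard` in `jumpCount` is a true count and not the default value `0`. -/
theorem IsJumpPath.finite_jumpTimes {x : ℝ≥0 → S} (hx : IsJumpPath x) (t : ℝ≥0) :
    {u | u ≤ t ∧ u ∈ jumpTimes x}.Finite := by
  have : (Set.Icc 0 t ∩ jumpTimes x).Finite := by
    refine (isCompact_Icc (a := (0 : ℝ≥0)) (b := t)).induction_on
      (p := fun s => (s ∩ jumpTimes x).Finite) (by simp) ?_ ?_ ?_
    · exact fun s s' h h' => h'.subset (Set.inter_subset_inter_left _ h)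
    · intro s s' h h'
      rw [Set.union_inter_distrib_right]
      exact h.union h'
    · intro u _
      refine ⟨_, nhdsWithin_le_nhds (hx.eventually_notMem_jumpTimes u), ?_⟩
      exact (Set.finite_singleton u).subset fun v hv => hv.1 hv.2
  exact this.subset fun u hu => ⟨⟨zero_le, hu.1⟩, hu.2⟩

/-- Local constancy propagates along the connected interval `[c, d]`. At `c` itself only
right-continuity enters, so a jump at `c` does no harm. -/
theorem IsJumpPath.eq_of_disjoint_jumpTimes {x : ℝ≥0 → S} (hx : IsJumpPath x) {c d : ℝ≥0} (hcd : c ≤ d)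
    (h : ∀ u ∈ Set.Ioc c d, u ∉ jumpTimes x) : x c = x d := by
  refine isPreconnected_Icc.induction₂ (s := Set.Icc c d) (fun u v => x u = x v) ?_
    (fun _ _ _ _ _ _ => Eq.trans) (fun _ _ _ _ => Eq.symm) (Set.left_mem_Icc.2 hcd) (Set.right_mem_Icc.2 hcd)
  intro u hu
  have hr := eventually_nhdsWithin_iff.1 (hx.right_cont u)
  rcases hu.1.eq_or_lt with rfl | hlt
  · filter_upwards [nhdsWithin_le_nhds hr, self_mem_nhdsWithin] with v hv hv'
    rcases hv'.1.eq_or_lt with rfl | h'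
    · rfl
    · exact (hv h').symm
  · have hl := not_not.1 (h u ⟨hlt, hu.2⟩)
    filter_upwards [nhdsWithin_le_nhds hr, nhdsWithin_le_nhds (eventually_nhdsWithin_iff.1 hl)]
      with v hv hv'
    rcases lt_trichotomy v u with h' | rfl | h'
    · exact (hv' h').symm
    · rfl
    · exact (hv h').symm

theorem jumpCount_zero (x : ℝ≥0 → S) : jumpCount x 0 = 0 := by
  have : {u | u ≤ 0 ∧ u ∈ jumpTimes x} = ∅ := by
    ext u
    simp only [Set.mem_ofPred_eq, Set.mem_empty_iff_false, iff_false, not_and, nonpos_iff_eq_zero]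
    rintro rfl
    simp [jumpTimes]
  rw [jumpCount, this, Set.ncard_empty]

theorem IsJumpPath.jumpCount_mono {x : ℝ≥0 → S} (hx : IsJumpPath x) : Monotone (jumpCount x) :=
  fun _ t hst => Set.ncard_le_ncard (fun _ hu => ⟨hu.1.trans hst, hu.2⟩) (hx.finite_jumpTimes t)

/-- The jump times up to `c` form a subset of the finite set of those up to `d`. Equal cardinality
makes the two sets equal, so no jump lies in `(c, d]`. -/
theorem IsJumpPath.eq_of_jumpCount_eq {x : ℝ≥0 → S} (hx : IsJumpPath x) {c d : ℝ≥0} (hcd : c ≤ d)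
    (h : jumpCount x c = jumpCount x d) : x c = x d := by
  have := Set.eq_of_subset_of_ncard_le (s := {u | u ≤ c ∧ u ∈ jumpTimes x})
    (t := {u | u ≤ d ∧ u ∈ jumpTimes x}) (fun _ hu => ⟨hu.1.trans hcd, hu.2⟩) h.ge
    (hx.finite_jumpTimes d)
  refine hx.eq_of_disjoint_jumpTimes hcd fun u hu hu' => ?_
  have h2 : u ∈ {u | u ≤ c ∧ u ∈ jumpTimes x} := by rw [this]; exact ⟨hu.2, hu'⟩
  exact absurd h2.1 (not_le.2 hu.1)

theorem jumpCount_eq_of_disjoint {x : ℝ≥0 → S} {c d : ℝ≥0} (hcd : c ≤ d)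
    (h : ∀ u ∈ Set.Ioc c d, u ∉ jumpTimes x) : jumpCount x d = jumpCount x c := by
  unfold jumpCount
  congr 1
  ext u
  refine ⟨fun hu => ⟨?_, hu.2⟩, fun hu => ⟨hu.1.trans hcd, hu.2⟩⟩
  by_contra hc
  exact h u ⟨not_le.1 hc, hu.1⟩ hu.2

/-- Locally a path has at most one jump. -/
theorem IsJumpPath.exists_nhds_jumpCount_le {x : ℝ≥0 → S} (hx : IsJumpPath x) (u : ℝ≥0) :
    ∃ U ∈ 𝓝 u, ∀ c ∈ U, ∀ d ∈ U, c ≤ d → jumpCount x d ≤ jumpCount x c + 1 := by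
  obtain ⟨ε, hε, hb⟩ := Metric.eventually_nhds_iff.1 (hx.eventually_notMem_jumpTimes u)
  refine ⟨Metric.ball u ε, Metric.ball_mem_nhds u hε, fun c hc d hd hcd => ?_⟩
  have hsub : {v | v ≤ d ∧ v ∈ jumpTimes x} ⊆ insert u {v | v ≤ c ∧ v ∈ jumpTimes x} := by
    rintro v ⟨hvd, hv⟩
    by_cases hvc : v ≤ c
    · exact Or.inr ⟨hvc, hv⟩
    · left
      apply hb _ hv
      rw [Metric.mem_ball, NNReal.dist_eq, abs_lt] at hc hd
      rw [NNReal.dist_eq, abs_lt]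
      have h1 : (c : ℝ) < v := by exact_mod_cast not_le.1 hvc
      have h2 : (v : ℝ) ≤ d := by exact_mod_cast hvd
      constructor <;> linarith [hc.1, hd.2]
  exact (Set.ncard_le_ncard hsub ((hx.finite_jumpTimes c).insert u)).trans (Set.ncard_insert_le _ _)

/-- Right-continuous counting functions. -/
structure IsCountingPath (A : ℝ≥0 → ℕ) : Prop where
  mono : Monotone A
  right_cont : ∀ t, ∀ᶠ s in 𝓝[>] t, A s = A t

theorem IsJumpPath.isCountingPath_jumpCount {x : ℝ≥0 → S} (hx : IsJumpPath x) :
    IsCountingPath (jumpCount x) := by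
  refine ⟨hx.jumpCount_mono, fun t => ?_⟩
  obtain ⟨ε, hε, hb⟩ := Metric.eventually_nhds_iff.1 (hx.eventually_notMem_jumpTimes t)
  filter_upwards [nhdsWithin_le_nhds (Metric.ball_mem_nhds t hε), self_mem_nhdsWithin] with s hs hts
  refine jumpCount_eq_of_disjoint (le_of_lt hts) fun u hu hu' => hu.1.ne' (hb ?_ hu')
  rw [Metric.mem_ball, NNReal.dist_eq, abs_lt] at hs
  rw [NNReal.dist_eq, abs_lt]
  have h1 : (t : ℝ) < u := by exact_mod_cast hu.1
  have h2 : (u : ℝ) ≤ s := by exact_mod_cast hu.2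
  constructor <;> linarith [hs.2]

/-- The time at which a counting function reaches level `k`. -/
noncomputable def hit (A : ℝ≥0 → ℕ) (k : ℕ) : ℝ≥0 := sInf {t | k ≤ A t}

/-- Right-continuity makes the infimum attained. The level must be reached at some time, since
otherwise `hit` is `sInf ∅ = 0`. -/
theorem IsCountingPath.hit_le_iff {A : ℝ≥0 → ℕ} (hA : IsCountingPath A) {k : ℕ} (hk : ∃ t, k ≤ A t)
    {b : ℝ≥0} : hit A k ≤ b ↔ k ≤ A b := by
  constructor
  · intro h
    refine le_trans ?_ (hA.mono h)
    have hev := hA.right_cont (hit A k)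
    obtain ⟨δ, hδ, hs⟩ := Metric.eventually_nhds_iff.1 (eventually_nhdsWithin_iff.1 hev)
    have hlt : sInf {t | k ≤ A t} < hit A k + ⟨δ, hδ.le⟩ :=
      lt_add_of_pos_right _ (by exact_mod_cast hδ)
    obtain ⟨t, ht, hlt⟩ := exists_lt_of_csInf_lt hk hlt
    have hle : hit A k ≤ t := csInf_le (OrderBot.bddBelow _) ht
    rcases hle.eq_or_lt with he | he
    · rw [he]; exact ht
    · rw [← hs _ he]
      · exact ht
      · rw [NNReal.dist_eq, abs_of_nonneg (sub_nonneg.2 (by exact_mod_cast hle))]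
        have : (t : ℝ) < hit A k + δ := by exact_mod_cast hlt
        linarith
  · exact fun h => csInf_le (OrderBot.bddBelow _) h

theorem IsCountingPath.apply_hit_self {A : ℝ≥0 → ℕ} (hA : IsCountingPath A) (t : ℝ≥0) :
    A (hit A (A t)) = A t :=
  le_antisymm (hA.mono ((hA.hit_le_iff ⟨t, le_rfl⟩).2 le_rfl))
    ((hA.hit_le_iff ⟨t, le_rfl⟩).1 le_rfl)

/-- A bounded set of natural numbers contains its supremum, and a monotone path that has reached it
before `u` stays there until `u`. Thus the local description of jump paths applies to counting paths
too. -/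
theorem IsCountingPath.left_lim {A : ℝ≥0 → ℕ} (hA : IsCountingPath A) (u : ℝ≥0) :
    ∃ l, ∀ᶠ s in 𝓝[<] u, A s = l := by
  by_cases hu : (Set.Iio u).Nonempty
  · have hbdd : BddAbove (A '' Set.Iio u) :=
      ⟨A u, by rintro _ ⟨v, hv, rfl⟩; exact hA.mono (le_of_lt hv)⟩
    obtain ⟨s0, hs0, he⟩ := Nat.sSup_mem (hu.image A) hbdd
    refine ⟨A s0, ?_⟩
    filter_upwards [self_mem_nhdsWithin, nhdsWithin_le_nhds (lt_mem_nhds hs0)] with s hs hs'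
    refine le_antisymm ?_ (hA.mono (le_of_lt hs'))
    rw [he]
    exact le_csSup hbdd ⟨s, hs, rfl⟩
  · rw [Set.not_nonempty_iff_eq_empty] at hu
    exact ⟨0, by simp [hu]⟩

theorem IsCountingPath.isJumpPath {A : ℝ≥0 → ℕ} (hA : IsCountingPath A) : IsJumpPath A :=
  ⟨hA.right_cont, hA.left_lim⟩

/-- No jump lies between the last jump time before `t` and `t`; in other words, the embedded state
with index `J(t)` is the state at `t`. -/
theorem IsJumpPath.apply_hit_jumpCount {x : ℝ≥0 → S} (hx : IsJumpPath x) (t : ℝ≥0) :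
    x (hit (jumpCount x) (jumpCount x t)) = x t := by
  have h := hx.isCountingPath_jumpCount
  exact hx.eq_of_jumpCount_eq ((h.hit_le_iff ⟨t, le_rfl⟩).2 le_rfl) (h.apply_hit_self t)

open scoped Classical in
/-- The number of jumps from `a` to `b`, as a limit of counts over partitions. -/
theorem IsJumpPath.eventually_sum_grid_transition {x : ℝ≥0 → S} (hx : IsJumpPath x) {a b : S} (hab : a ≠ b)
    {s t : ℝ≥0} (hst : s ≤ t) :
    ∀ᶠ n : ℕ in atTop,
      ∑ i ∈ Finset.range n, (if x (grid s t n i) = a ∧ x (grid s t n (i + 1)) = b then (1 : ℝ) else 0)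
      = ∑ j ∈ Finset.Ioc (jumpCount x s) (jumpCount x t),
        if x (hit (jumpCount x) (j - 1)) = a ∧ x (hit (jumpCount x) j) = b then (1 : ℝ) else 0 := by
  refine eventually_sum_grid_eq
    (V := fun c d => ∑ j ∈ Finset.Ioc (jumpCount x c) (jumpCount x d),
        if x (hit (jumpCount x) (j - 1)) = a ∧ x (hit (jumpCount x) j) = b then (1 : ℝ) else 0)
    (F := fun c d => if x c = a ∧ x d = b then (1 : ℝ) else 0) ?_ ?_ hst
  · intro c d e hcd hde
    exact (Finset.sum_Ioc_consecutive _ (hx.jumpCount_mono hcd) (hx.jumpCount_mono hde)).symm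
  · intro u
    -- On intervals with at most one jump the endpoints tell everything: either the path is
    -- unchanged, or its only jump has index `J(c) + 1` and leads from `x c` to `x d`.
    obtain ⟨U, hU, h⟩ := hx.exists_nhds_jumpCount_le u
    refine ⟨U, hU, fun c hc d hd hcd => ?_⟩
    rcases (hx.jumpCount_mono hcd).eq_or_lt with he | hlt
    · have := hx.eq_of_jumpCount_eq hcd he
      simp only [he, Finset.Ioc_self, Finset.sum_empty, ite_eq_right_iff, one_ne_zero, imp_false]
      rintro ⟨rfl, rfl⟩
      exact hab this
    · have he : jumpCount x d = jumpCount x c + 1 := le_antisymm (h c hc d hd hcd) hlt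
      have h1 := hx.apply_hit_jumpCount c
      have h2 := hx.apply_hit_jumpCount d
      simp only [he] at h2 ⊢
      rw [show Finset.Ioc (jumpCount x c) (jumpCount x c + 1) = {jumpCount x c + 1} by
        simp, Finset.sum_singleton, Nat.add_sub_cancel, h1, h2]

-- Here a jump must be shown to be visible at the endpoints of a short interval. If the value just
-- before a jump time `v` were that at `v`, then `v` would not be a jump time. The limit yields
-- measurability and finite mean of the number of jumps.
open scoped Classical in
theorem IsJumpPath.eventually_sum_grid_change {x : ℝ≥0 → S} (hx : IsJumpPath x)
    {s t : ℝ≥0} (hst : s ≤ t) :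
    ∀ᶠ n : ℕ in atTop,
      ∑ i ∈ Finset.range n, (if x (grid s t n i) ≠ x (grid s t n (i + 1)) then (1 : ℝ) else 0)
      = (jumpCount x t : ℝ) - jumpCount x s := by
  refine eventually_sum_grid_eq
    (V := fun c d => (jumpCount x d : ℝ) - jumpCount x c)
    (F := fun c d => if x c ≠ x d then (1 : ℝ) else 0) (fun _ _ _ _ _ => by ring) ?_ hst
  intro u
  obtain ⟨U, hU, h⟩ := hx.exists_nhds_jumpCount_le u
  have hnj : ∀ᶠ v in 𝓝 u, v ∈ jumpTimes x → v = u := hx.eventually_notMem_jumpTimes u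
  obtain ⟨y, hy⟩ := hx.eventually_nhds u
  obtain ⟨ε, hε, hb⟩ := Metric.eventually_nhds_iff.1 (hnj.and hy)
  refine ⟨U ∩ Metric.ball u ε, inter_mem hU (Metric.ball_mem_nhds u hε), ?_⟩
  rintro c ⟨hc, hcb⟩ d ⟨hd, hdb⟩ hcd
  rcases (hx.jumpCount_mono hcd).eq_or_lt with he | hlt
  · have := hx.eq_of_jumpCount_eq hcd he
    simp [he, this]
  · have he : jumpCount x d = jumpCount x c + 1 := le_antisymm (h c hc d hd hcd) hlt
    have hne : ∃ v ∈ Set.Ioc c d, v ∈ jumpTimes x := by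
      by_contra! hcon
      exact hlt.ne' (jumpCount_eq_of_disjoint hcd hcon)
    obtain ⟨v, hv, hvJ⟩ := hne
    have hvb : dist v u < ε := by
      rw [Metric.mem_ball, NNReal.dist_eq, abs_lt] at hcb hdb
      rw [NNReal.dist_eq, abs_lt]
      have h1 : (c : ℝ) < v := by exact_mod_cast hv.1
      have h2 : (v : ℝ) ≤ d := by exact_mod_cast hv.2
      constructor <;> linarith [hcb.1, hdb.2]
    have hvu : v = u := (hb hvb).1 hvJ
    subst hvu
    have hxc : x c = y := (hb hcb).2.1 hv.1
    have hxd : x d = x v := (hb hdb).2.2 hv.2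
    have hyne : x c ≠ x d := by
      intro heq
      apply hvJ
      filter_upwards [nhdsWithin_le_nhds hy, self_mem_nhdsWithin] with w hw hwv
      rw [hw.1 hwv, ← hxc, heq, hxd]
    simp [he, hyne]

/-- The number of points of `A` at which `x` is in state `a`, as a limit over partitions. -/
theorem IsJumpPath.eventually_sum_grid_count [DecidableEq S] {x : ℝ≥0 → S} (hx : IsJumpPath x)
    {A : ℝ≥0 → ℕ} (hA : IsCountingPath A) (a : S) {s t : ℝ≥0} (hst : s ≤ t) :
    ∀ᶠ n : ℕ in atTop,
      ∑ i ∈ Finset.range n, (if x (grid s t n (i + 1)) = a then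
        ((A (grid s t n (i + 1)) : ℝ) - A (grid s t n i)) else 0)
      = ∑ k ∈ Finset.Ioc (A s) (A t), if x (hit A k) = a then (1 : ℝ) else 0 := by
  refine eventually_sum_grid_eq
    (V := fun c d => ∑ k ∈ Finset.Ioc (A c) (A d), if x (hit A k) = a then (1 : ℝ) else 0)
    (F := fun c d => if x d = a then ((A d : ℝ) - A c) else 0) ?_ ?_ hst
  · intro c d e hcd hde
    exact (Finset.sum_Ioc_consecutive _ (hA.mono hcd) (hA.mono hde)).symm
  · intro u
    obtain ⟨y, hy⟩ := hx.eventually_nhds u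
    obtain ⟨l, hl⟩ := hA.isJumpPath.eventually_nhds u
    obtain ⟨ε, hε, hb⟩ := Metric.eventually_nhds_iff.1 (hy.and hl)
    refine ⟨Metric.ball u ε, Metric.ball_mem_nhds u hε, fun c hc d hd hcd => ?_⟩
    -- All points of `A` in a short interval `(c, d]` sit at `u`, where `A` may jump by any amount,
    -- and from `u` on `x` is constant. So the state at the right endpoint serves for all of them.
    have key : ∀ k ∈ Finset.Ioc (A c) (A d), x (hit A k) = x d := by
      intro k hk
      rw [Finset.mem_Ioc] at hk
      have hcu : c < u := by
        by_contra hcon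
        rw [not_lt] at hcon
        have := (hb hc).2.2 hcon
        have := (hb hd).2.2 (hcon.trans hcd)
        omega
      have hud : u ≤ d := by
        by_contra hcon
        rw [not_le] at hcon
        have := (hb hc).2.1 hcu
        have := (hb hd).2.1 hcon
        omega
      have hle : hit A k ≤ d := (hA.hit_le_iff ⟨d, hk.2⟩).2 hk.2
      have hge : c < hit A k := by
        rw [← not_le, hA.hit_le_iff ⟨d, hk.2⟩]; omega
      have hmem : dist (hit A k) u < ε := by
        rw [Metric.mem_ball, NNReal.dist_eq, abs_lt] at hc hd
        rw [NNReal.dist_eq, abs_lt]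
        have h1 : (c : ℝ) < hit A k := by exact_mod_cast hge
        have h2 : (hit A k : ℝ) ≤ d := by exact_mod_cast hle
        constructor <;> linarith [hc.1, hd.2]
      have huk : u ≤ hit A k := by
        by_contra hcon
        rw [not_le] at hcon
        have h1 := (hb hmem).2.1 hcon
        have h2 := (hb hc).2.1 hcu
        have h3 := (hA.hit_le_iff ⟨d, hk.2⟩ (b := hit A k)).1 le_rfl
        omega
      rw [(hb hmem).1.2 huk, (hb hd).1.2 hud]
    change _ = ∑ k ∈ Finset.Ioc (A c) (A d), if x (hit A k) = a then (1 : ℝ) else 0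
    rw [Finset.sum_congr rfl fun k hk => by rw [key k hk]]
    rw [Finset.sum_const, Nat.card_Ioc, nsmul_eq_mul, Nat.cast_sub (hA.mono hcd)]
    split_ifs <;> simp

end Paths

/-! ### Measurability of path functionals -/

section PathMeasurability

variable {S Ω : Type*} [MeasurableSpace S] [MeasurableSingletonClass S]

/-- The times `d n u` take countably many values and tend to `u` strictly from the right. By
right-continuity `X` at `d n u` is eventually equal to `X` at `u`, so the level sets of `X` are
lower limits of measurable sets. -/
theorem measurable_uncurry_of_right_cont [Countable S] {_ : MeasurableSpace Ω} {X : ℝ≥0 → Ω → S}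
    (hX : ∀ t, Measurable (X t)) (hr : ∀ ω t, ∀ᶠ s in 𝓝[>] t, X s ω = X t ω) :
    Measurable fun q : ℝ≥0 × Ω => X q.1 q.2 := by
  let d : ℕ → ℝ≥0 → ℝ≥0 := fun n u => ((⌊(n + 1 : ℝ≥0) * u⌋₊ + 1 : ℕ) : ℝ≥0) / (n + 1 : ℝ≥0)
  have hpos : ∀ n : ℕ, (0 : ℝ≥0) < n + 1 := fun n => by positivity
  have hd_gt : ∀ n u, u < d n u := by
    intro n u
    rw [lt_div_iff₀ (hpos n), mul_comm]
    exact_mod_cast Nat.lt_floor_add_one ((n + 1 : ℝ≥0) * u)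
  have hd_le : ∀ n u, d n u ≤ u + 1 / (n + 1 : ℝ≥0) := by
    intro n u
    rw [div_le_iff₀ (hpos n), add_mul u, one_div, inv_mul_cancel₀ (hpos n).ne']
    push_cast
    gcongr
    rw [mul_comm u]
    exact Nat.floor_le zero_le
  have hd_tendsto : ∀ u, Tendsto (fun n => d n u) atTop (𝓝[>] u) := by
    intro u
    refine tendsto_nhdsWithin_iff.2 ⟨?_, Eventually.of_forall fun n => hd_gt n u⟩
    have h1 : Tendsto (fun n : ℕ => u + 1 / (n + 1 : ℝ≥0)) atTop (𝓝 u) := by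
      have := (tendsto_const_nhds (x := u)).add (tendsto_one_div_add_atTop_nhds_zero_nat (𝕜 := ℝ≥0))
      simpa using this
    exact tendsto_of_tendsto_of_tendsto_of_le_of_le tendsto_const_nhds h1
      (fun n => (hd_gt n u).le) (fun n => hd_le n u)
  have hmeas : ∀ n, Measurable fun q : ℝ≥0 × Ω => X (d n q.1) q.2 := by
    intro n
    have h1 : Measurable fun q : ℕ × Ω => X (((q.1 + 1 : ℕ) : ℝ≥0) / (n + 1 : ℝ≥0)) q.2 :=
      measurable_from_prod_countable_right fun k => hX (((k + 1 : ℕ) : ℝ≥0) / (n + 1 : ℝ≥0))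
    exact h1.comp ((Nat.measurable_floor.comp (measurable_const.mul measurable_fst)).prodMk
      measurable_snd)
  refine measurable_to_countable' fun x => ?_
  have : (fun q : ℝ≥0 × Ω => X q.1 q.2) ⁻¹' {x}
      = ⋃ N : ℕ, ⋂ n ∈ Set.Ici N, (fun q : ℝ≥0 × Ω => X (d n q.1) q.2) ⁻¹' {x} := by
    ext ⟨u, ω⟩
    have hev := (hd_tendsto u).eventually (hr ω u)
    simp only [Set.mem_preimage, Set.mem_singleton_iff, Set.mem_iUnion, Set.mem_iInter, Set.mem_Ici]
    obtain ⟨N, hN⟩ := eventually_atTop.1 hev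
    constructor
    · intro h
      exact ⟨N, fun n hn => (hN n hn).trans h⟩
    · rintro ⟨M, hM⟩
      rw [← hN (max M N) (le_max_right _ _)]
      exact hM _ (le_max_left _ _)
  rw [this]
  exact MeasurableSet.iUnion fun N => MeasurableSet.biInter (Set.to_countable _) fun n _ =>
    hmeas n (measurableSet_singleton x)

/-- The count is the pointwise limit of the numbers of changes of state along partitions, each of
which depends on finitely many coordinates. -/
theorem measurable_jumpCount [Countable S] {_ : MeasurableSpace Ω} {X : ℝ≥0 → Ω → S}
    (hX : ∀ t, Measurable (X t)) (hp : ∀ ω, IsJumpPath fun t => X t ω) (t : ℝ≥0) :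
    Measurable fun ω => jumpCount (fun t => X t ω) t := by
  classical
  have h : Measurable fun ω => (jumpCount (fun t => X t ω) t : ℝ) := by
    refine measurable_of_tendsto_metrizable (f := fun (n : ℕ) ω => ∑ i ∈ Finset.range n,
      (if X (grid 0 t n i) ω ≠ X (grid 0 t n (i + 1)) ω then (1 : ℝ) else 0)) ?_ ?_
    · intro n
      refine Finset.measurable_fun_sum _ fun i _ => Measurable.ite ?_ measurable_const measurable_const
      have : {ω | X (grid 0 t n i) ω = X (grid 0 t n (i + 1)) ω}
          = ⋃ x, X (grid 0 t n i) ⁻¹' {x} ∩ X (grid 0 t n (i + 1)) ⁻¹' {x} := by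
        ext ω; simp [eq_comm]
      change MeasurableSet {ω | X (grid 0 t n i) ω = X (grid 0 t n (i + 1)) ω}ᶜ
      rw [this]
      exact (MeasurableSet.iUnion fun x =>
        (hX _ (measurableSet_singleton x)).inter (hX _ (measurableSet_singleton x))).compl
    · refine tendsto_pi_nhds.2 fun ω => tendsto_const_nhds.congr' ?_
      filter_upwards [(hp ω).eventually_sum_grid_change (zero_le : 0 ≤ t)] with n hn
      rw [hn, jumpCount_zero, Nat.cast_zero, sub_zero]
  refine measurable_to_countable' fun k => ?_
  have : (fun ω => jumpCount (fun t => X t ω) t) ⁻¹' {k}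
      = (fun ω => (jumpCount (fun t => X t ω) t : ℝ)) ⁻¹' {(k : ℝ)} := by
    ext; simp
  rw [this]
  exact h (measurableSet_singleton _)

theorem measurable_hit {_ : MeasurableSpace Ω} {A : ℝ≥0 → Ω → ℕ} (hA : ∀ t, Measurable (A t))
    (hp : ∀ ω, IsCountingPath fun t => A t ω) (k : ℕ) :
    Measurable fun ω => hit (fun t => A t ω) k := by
  refine measurable_of_Iic fun b => ?_
  -- The second set is where level `k` is never reached; there `hit` has its default value `0`. By
  -- monotonicity integer times detect this.
  have : (fun ω => hit (fun t => A t ω) k) ⁻¹' Set.Iic b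
      = {ω | k ≤ A b ω} ∪ ⋂ n : ℕ, {ω | k ≤ A n ω}ᶜ := by
    ext ω
    by_cases hne : ∃ t, k ≤ A t ω
    · have hne' : ∃ n : ℕ, k ≤ A n ω := by
        obtain ⟨t, ht⟩ := hne
        obtain ⟨n, hn⟩ := exists_nat_ge t
        exact ⟨n, ht.trans ((hp ω).mono hn)⟩
      simp only [Set.mem_preimage, Set.mem_Iic, (hp ω).hit_le_iff hne, Set.mem_union, Set.mem_ofPred_eq,
        Set.mem_iInter, Set.mem_compl_iff]
      exact ⟨Or.inl, fun h => h.elim id fun h => absurd hne' (by push Not; exact fun n => not_le.1 (h n))⟩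
    · have h0 : hit (fun t => A t ω) k = 0 := by
        have : {t | k ≤ A t ω} = ∅ := by
          ext t; simp only [Set.mem_ofPred_eq, Set.mem_empty_iff_false, iff_false]
          exact fun h => hne ⟨t, h⟩
        rw [hit, this, NNReal.sInf_empty]
      simp only [Set.mem_preimage, h0, Set.mem_Iic, zero_le, Set.mem_union, true_iff]
      right
      exact Set.mem_iInter.2 fun n h => hne ⟨n, h⟩
  rw [this]
  exact (hA b measurableSet_Ici).union (MeasurableSet.iInter fun n => (hA n measurableSet_Ici).compl)

end PathMeasurability

/-! ### Stopped paths -/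

section Stopping

variable {S : Type*}

/-- Stopping at `s` yields measurability with respect to the past: a functional of the path on `[0,
s]` equals the same functional of the stopped path, all of whose coordinates are measurable up to
`s`. -/
theorem IsJumpPath.stopped {x : ℝ≥0 → S} (hx : IsJumpPath x) (s : ℝ≥0) :
    IsJumpPath fun t => x (min t s) := by
  constructor
  · intro t
    rcases lt_or_ge t s with h | h
    · filter_upwards [hx.right_cont t, nhdsWithin_le_nhds (gt_mem_nhds h)] with v hv hvs
      rw [min_eq_left (le_of_lt hvs), min_eq_left h.le, hv]
    · filter_upwards [self_mem_nhdsWithin] with v hv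
      rw [min_eq_right h, min_eq_right (h.trans (le_of_lt hv))]
  · intro t
    rcases le_or_gt t s with h | h
    · obtain ⟨y, hy⟩ := hx.left_lim t
      refine ⟨y, ?_⟩
      filter_upwards [hy, self_mem_nhdsWithin] with v hv hvt
      rw [min_eq_left ((le_of_lt hvt).trans h), hv]
    · refine ⟨x s, ?_⟩
      filter_upwards [nhdsWithin_le_nhds (lt_mem_nhds h)] with v hv
      rw [min_eq_right (le_of_lt hv)]

theorem jumpTimes_stopped (x : ℝ≥0 → S) (s : ℝ≥0) :
    jumpTimes (fun t => x (min t s)) = {u | u ≤ s ∧ u ∈ jumpTimes x} := by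
  ext u
  rcases le_or_gt u s with h | h
  · simp only [jumpTimes, Set.mem_ofPred_eq, h, true_and]
    refine not_congr (eventually_congr ?_)
    filter_upwards [self_mem_nhdsWithin] with v hv
    rw [min_eq_left ((le_of_lt hv).trans h), min_eq_left h]
  · simp only [jumpTimes, Set.mem_ofPred_eq, not_le.2 h, false_and, iff_false, not_not]
    filter_upwards [nhdsWithin_le_nhds (lt_mem_nhds h)] with v hv
    rw [min_eq_right (le_of_lt hv), min_eq_right h.le]

theorem jumpCount_stopped (x : ℝ≥0 → S) (s t : ℝ≥0) :
    jumpCount (fun t => x (min t s)) t = jumpCount x (min t s) := by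
  simp only [jumpCount, jumpTimes_stopped]
  congr 1
  ext u
  simp only [Set.mem_ofPred_eq, le_min_iff, and_assoc]

theorem IsCountingPath.stopped {A : ℝ≥0 → ℕ} (hA : IsCountingPath A) (s : ℝ≥0) :
    IsCountingPath fun t => A (min t s) :=
  ⟨fun _ _ h => hA.mono (min_le_min_right s h), (hA.isJumpPath.stopped s).right_cont⟩

theorem IsCountingPath.hit_stopped {A : ℝ≥0 → ℕ} (hA : IsCountingPath A) {s : ℝ≥0} {k : ℕ}
    (hk : k ≤ A s) : hit (fun t => A (min t s)) k = hit A k := by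
  refine eq_of_forall_ge_iff fun b => ?_
  rw [(hA.stopped s).hit_le_iff ⟨s, by simpa using hk⟩, hA.hit_le_iff ⟨s, hk⟩]
  rcases le_total b s with h | h
  · rw [min_eq_left h]
  · rw [min_eq_right h]
    exact ⟨fun h' => h'.trans (hA.mono h), fun _ => hk⟩

end Stopping

/-! ### Transition matrices: Lipschitz estimates and the Chapman–Kolmogorov equations -/

section Transition

variable {S : Type*} [Fintype S] [DecidableEq S] {Q : ℝ≥0 → Matrix S S ℝ}
  {P : ℝ≥0 → ℝ≥0 → Matrix S S ℝ}

namespace IsTransitionFamily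

theorem nonneg (hP : IsTransitionFamily Q P) {s t : ℝ≥0} (h : s ≤ t) (x y : S) : 0 ≤ P s t x y :=
  (Matrix.mem_rowStochastic_iff_sum.1 (hP.stochastic s t h)).1 x y

theorem sum_eq_one (hP : IsTransitionFamily Q P) {s t : ℝ≥0} (h : s ≤ t) (x : S) : ∑ y, P s t x y = 1 :=
  (Matrix.mem_rowStochastic_iff_sum.1 (hP.stochastic s t h)).2 x

theorem le_one (hP : IsTransitionFamily Q P) {s t : ℝ≥0} (h : s ≤ t) (x y : S) : P s t x y ≤ 1 := by
  rw [← hP.sum_eq_one h x]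
  exact Finset.single_le_sum (f := fun y => P s t x y) (fun z _ => hP.nonneg h x z) (Finset.mem_univ y)

theorem abs_mul_le (hP : IsTransitionFamily Q P) {Λ : ℝ} (hQ : ∀ u x y, |Q u x y| ≤ Λ) {s u : ℝ≥0}
    (h : s ≤ u) (x y : S) : |(P s u * Q u) x y| ≤ Λ := by
  rw [Matrix.mul_apply]
  calc |∑ z, P s u x z * Q u z y| ≤ ∑ z, |P s u x z * Q u z y| := Finset.abs_sum_le_sum_abs _ _
    _ ≤ ∑ z, P s u x z * Λ := by
        refine Finset.sum_le_sum fun z _ => ?_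
        rw [abs_mul, abs_of_nonneg (hP.nonneg h x z)]
        exact mul_le_mul_of_nonneg_left (hQ u z y) (hP.nonneg h x z)
    _ = Λ := by rw [← Finset.sum_mul, hP.sum_eq_one h, one_mul]

theorem self_eq_one (hP : IsTransitionFamily Q P) (s : ℝ≥0) : P s s = 1 := by
  ext x y
  rw [(hP.forward s s le_rfl x y).2]
  simp

theorem sub_eq (hP : IsTransitionFamily Q P) {s a b : ℝ≥0} (hsa : s ≤ a) (hab : a ≤ b) (x y : S) :
    P s b x y = P s a x y + ∫ u in Set.Ioc a b, (P s u * Q u) x y ∂leb := by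
  rw [(hP.forward s b (hsa.trans hab) x y).2, (hP.forward s a hsa x y).2,
    setIntegral_leb_Ioc_add hsa hab (hP.forward s b (hsa.trans hab) x y).1, add_assoc]

theorem abs_sub_le (hP : IsTransitionFamily Q P) {Λ : ℝ} (hQ : ∀ u x y, |Q u x y| ≤ Λ) {s a b : ℝ≥0}
    (hsa : s ≤ a) (hab : a ≤ b) (x y : S) : |P s b x y - P s a x y| ≤ Λ * (b - a) := by
  rw [hP.sub_eq hsa hab, add_sub_cancel_left]
  exact norm_setIntegral_leb_Ioc_le hab fun u hu => hP.abs_mul_le hQ (hsa.trans hu.1.le) x y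

theorem abs_sub_one_le (hP : IsTransitionFamily Q P) {Λ : ℝ} (hQ : ∀ u x y, |Q u x y| ≤ Λ) {s t : ℝ≥0}
    (h : s ≤ t) (x y : S) : |P s t x y - (1 : Matrix S S ℝ) x y| ≤ Λ * (t - s) := by
  rw [← hP.self_eq_one s]
  exact hP.abs_sub_le hQ le_rfl h x y

theorem continuous_add (hP : IsTransitionFamily Q P) {Λ : ℝ} (hQ : ∀ u x y, |Q u x y| ≤ Λ) (s : ℝ≥0)
    (x y : S) : Continuous fun u => P s (s + u) x y := by
  have hΛ : 0 ≤ Λ := (abs_nonneg _).trans (hQ 0 x y)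
  refine (LipschitzWith.of_dist_le_mul (K := Λ.toNNReal) fun u v => ?_).continuous
  rw [Real.dist_eq, NNReal.dist_eq, Real.coe_toNNReal _ hΛ]
  rcases le_total u v with h | h
  · rw [abs_sub_comm, abs_sub_comm (u : ℝ), abs_of_nonneg (sub_nonneg.2 (by exact_mod_cast h : (u : ℝ) ≤ v))]
    refine (hP.abs_sub_le hQ le_self_add (by gcongr) x y).trans_eq ?_
    push_cast; ring
  · rw [abs_of_nonneg (sub_nonneg.2 (by exact_mod_cast h : (v : ℝ) ≤ u))]
    refine (hP.abs_sub_le hQ le_self_add (by gcongr) x y).trans_eq ?_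
    push_cast; ring

/-- `P s u` is within `Λ (u - s)` of the identity, so the forward density `P Q` is `Q` up to a
linear error. This bounds transition probabilities below in the minorization and gives the quadratic
local error in the compensator of transitions. -/
theorem abs_mul_sub_le (hP : IsTransitionFamily Q P) {Λ : ℝ} (hQ : ∀ u x y, |Q u x y| ≤ Λ) {s u : ℝ≥0}
    (h : s ≤ u) (x y : S) :
    |(P s u * Q u) x y - Q u x y| ≤ Fintype.card S * Λ ^ 2 * (u - s) := by
  have hΛ : 0 ≤ Λ := (abs_nonneg _).trans (hQ 0 x y)
  have : (P s u * Q u) x y - Q u x y = ∑ z, (P s u x z - (1 : Matrix S S ℝ) x z) * Q u z y := by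
    simp only [sub_mul, Finset.sum_sub_distrib]
    rw [← Matrix.mul_apply, ← Matrix.mul_apply, one_mul]
  rw [this]
  calc |∑ z, (P s u x z - (1 : Matrix S S ℝ) x z) * Q u z y|
      ≤ ∑ z, |(P s u x z - (1 : Matrix S S ℝ) x z) * Q u z y| := Finset.abs_sum_le_sum_abs _ _
    _ ≤ ∑ _z : S, Λ * (u - s) * Λ := by
        refine Finset.sum_le_sum fun z _ => ?_
        rw [abs_mul]
        refine mul_le_mul (hP.abs_sub_one_le hQ h x z) (hQ u z y) (abs_nonneg _)
          (mul_nonneg hΛ (sub_nonneg.2 (by exact_mod_cast h)))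
    _ = _ := by rw [Finset.sum_const, Finset.card_univ, nsmul_eq_mul]; ring

/-- The integral behind one step of the iteration in `mul_eq`. -/
theorem setIntegral_pow_sub (t u : ℝ≥0) (htu : t ≤ u) (n : ℕ) :
    IntegrableOn (fun v : ℝ≥0 => ((v : ℝ) - t) ^ n) (Set.Ioc t u) leb ∧
    ∫ v in Set.Ioc t u, ((v : ℝ) - t) ^ n ∂leb = ((u : ℝ) - t) ^ (n + 1) / (n + 1) := by
  have htu' : (t : ℝ) ≤ u := by exact_mod_cast htu
  constructor
  · refine IntegrableOn.of_bound (leb_Ioc_lt_top t u) (by fun_prop) (((u : ℝ) - t) ^ n) ?_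
    filter_upwards [ae_restrict_mem measurableSet_Ioc] with v hv
    have h1 : (t : ℝ) ≤ v := by exact_mod_cast hv.1.le
    have h2 : (v : ℝ) ≤ u := by exact_mod_cast hv.2
    rw [Real.norm_of_nonneg (pow_nonneg (sub_nonneg.2 h1) n)]
    gcongr
  · rw [setIntegral_leb_Ioc t u (fun v => (v - t) ^ n), ← intervalIntegral.integral_of_le htu',
      intervalIntegral.integral_comp_sub_right (fun v => v ^ n), sub_self, integral_pow]
    simp

/-- The Chapman–Kolmogorov equations. -/
theorem mul_eq (hP : IsTransitionFamily Q P) {Λ : ℝ} (hQ : ∀ u x y, |Q u x y| ≤ Λ) {s t u : ℝ≥0}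
    (hst : s ≤ t) (htu : t ≤ u) : P s t * P t u = P s u := by
  ext x y
  have hΛ : 0 ≤ Λ := (abs_nonneg _).trans (hQ 0 x y)
  -- Uniqueness by iteration: both sides, as functions of the final time, solve the forward equation
  -- on `[t, u]` with the same value at `t`. The `ℓ¹` norm `d` of a row of the difference is shown
  -- to vanish.
  set d : ℝ≥0 → ℝ := fun u => ∑ z, |P s u x z - (P s t * P t u) x z| with hd
  set K : ℝ := Fintype.card S * Λ with hK
  have hint : ∀ u, t ≤ u → ∀ z, P s u x z - (P s t * P t u) x z
      = ∫ v in Set.Ioc t u, ∑ w, (P s v x w - (P s t * P t v) x w) * Q v w z ∂leb := by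
    intro u htu z
    have h1 := (hP.forward s u (hst.trans htu) x z).1.mono_set
      (Set.Ioc_subset_Ioc_left (b := u) hst)
    have h2 : ∀ w, IntegrableOn (fun v => P s t x w * (P t v * Q v) w z) (Set.Ioc t u) leb :=
      fun w => (hP.forward t u htu w z).1.const_mul _
    have e1 : (P s t * P t u) x z
        = P s t x z + ∫ v in Set.Ioc t u, ∑ w, P s t x w * (P t v * Q v) w z ∂leb := by
      rw [integral_finsetSum _ fun w _ => h2 w, Matrix.mul_apply]
      simp_rw [(hP.forward t u htu _ z).2, mul_add, Finset.sum_add_distrib, integral_const_mul]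
      rw [← Matrix.mul_apply, mul_one]
    rw [hP.sub_eq hst htu, e1, add_sub_add_left_eq_sub, ← integral_sub h1 (integrable_finsetSum _ fun w _ => h2 w)]
    congr 1
    ext v
    simp only [sub_mul, Finset.sum_sub_distrib]
    rw [← Matrix.mul_apply, ← Matrix.mul_apply, ← Matrix.mul_apply, Matrix.mul_assoc]
  -- The entries lie in `[0, 1]`, whence the crude start `2 |S|`. Each use of the integral equation
  -- gains a factor `K (u - t) / (n + 1)`, so `d u` is below terms of an exponential series.
  have hbound : ∀ n : ℕ, ∀ u, t ≤ u → d u ≤ 2 * Fintype.card S * (K ^ n * ((u : ℝ) - t) ^ n / n.factorial) := by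
    intro n
    induction n with
    | zero =>
      intro u htu
      simp only [pow_zero, Nat.factorial_zero, Nat.cast_one, mul_one, div_one, hd]
      calc ∑ z, |P s u x z - (P s t * P t u) x z| ≤ ∑ _z : S, (2 : ℝ) := by
            refine Finset.sum_le_sum fun z _ => ?_
            have h1 := hP.nonneg (hst.trans htu) x z
            have h2 := hP.le_one (hst.trans htu) x z
            have h3 := mul_mem (hP.stochastic s t hst) (hP.stochastic t u htu)
            rw [Matrix.mem_rowStochastic_iff_sum] at h3
            have h4 := h3.1 x z
            have h5 : (P s t * P t u) x z ≤ 1 := by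
              rw [← h3.2 x]
              exact Finset.single_le_sum (f := fun y => (P s t * P t u) x y) (fun z _ => h3.1 x z)
                (Finset.mem_univ z)
            rw [abs_le]
            constructor <;> linarith
        _ = _ := by rw [Finset.sum_const, Finset.card_univ, nsmul_eq_mul, mul_comm]
    | succ n ih =>
      intro u htu
      obtain ⟨hi, he⟩ := setIntegral_pow_sub t u htu n
      set C : ℝ := Λ * (2 * Fintype.card S * (K ^ n / n.factorial)) with hC
      have key : ∀ z, |P s u x z - (P s t * P t u) x z| ≤ C * (((u : ℝ) - t) ^ (n + 1) / (n + 1)) := by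
        intro z
        rw [hint u htu z, ← he, ← integral_const_mul, ← Real.norm_eq_abs]
        refine norm_integral_le_of_norm_le (μ := leb.restrict (Set.Ioc t u)) (hi.const_mul C) ?_
        filter_upwards [ae_restrict_mem measurableSet_Ioc] with v hv
        calc |∑ w, (P s v x w - (P s t * P t v) x w) * Q v w z|
            ≤ ∑ w, |(P s v x w - (P s t * P t v) x w) * Q v w z| := Finset.abs_sum_le_sum_abs _ _
          _ ≤ ∑ w, |P s v x w - (P s t * P t v) x w| * Λ := by
              refine Finset.sum_le_sum fun w _ => ?_
              rw [abs_mul]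
              exact mul_le_mul_of_nonneg_left (hQ v w z) (abs_nonneg _)
          _ = Λ * d v := by rw [← Finset.sum_mul, mul_comm]
          _ ≤ Λ * (2 * Fintype.card S * (K ^ n * ((v : ℝ) - t) ^ n / n.factorial)) :=
              mul_le_mul_of_nonneg_left (ih v hv.1.le) hΛ
          _ = C * ((v : ℝ) - t) ^ n := by rw [hC]; ring
      calc d u ≤ ∑ _z : S, C * (((u : ℝ) - t) ^ (n + 1) / (n + 1)) := Finset.sum_le_sum fun z _ => key z
        _ = _ := by
          rw [Finset.sum_const, Finset.card_univ, nsmul_eq_mul, Nat.factorial_succ, hC, hK]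
          have : (n.factorial : ℝ) ≠ 0 := by exact_mod_cast n.factorial_ne_zero
          push_cast
          field_simp
          ring
  have hlim : Tendsto (fun n : ℕ => 2 * (Fintype.card S : ℝ) * (K ^ n * ((u : ℝ) - t) ^ n / n.factorial))
      atTop (𝓝 0) := by
    have := (FloorSemiring.tendsto_pow_div_factorial_atTop (K * ((u : ℝ) - t))).const_mul
      (2 * (Fintype.card S : ℝ))
    simpa only [mul_pow, mul_zero] using this
  have hd0 : d u ≤ 0 := ge_of_tendsto' hlim fun n => hbound n u htu
  have hy : |P s u x y - (P s t * P t u) x y| ≤ 0 :=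
    (Finset.single_le_sum (f := fun z => |P s u x z - (P s t * P t u) x z|) (fun _ _ => abs_nonneg _)
      (Finset.mem_univ y)).trans hd0
  linarith [abs_nonpos_iff.1 hy]

end IsTransitionFamily

/-! ### Uniform ergodicity: minorization, contraction and exponential forgetting -/

/-- Dobrushin contraction: a stochastic matrix whose entries are at least `δ` contracts
oscillations by the factor `1 - δ`. -/
theorem abs_sum_mul_sub_sum_mul_le {A : Matrix S S ℝ} (hA : A ∈ Matrix.rowStochastic ℝ S) {δ : ℝ}
    (hδ : ∀ x y, δ ≤ A x y) {f : S → ℝ} {K : ℝ} (hf : ∀ x y, |f x - f y| ≤ K) (x x' : S) :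
    |∑ y, A x y * f y - ∑ y, A x' y * f y| ≤ (1 - δ) * K := by
  obtain ⟨h0, h1⟩ := Matrix.mem_rowStochastic_iff_sum.1 hA
  have hK : 0 ≤ K := (abs_nonneg _).trans (hf x x)
  -- Independent coupling of the rows `x` and `x'`: the diagonal terms of the double sum vanish, and
  -- the diagonal carries mass at least `δ` because `A x' y ≥ δ`.
  have e : ∑ y, A x y * f y - ∑ y, A x' y * f y
      = ∑ y, ∑ y', A x y * A x' y' * (f y - f y') := by
    have e1 : ∑ y, ∑ y', A x y * A x' y' * f y = ∑ y, A x y * f y := by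
      refine Finset.sum_congr rfl fun y _ => ?_
      rw [← Finset.sum_mul, ← Finset.mul_sum, h1, mul_one]
    have e2 : ∑ y, ∑ y', A x y * A x' y' * f y' = ∑ y', A x' y' * f y' := by
      rw [Finset.sum_comm]
      refine Finset.sum_congr rfl fun y _ => ?_
      rw [← Finset.sum_mul, ← Finset.sum_mul, h1, one_mul]
    simp only [mul_sub, Finset.sum_sub_distrib, e1, e2]
  have e3 : ∑ y, ∑ y', A x y * A x' y' = 1 := by
    simp_rw [← Finset.mul_sum, h1, mul_one, h1]
  have e4 : ∑ y, ∑ y', (if y = y' then A x y * A x' y' else 0) ≥ δ := by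
    simp only [Finset.sum_ite_eq, Finset.mem_univ, if_true]
    calc δ = ∑ y, A x y * δ := by rw [← Finset.sum_mul, h1, one_mul]
      _ ≤ ∑ y, A x y * A x' y := Finset.sum_le_sum fun y _ => mul_le_mul_of_nonneg_left (hδ _ _) (h0 _ _)
  rw [e]
  calc |∑ y, ∑ y', A x y * A x' y' * (f y - f y')|
      ≤ ∑ y, ∑ y', |A x y * A x' y' * (f y - f y')| :=
        (Finset.abs_sum_le_sum_abs _ _).trans (Finset.sum_le_sum fun y _ => Finset.abs_sum_le_sum_abs _ _)
    _ ≤ ∑ y, ∑ y', (A x y * A x' y' - if y = y' then A x y * A x' y' else 0) * K := by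
        refine Finset.sum_le_sum fun y _ => Finset.sum_le_sum fun y' _ => ?_
        split_ifs with h
        · simp [h]
        · rw [sub_zero, abs_mul, abs_of_nonneg (mul_nonneg (h0 _ _) (h0 _ _))]
          exact mul_le_mul_of_nonneg_left (hf _ _) (mul_nonneg (h0 _ _) (h0 _ _))
    _ = (1 - ∑ y, ∑ y', (if y = y' then A x y * A x' y' else 0)) * K := by
        simp_rw [← Finset.sum_mul, Finset.sum_sub_distrib, e3]
    _ ≤ (1 - δ) * K := mul_le_mul_of_nonneg_right (by linarith) hK

/-- Uniform Doeblin minorization. -/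
theorem IsTransitionFamily.exists_minorization (hP : IsTransitionFamily Q P) {Λ : ℝ}
    (hQ : ∀ u x y, |Q u x y| ≤ Λ) {ε : ℝ} (hε : 0 < ε) (hQε : ∀ x y, 0 < Q 1 x y → ∀ u, ε ≤ Q u x y)
    (hirr : IsIrreducibleRate (Q 1)) :
    ∃ L : ℝ≥0, 0 < L ∧ ∃ δ : ℝ, 0 < δ ∧ δ ≤ 1 ∧ ∀ s x y, δ ≤ P s (s + L) x y := by
  -- A step length `h` for which the linear errors cost at most half of the rate bound `ε` and half
  -- of the unit mass on the diagonal.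
  have hev : ∀ᶠ h : ℝ in 𝓝[>] 0, Fintype.card S * Λ ^ 2 * h ≤ ε / 2 ∧ Λ * h ≤ 1 / 2 := by
    have h1 : Tendsto (fun h : ℝ => Fintype.card S * Λ ^ 2 * h) (𝓝[>] 0) (𝓝 0) := by
      have : Continuous fun h : ℝ => Fintype.card S * Λ ^ 2 * h := by fun_prop
      simpa using (this.tendsto 0).mono_left nhdsWithin_le_nhds
    have h2 : Tendsto (fun h : ℝ => Λ * h) (𝓝[>] 0) (𝓝 0) := by
      have : Continuous fun h : ℝ => Λ * h := by fun_prop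
      simpa using (this.tendsto 0).mono_left nhdsWithin_le_nhds
    exact (h1.eventually_le_const (half_pos hε)).and (h2.eventually_le_const (by norm_num))
  obtain ⟨h', ⟨hh1, hh2⟩, hpos⟩ := (hev.and self_mem_nhdsWithin).exists
  obtain ⟨h, rfl⟩ : ∃ h : ℝ≥0, (h : ℝ) = h' := ⟨⟨h', (le_of_lt hpos)⟩, rfl⟩
  have hpos : (0 : ℝ) < h := hpos
  set δ : ℝ := min (1 / 2) (ε / 2 * h) with hδ
  have hδpos : 0 < δ := lt_min (by norm_num) (by positivity)
  have hδ1 : δ ≤ 1 := (min_le_left _ _).trans (by norm_num)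
  have hself : ∀ s x, δ ≤ P s (s + h) x x := by
    intro s x
    have := abs_le.1 (hP.abs_sub_one_le hQ (le_self_add : s ≤ s + h) x x)
    rw [Matrix.one_apply_eq] at this
    push_cast at this
    refine (min_le_left _ _).trans ?_
    nlinarith [this.1]
  have hstep : ∀ s x y, 0 < Q 1 x y → δ ≤ P s (s + h) x y := by
    intro s x y hxy
    have h1 : ε / 2 * h ≤ ∫ u in Set.Ioc s (s + h), (P s u * Q u) x y ∂leb := by
      have : ∫ u in Set.Ioc s (s + h), (ε / 2 : ℝ) ∂leb = ε / 2 * h := by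
        rw [setIntegral_const, leb_real_Ioc le_self_add]
        push_cast
        rw [add_sub_cancel_left, smul_eq_mul, mul_comm]
      rw [← this]
      refine setIntegral_mono_on (integrableOn_const (leb_Ioc_lt_top _ _).ne) (hP.forward s (s + h) le_self_add x y).1
        measurableSet_Ioc fun u hu => ?_
      have := abs_le.1 (hP.abs_mul_sub_le hQ hu.1.le x y)
      have h3 : (u : ℝ) - s ≤ h := by
        have : (u : ℝ) ≤ s + h := by exact_mod_cast hu.2
        linarith
      have h4 := hQε x y hxy u
      have h5 : Fintype.card S * Λ ^ 2 * ((u : ℝ) - s) ≤ Fintype.card S * Λ ^ 2 * h :=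
        mul_le_mul_of_nonneg_left h3 (by positivity)
      linarith [this.1]
    rw [(hP.forward s (s + h) le_self_add x y).2]
    have h2 : 0 ≤ (1 : Matrix S S ℝ) x y := by
      rw [Matrix.one_apply]; split_ifs <;> norm_num
    refine (min_le_right _ _).trans ?_
    linarith
  have hchain : ∀ (n : ℕ) s x y z, δ ^ n ≤ P s (s + n * h) x y →
      (∀ s, δ ≤ P s (s + h) y z) → δ ^ (n + 1) ≤ P s (s + (n + 1 : ℕ) * h) x z := by
    intro n s x y z hxy hyz
    have e : s + ((n + 1 : ℕ) : ℝ≥0) * h = s + n * h + h := by push_cast; ring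
    rw [e, ← hP.mul_eq hQ (le_self_add : s ≤ s + n * h) le_self_add, Matrix.mul_apply, pow_succ]
    refine (mul_le_mul hxy (hyz (s + n * h)) hδpos.le ((pow_pos hδpos n).le.trans hxy)).trans ?_
    exact Finset.single_le_sum (f := fun w => P s (s + n * h) x w * P (s + n * h) (s + n * h + h) w z)
      (fun w _ => mul_nonneg (hP.nonneg le_self_add _ _) (hP.nonneg le_self_add _ _)) (Finset.mem_univ y)
  -- A state is kept over one step with probability at least `δ`, so a chain of `n` transitions
  -- gives the bound `δ ^ m` for every `m ≥ n`. This allows one number of steps common to all pairs.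
  have hreach : ∀ x y, ∃ n : ℕ, ∀ m ≥ n, ∀ s, δ ^ m ≤ P s (s + m * h) x y := by
    intro x y
    have hmono : ∀ (n : ℕ) (y : S), (∀ s, δ ^ n ≤ P s (s + n * h) x y) → ∀ m ≥ n, ∀ s, δ ^ m ≤ P s (s + m * h) x y := by
      intro n y hn m hm
      induction m, hm using Nat.le_induction with
      | base => exact hn
      | succ m hm ih => exact fun s => hchain m s x y y (ih s) fun s => hself s y
    induction hirr x y with
    | refl => exact ⟨0, hmono 0 x fun s => by simp [hP.self_eq_one]⟩
    | @tail b c _ hbc ih =>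
      obtain ⟨n, hn⟩ := ih
      exact ⟨n + 1, hmono (n + 1) c fun s => hchain n s x b c (hn n le_rfl s) fun s => hstep s b c hbc⟩
  choose n hn using hreach
  obtain ⟨N, hN⟩ := (Set.finite_range fun q : S × S => n q.1 q.2).bddAbove
  refine ⟨(N + 1 : ℕ) * h, mul_pos (by positivity) (by exact_mod_cast hpos), δ ^ (N + 1), pow_pos hδpos _, pow_le_one₀ hδpos.le hδ1, ?_⟩
  intro s x y
  exact hn x y (N + 1) ((hN ⟨(x, y), rfl⟩).trans N.le_succ) s

/-- Exponential forgetting of the initial state. -/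
theorem IsTransitionFamily.exists_exp_bound (hP : IsTransitionFamily Q P) {Λ : ℝ}
    (hQ : ∀ u x y, |Q u x y| ≤ Λ) {ε : ℝ} (hε : 0 < ε) (hQε : ∀ x y, 0 < Q 1 x y → ∀ u, ε ≤ Q u x y)
    (hirr : IsIrreducibleRate (Q 1)) :
    ∃ B κ : ℝ, 0 < B ∧ 0 < κ ∧ ∀ (s u : ℝ≥0) (f : S → ℝ) (K : ℝ), (∀ x y, |f x - f y| ≤ K) →
      ∀ x x', |∑ y, P s (s + u) x y * f y - ∑ y, P s (s + u) x' y * f y|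
        ≤ B * K * Real.exp (-κ * u) := by
  obtain ⟨L, hL, δ, hδ, hδ1, hmin⟩ := hP.exists_minorization hQ hε hQε hirr
  have hL' : (0 : ℝ) < L := hL
  -- The remainder `v` of the elapsed time is carried along; over it oscillations at least do not
  -- grow, which is the contraction lemma with `δ = 0`.
  have hiter : ∀ (n : ℕ) (s v : ℝ≥0) (f : S → ℝ) (K : ℝ), (∀ x y, |f x - f y| ≤ K) →
      ∀ x x', |∑ y, P s (s + (n * L + v)) x y * f y - ∑ y, P s (s + (n * L + v)) x' y * f y|
        ≤ (1 - δ) ^ n * K := by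
    intro n
    induction n with
    | zero =>
      intro s v f K hf x x'
      have := abs_sum_mul_sub_sum_mul_le (hP.stochastic s (s + v) le_self_add) (δ := 0)
        (fun x y => hP.nonneg le_self_add x y) hf x x'
      simpa using this
    | succ n ih =>
      intro s v f K hf x x'
      have e : s + (((n + 1 : ℕ) : ℝ≥0) * L + v) = s + L + (n * L + v) := by push_cast; ring
      have e2 : ∀ x, ∑ y, P s (s + L + (n * L + v)) x y * f y
          = ∑ z, P s (s + L) x z * ∑ y, P (s + L) (s + L + (n * L + v)) z y * f y := by
        intro x
        rw [← hP.mul_eq hQ (le_self_add : s ≤ s + L) (le_self_add : s + L ≤ s + L + (n * L + v))]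
        simp_rw [Matrix.mul_apply, Finset.sum_mul, Finset.mul_sum]
        rw [Finset.sum_comm]
        simp_rw [mul_assoc]
      rw [e, e2, e2, pow_succ', mul_assoc]
      exact abs_sum_mul_sub_sum_mul_le (hP.stochastic s (s + L) le_self_add) (hmin s)
        (fun z z' => ih (s + L) v f K hf z z') x x'
  -- After `n = ⌊u / L⌋` contractions, `(1 - δ) ^ n ≤ exp (-δ n)` and `n > u / L - 1` give the rate
  -- `δ / L`; the incomplete last step costs the factor `exp δ`.
  refine ⟨Real.exp δ, δ / L, Real.exp_pos _, div_pos hδ hL', fun s u f K hf x x' => ?_⟩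
  have hK : 0 ≤ K := (abs_nonneg _).trans (hf x x)
  set n := ⌊u / L⌋₊ with hn
  have hnL : n * L ≤ u := by
    rw [← le_div_iff₀ hL]; exact Nat.floor_le zero_le
  have hu : u = n * L + (u - n * L) := (add_tsub_cancel_of_le hnL).symm
  have h1 := hiter n s (u - n * L) f K hf x x'
  rw [← hu] at h1
  refine h1.trans ?_
  have h2 : (1 - δ) ^ n ≤ Real.exp δ * Real.exp (-(δ / L) * u) := by
    calc (1 - δ) ^ n ≤ (Real.exp (-δ)) ^ n :=
          pow_le_pow_left₀ (by linarith) (Real.one_sub_le_exp_neg δ) n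
      _ = Real.exp (-δ * n) := by rw [← Real.exp_nat_mul]; ring_nf
      _ ≤ Real.exp (δ + -(δ / L) * u) := by
        rw [Real.exp_le_exp]
        have h3 : (u : ℝ) / L < n + 1 := by
          have := Nat.lt_floor_add_one (u / L)
          exact_mod_cast this
        have h4 : δ / L * u = δ * (u / L) := by ring
        nlinarith
      _ = _ := Real.exp_add _ _
  calc (1 - δ) ^ n * K ≤ Real.exp δ * Real.exp (-(δ / L) * u) * K := mul_le_mul_of_nonneg_right h2 hK
    _ = _ := by ring

end Transition

/-! ### Conditional probabilities as densities; the Poisson mean -/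

section ConditionalProbability

open scoped ENNReal

variable {Ω : Type*}

/-- Integration of measurable functions against a conditional probability. -/
theorem setLIntegral_eq_of_condExp {m m0 : MeasurableSpace Ω} (hm : m ≤ m0) {μ : Measure Ω}
    [IsFiniteMeasure μ] {B D : Set Ω} (hB : MeasurableSet B) {φ : Ω → ℝ}
    (h : ∀ᵐ ω ∂μ, ω ∈ D → (μ[B.indicator (fun _ => (1 : ℝ)) | m]) ω = φ ω)
    {ψ : Ω → ℝ≥0∞} (hψ : Measurable[m] ψ) (hD : ∀ ω, ω ∉ D → ψ ω = 0) :
    ∫⁻ ω in B, ψ ω ∂μ = ∫⁻ ω, ψ ω * ENNReal.ofReal (φ ω) ∂μ := by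
  set c := μ[B.indicator (fun _ => (1 : ℝ)) | m] with hc
  have hcm : Measurable[m] c := stronglyMeasurable_condExp.measurable
  have hc0 : 0 ≤ᵐ[μ] c :=
    condExp_nonneg (ae_of_all _ fun ω => Set.indicator_nonneg (fun _ _ => zero_le_one) ω)
  have hint : Integrable (B.indicator fun _ => (1 : ℝ)) μ := (integrable_const 1).indicator hB
  -- On `m`, the restriction of `μ` to `B` has density `c`, so non-negative `m`-measurable functions
  -- can be integrated without integrability. The formula `φ` for `c` is needed only on `D`, since
  -- `ψ` vanishes elsewhere.
  have hmeas : (μ.restrict B).trim hm = (μ.withDensity fun ω => ENNReal.ofReal (c ω)).trim hm := by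
    refine @Measure.ext _ m _ _ fun E hE => ?_
    rw [trim_measurableSet_eq hm hE, trim_measurableSet_eq hm hE, withDensity_apply _ (hm E hE),
      ← ofReal_integral_eq_lintegral_ofReal integrable_condExp.integrableOn (ae_restrict_of_ae hc0),
      setIntegral_condExp hm hint hE, integral_indicator hB, setIntegral_const, smul_eq_mul, mul_one,
      Measure.restrict_apply (hm E hE), Measure.real, Measure.restrict_apply hB, Set.inter_comm,
      ENNReal.ofReal_toReal (measure_ne_top _ _)]
  calc ∫⁻ ω in B, ψ ω ∂μ = ∫⁻ ω, ψ ω ∂((μ.restrict B).trim hm) := (lintegral_trim hm hψ).symm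
    _ = ∫⁻ ω, ψ ω ∂(μ.withDensity fun ω => ENNReal.ofReal (c ω)) := by rw [hmeas, lintegral_trim hm hψ]
    _ = ∫⁻ ω, ENNReal.ofReal (c ω) * ψ ω ∂μ := lintegral_withDensity_eq_lintegral_mul _
        ((hcm.mono hm le_rfl).ennreal_ofReal) (hψ.mono hm le_rfl)
    _ = ∫⁻ ω, ψ ω * ENNReal.ofReal (φ ω) ∂μ := by
        refine lintegral_congr_ae ?_
        filter_upwards [h] with ω hω
        by_cases hωD : ω ∈ D
        · rw [hω hωD, mul_comm]
        · rw [hD ω hωD, zero_mul, mul_zero]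

/-- Equality of integrals over the sets of a σ-algebra extends to measurable weights. -/
theorem lintegral_mul_eq_of_forall_setLIntegral_eq {m m0 : MeasurableSpace Ω} (hm : m ≤ m0)
    {μ : Measure Ω} {F G : Ω → ℝ≥0∞} (hF : AEMeasurable F μ) (hG : AEMeasurable G μ)
    (h : ∀ E, MeasurableSet[m] E → ∫⁻ ω in E, F ω ∂μ = ∫⁻ ω in E, G ω ∂μ)
    {ψ : Ω → ℝ≥0∞} (hψ : Measurable[m] ψ) :
    ∫⁻ ω, ψ ω * F ω ∂μ = ∫⁻ ω, ψ ω * G ω ∂μ := by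
  have hmeas : (μ.withDensity F).trim hm = (μ.withDensity G).trim hm := by
    refine @Measure.ext _ m _ _ fun E hE => ?_
    rw [trim_measurableSet_eq hm hE, trim_measurableSet_eq hm hE, withDensity_apply _ (hm E hE),
      withDensity_apply _ (hm E hE), h E hE]
  have key : ∀ {F : Ω → ℝ≥0∞}, AEMeasurable F μ →
      ∫⁻ ω, ψ ω * F ω ∂μ = ∫⁻ ω, ψ ω ∂((μ.withDensity F).trim hm) := by
    intro F hF
    rw [lintegral_trim hm hψ, lintegral_withDensity_eq_lintegral_mul₀ hF (hψ.mono hm le_rfl).aemeasurable]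
    simp [mul_comm]
  rw [key hF, key hG, hmeas]

/-- Mean of the Poisson distribution. -/
theorem tsum_mul_ofReal_poisson {l : ℝ} (hl : 0 ≤ l) :
    ∑' k : ℕ, (k : ℝ≥0∞) * ENNReal.ofReal (Real.exp (-l) * l ^ k / k.factorial) = ENNReal.ofReal l := by
  have h0 : ∀ k : ℕ, 0 ≤ Real.exp (-l) * l ^ k / k.factorial := fun k => by positivity
  have h1 : HasSum (fun k : ℕ => Real.exp (-l) * l ^ k / k.factorial) 1 := by
    have := (NormedSpace.expSeries_div_hasSum_exp (𝔸 := ℝ) l).mul_left (Real.exp (-l))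
    rw [← Real.exp_eq_exp_ℝ, ← Real.exp_add, neg_add_cancel, Real.exp_zero] at this
    simpa only [mul_div_assoc] using this
  -- The term `k = 0` vanishes, and for the others `k` cancels against `k!`, which leaves `l` times
  -- the total mass of the Poisson law.
  rw [tsum_eq_zero_add' ENNReal.summable, Nat.cast_zero, zero_mul, zero_add]
  have h2 : ∀ k : ℕ, ((k + 1 : ℕ) : ℝ≥0∞) * ENNReal.ofReal (Real.exp (-l) * l ^ (k + 1) / (k + 1).factorial)
      = ENNReal.ofReal l * ENNReal.ofReal (Real.exp (-l) * l ^ k / k.factorial) := by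
    intro k
    rw [← ENNReal.ofReal_natCast, ← ENNReal.ofReal_mul (Nat.cast_nonneg _), ← ENNReal.ofReal_mul hl]
    congr 1
    rw [Nat.factorial_succ]
    have : (k.factorial : ℝ) ≠ 0 := by exact_mod_cast k.factorial_ne_zero
    push_cast
    field_simp
    ring
  simp_rw [h2]
  rw [ENNReal.tsum_mul_left, ← ENNReal.ofReal_tsum_of_nonneg h0 h1.summable, h1.tsum_eq,
    ENNReal.ofReal_one, mul_one]

end ConditionalProbability

/-! ### A uniqueness theorem for events of a counting process -/

section Cylinders

open scoped ENNReal

/-- A finite set of times as the range of a monotone sequence starting at `0`. -/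
theorem exists_monotone_enumeration (F : Finset ℝ≥0) :
    ∃ (n : ℕ) (s : ℕ → ℝ≥0), Monotone s ∧ s 0 = 0 ∧ (∀ v ∈ F, ∃ i ≤ n, s i = v) ∧
      ∀ i, s i = 0 ∨ s i ∈ F := by
  induction F using Finset.induction_on_max with
  | empty => exact ⟨0, fun _ => 0, monotone_const, rfl, by simp, fun _ => Or.inl rfl⟩
  | insert a F hF ih =>
    obtain ⟨n, s, hs, hs0, hF1, hF2⟩ := ih
    have hle : ∀ i, s i ≤ a := fun i => (hF2 i).elim (fun h => h ▸ zero_le) fun h => (hF _ h).le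
    refine ⟨n + 1, fun i => if i ≤ n then s i else a, ?_, by simpa using hs0, ?_, ?_⟩
    · intro i j hij
      dsimp only
      split_ifs with h1 h2
      · exact hs hij
      · exact hle i
      · omega
      · rfl
    · intro v hv
      rcases Finset.mem_insert.1 hv with rfl | hv
      · exact ⟨n + 1, le_rfl, by simp⟩
      · obtain ⟨i, hi, he⟩ := hF1 v hv
        exact ⟨i, by omega, by simp [hi, he]⟩
    · intro i
      dsimp only
      split_ifs
      · exact (hF2 i).imp id fun h => Finset.mem_insert_of_mem h
      · exact Or.inr (Finset.mem_insert_self _ _)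

variable {Ω : Type*}

/-- Two measures which agree on the sets `E ∩ {increments of N on [0, a] are prescribed}`, where `E`
belongs to the σ-algebra `𝓧`, agree on the σ-algebra generated by `𝓧` and `N` on `[0, a]`. -/
theorem measure_eq_of_increments {m0 : MeasurableSpace Ω} {μ ν : Measure Ω} [IsFiniteMeasure μ]
    {N : ℝ≥0 → Ω → ℕ} (hN : ∀ t, Measurable (N t)) (hN0 : ∀ ω, N 0 ω = 0) (hmono : ∀ ω, Monotone fun t => N t ω) {𝓧 : MeasurableSpace Ω} (h𝓧 : 𝓧 ≤ m0) (a : ℝ≥0)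
    (h : ∀ E, MeasurableSet[𝓧] E → ∀ (n : ℕ) (s : ℕ → ℝ≥0), Monotone s → s 0 = 0 → s n = a → ∀ κ : ℕ → ℕ,
      μ (E ∩ {ω | ∀ i < n, N (s (i + 1)) ω = N (s i) ω + κ i})
        = ν (E ∩ {ω | ∀ i < n, N (s (i + 1)) ω = N (s i) ω + κ i}))
    {E : Set Ω} (hE : MeasurableSet[𝓧 ⊔ ⨆ v ∈ Set.Iic a, MeasurableSpace.comap (N v) inferInstance] E) :
    μ E = ν E := by
  set 𝓩 : MeasurableSpace Ω := 𝓧 ⊔ ⨆ v ∈ Set.Iic a, MeasurableSpace.comap (N v) inferInstance with h𝓩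
  have h𝓩m : 𝓩 ≤ m0 := sup_le h𝓧 (iSup₂_le fun v _ => (hN v).comap_le)
  -- Cylinders prescribe values rather than increments, so that they are closed under nonempty
  -- intersection. The condition `a ∈ F` makes the enumeration of `F` end at `a`; the sets `{N a =
  -- k}` are themselves such cylinders and cover `Ω`.
  let C : Set (Set Ω) := {A | ∃ E, MeasurableSet[𝓧] E ∧ ∃ F : Finset ℝ≥0, a ∈ F ∧ (∀ v ∈ F, v ≤ a) ∧
    ∃ k : ℝ≥0 → ℕ, A = E ∩ {ω | ∀ v ∈ F, N v ω = k v}}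
  have hNm : ∀ v ≤ a, Measurable[𝓩] (N v) := fun v hv =>
    (comap_measurable (N v)).mono ((le_iSup₂ (f := fun v (_ : v ∈ Set.Iic a) =>
      MeasurableSpace.comap (N v) inferInstance) v hv).trans le_sup_right) le_rfl
  have hpi : IsPiSystem C := by
    rintro _ ⟨E, hE, F, haF, hF, k, rfl⟩ _ ⟨E', hE', F', haF', hF', k', rfl⟩ ⟨ω0, hω0⟩
    refine ⟨E ∩ E', hE.inter hE', F ∪ F', Finset.mem_union_left _ haF, ?_, fun v => N v ω0, ?_⟩
    · intro v hv
      exact (Finset.mem_union.1 hv).elim (hF v) (hF' v)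
    · have hk : ∀ v ∈ F, N v ω0 = k v := hω0.1.2
      have hk' : ∀ v ∈ F', N v ω0 = k' v := hω0.2.2
      ext ω
      simp only [Set.mem_inter_iff, Set.mem_ofPred_eq, Finset.mem_union]
      constructor
      · rintro ⟨⟨h1, h2⟩, h3, h4⟩
        refine ⟨⟨h1, h3⟩, fun v hv => hv.elim (fun hv => ?_) fun hv => ?_⟩
        · rw [h2 v hv, hk v hv]
        · rw [h4 v hv, hk' v hv]
      · rintro ⟨⟨h1, h3⟩, h2⟩
        exact ⟨⟨h1, fun v hv => by rw [h2 v (Or.inl hv), hk v hv]⟩, h3,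
          fun v hv => by rw [h2 v (Or.inr hv), hk' v hv]⟩
  have hgen : 𝓩 = MeasurableSpace.generateFrom C := by
    apply le_antisymm
    · refine sup_le (fun E hE => ?_) (iSup₂_le fun v hv => ?_)
      · have : E = ⋃ k : ℕ, E ∩ {ω | ∀ w ∈ ({a} : Finset ℝ≥0), N w ω = (fun _ => k) w} := by
          ext ω; simp
        rw [this]
        exact MeasurableSet.iUnion fun k => MeasurableSpace.measurableSet_generateFrom
          ⟨E, hE, {a}, by simp, by simp, fun _ => k, rfl⟩
      · refine Measurable.comap_le (@measurable_to_countable' _ _ _ _ (_) _ fun k => ?_)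
        have : N v ⁻¹' {k} = ⋃ k' : ℕ, Set.univ ∩
            {ω | ∀ w ∈ ({a, v} : Finset ℝ≥0), N w ω = (fun w => if w = v then k else k') w} := by
          ext ω
          by_cases hav : a = v
          · subst hav; simp
          · simp [hav]
        rw [this]
        exact MeasurableSet.iUnion fun k' => MeasurableSpace.measurableSet_generateFrom
          ⟨Set.univ, MeasurableSet.univ, {a, v}, by simp, by simpa using hv, _, rfl⟩
    · refine MeasurableSpace.generateFrom_le ?_
      rintro _ ⟨E, hE, F, haF, hF, k, rfl⟩
      refine MeasurableSet.inter ((le_sup_left : 𝓧 ≤ 𝓩) E hE) ?_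
      have : {ω | ∀ v ∈ F, N v ω = k v} = ⋂ v ∈ F, N v ⁻¹' {k v} := by ext; simp
      rw [this]
      exact Finset.measurableSet_biInter F fun v hv => hNm v (hF v hv) (measurableSet_singleton _)
  have heq : @Measure.trim Ω 𝓩 m0 μ h𝓩m = @Measure.trim Ω 𝓩 m0 ν h𝓩m := by
    refine @Measure.ext_of_generateFrom_of_iUnion _ 𝓩 _ _ C
      (fun k => Set.univ ∩ {ω | ∀ w ∈ ({a} : Finset ℝ≥0), N w ω = (fun _ => k) w}) hgen hpi ?_ ?_ ?_ ?_
    · ext ω; simp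
    · exact fun k => ⟨Set.univ, MeasurableSet.univ, {a}, by simp, by simp, fun _ => k, rfl⟩
    · exact fun k => measure_ne_top _ _
    · intro A hA
      have hA𝓩 : MeasurableSet[𝓩] A := by rw [hgen]; exact MeasurableSpace.measurableSet_generateFrom hA
      rw [trim_measurableSet_eq h𝓩m hA𝓩, trim_measurableSet_eq h𝓩m hA𝓩]
      obtain ⟨E, hE, F, haF, hF, k, rfl⟩ := hA
      rcases Set.eq_empty_or_nonempty {ω | ∀ v ∈ F, N v ω = k v} with he | ⟨ω0, hω0⟩
      · rw [he, Set.inter_empty, measure_empty, measure_empty]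
      obtain ⟨n, s, hs, hs0, hF1, hF2⟩ := exists_monotone_enumeration F
      have hsn : s n = a := by
        apply le_antisymm
        · exact (hF2 n).elim (fun h => h ▸ zero_le) fun h => hF _ h
        · obtain ⟨i, hi, he⟩ := hF1 a haF
          rw [← he]; exact hs hi
      -- Since `N 0 = 0`, prescribing values along an enumeration from `0` is prescribing
      -- increments. They are read off at a point `ω0` of the cylinder, whose path is monotone, so
      -- the truncated subtraction is exact.
      have : {ω | ∀ v ∈ F, N v ω = k v} =
          {ω | ∀ i < n, N (s (i + 1)) ω = N (s i) ω + (N (s (i + 1)) ω0 - N (s i) ω0)} := by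
        ext ω
        simp only [Set.mem_ofPred_eq]
        constructor
        · intro hω i _
          have he : ∀ i, N (s i) ω = N (s i) ω0 := by
            intro i
            rcases hF2 i with h | h
            · rw [h, hN0, hN0]
            · rw [hω _ h, hω0 _ h]
          have := hmono ω0 (hs i.le_succ)
          simp only [Nat.succ_eq_add_one] at this
          rw [he, he]
          omega
        · intro hω v hv
          have he : ∀ i ≤ n, N (s i) ω = N (s i) ω0 := by
            intro i
            induction i with
            | zero => intro _; rw [hs0, hN0, hN0]
            | succ i ih =>
              intro hi
              have := hmono ω0 (hs i.le_succ)
              simp only [Nat.succ_eq_add_one] at this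
              rw [hω i (by omega), ih (by omega)]
              omega
          obtain ⟨i, hi, rfl⟩ := hF1 v hv
          rw [he i hi, hω0 _ hv]
      rw [this]
      exact h E hE n s hs hs0 hsn _
  rw [← trim_measurableSet_eq h𝓩m hE, heq, trim_measurableSet_eq h𝓩m hE]

end Cylinders

/-! ### The joint history of `X` and `N`: Markov property and compensator of `N` -/

section MarkovCox

open scoped ENNReal

theorem measurable_indicator_one {Ω : Type*} {_ : MeasurableSpace Ω} {E : Set Ω} (hE : MeasurableSet E) :
    Measurable (E.indicator (1 : Ω → ℝ≥0∞)) := measurable_one.indicator hE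

theorem measurable_setIntegral_path {S Ω : Type*} [Countable S] [MeasurableSpace S]
    [MeasurableSingletonClass S] {_ : MeasurableSpace Ω} {X : ℝ≥0 → Ω → S}
    (hX : ∀ t, Measurable (X t)) (hr : ∀ ω t, ∀ᶠ s in 𝓝[>] t, X s ω = X t ω)
    {f : ℝ≥0 → S → ℝ} (hf : ∀ x, Measurable fun u => f u x) (c d : ℝ≥0) :
    Measurable fun ω => ∫ u in Set.Ioc c d, f u (X u ω) ∂leb := by
  have hf' : Measurable fun q : ℝ≥0 × S => f q.1 q.2 := measurable_from_prod_countable_left hf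
  have h1 : Measurable fun q : ℝ≥0 × Ω => f q.1 (X q.1 q.2) :=
    hf'.comp (measurable_fst.prodMk (measurable_uncurry_of_right_cont hX hr))
  have h2 : StronglyMeasurable fun q : Ω × ℝ≥0 => f q.2 (X q.2 q.1) :=
    (h1.comp measurable_swap).stronglyMeasurable
  exact h2.integral_prod_right.measurable

namespace RewardProcess

variable {S Ω : Type*} [MeasurableSpace S] [MeasurableSpace Ω]

/-- `σ(N(s) : s ≤ t)`. -/
abbrev sigmaN (p : RewardProcess Ω S) (t : ℝ≥0) : MeasurableSpace Ω :=
  ⨆ v ∈ Set.Iic t, MeasurableSpace.comap (p.N v) inferInstance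

/-- `σ(X(s), N(s) : s ≤ t)`. -/
abbrev sigmaXNUpTo (p : RewardProcess Ω S) (t : ℝ≥0) : MeasurableSpace Ω :=
  p.sigmaXUpTo t ⊔ p.sigmaN t

variable {p : RewardProcess Ω S} {Pr : Measure Ω} {β : ℝ≥0 → S → ℝ}

theorem measurable_X_sigmaXUpTo {v s : ℝ≥0} (h : v ≤ s) : Measurable[p.sigmaXUpTo s] (p.X v) :=
  (comap_measurable (p.X v)).mono (le_iSup₂ (f := fun v (_ : v ∈ Set.Iic s) =>
    MeasurableSpace.comap (p.X v) inferInstance) v h) le_rfl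

theorem measurable_N_sigmaN {v s : ℝ≥0} (h : v ≤ s) : Measurable[p.sigmaN s] (p.N v) :=
  (comap_measurable (p.N v)).mono (le_iSup₂ (f := fun v (_ : v ∈ Set.Iic s) =>
    MeasurableSpace.comap (p.N v) inferInstance) v h) le_rfl

theorem measurable_X_sigmaX (v : ℝ≥0) : Measurable[p.sigmaX] (p.X v) :=
  (comap_measurable (p.X v)).mono (le_iSup (fun v => MeasurableSpace.comap (p.X v) inferInstance) v) le_rfl

theorem measurable_N_sigmaXN (v : ℝ≥0) : Measurable[p.sigmaXN] (p.N v) :=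
  (comap_measurable (p.N v)).mono
    ((le_iSup (fun v => MeasurableSpace.comap (p.N v) inferInstance) v).trans le_sup_right) le_rfl

theorem measurable_X_sigmaXN (v : ℝ≥0) : Measurable[p.sigmaXN] (p.X v) :=
  (measurable_X_sigmaX v).mono le_sup_left le_rfl

theorem sigmaXUpTo_le_sigmaX (s : ℝ≥0) : p.sigmaXUpTo s ≤ p.sigmaX :=
  iSup₂_le fun v _ => (measurable_X_sigmaX v).comap_le

theorem sigmaXNUpTo_le_sigmaXN (s : ℝ≥0) : p.sigmaXNUpTo s ≤ p.sigmaXN :=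
  sup_le ((sigmaXUpTo_le_sigmaX s).trans le_sup_left)
    (iSup₂_le fun v _ => (measurable_N_sigmaXN v).comap_le)

theorem sigmaXNUpTo_mono {s t : ℝ≥0} (h : s ≤ t) : p.sigmaXNUpTo s ≤ p.sigmaXNUpTo t :=
  sup_le_sup (iSup₂_le fun _ hv => (measurable_X_sigmaXUpTo (le_trans hv h)).comap_le)
    (iSup₂_le fun _ hv => (measurable_N_sigmaN (le_trans hv h)).comap_le)

theorem IsMarkovJump.isJumpPath {P : ℝ≥0 → ℝ≥0 → Matrix S S ℝ} (hX : p.IsMarkovJump P Pr) (ω : Ω) :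
    IsJumpPath fun t => p.X t ω :=
  ⟨fun t => hX.right_cont t ω, fun t => hX.left_lim t ω⟩

theorem IsMarkovJump.sigmaX_le {P : ℝ≥0 → ℝ≥0 → Matrix S S ℝ} (hX : p.IsMarkovJump P Pr) :
    p.sigmaX ≤ ‹MeasurableSpace Ω› := iSup_le fun v => (hX.measurable v).comap_le

theorem IsMarkovJump.sigmaXUpTo_le {P : ℝ≥0 → ℝ≥0 → Matrix S S ℝ} (hX : p.IsMarkovJump P Pr) (s : ℝ≥0) :
    p.sigmaXUpTo s ≤ ‹MeasurableSpace Ω› := iSup₂_le fun v _ => (hX.measurable v).comap_le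

theorem IsCoxCounting.isCountingPath (hN : p.IsCoxCounting β Pr) (ω : Ω) :
    IsCountingPath fun t => p.N t ω :=
  ⟨hN.mono ω, fun t => hN.right_cont t ω⟩

theorem IsCoxCounting.sigmaN_le (hN : p.IsCoxCounting β Pr) (s : ℝ≥0) :
    p.sigmaN s ≤ ‹MeasurableSpace Ω› := iSup₂_le fun v _ => (hN.measurable v).comap_le

theorem IsMarkovJump.sigmaXN_le {P : ℝ≥0 → ℝ≥0 → Matrix S S ℝ} (hX : p.IsMarkovJump P Pr)
    (hN : p.IsCoxCounting β Pr) : p.sigmaXN ≤ ‹MeasurableSpace Ω› :=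
  sup_le hX.sigmaX_le (iSup_le fun v => (hN.measurable v).comap_le)

variable [Fintype S] [MeasurableSingletonClass S] {P : ℝ≥0 → ℝ≥0 → Matrix S S ℝ}

/-- Up to `d ≤ s` the integral sees only the path stopped at `s`. -/
theorem IsMarkovJump.measurable_setIntegral_upTo (hX : p.IsMarkovJump P Pr) {f : ℝ≥0 → S → ℝ}
    (hf : ∀ x, Measurable fun u => f u x) (c : ℝ≥0) {d s : ℝ≥0} (hds : d ≤ s) :
    Measurable[p.sigmaXUpTo s] fun ω => ∫ u in Set.Ioc c d, f u (p.X u ω) ∂leb := by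
  have h := @measurable_setIntegral_path S Ω _ _ _ (p.sigmaXUpTo s) (fun t => p.X (min t s))
    (fun t => measurable_X_sigmaXUpTo (min_le_right t s))
    (fun ω t => ((hX.isJumpPath ω).stopped s).right_cont t) f hf c d
  have he : (fun ω => ∫ u in Set.Ioc c d, f u (p.X u ω) ∂leb)
      = fun ω => ∫ u in Set.Ioc c d, f u (p.X (min u s) ω) ∂leb := by
    ext ω
    refine setIntegral_congr_fun measurableSet_Ioc fun u hu => ?_
    simp only [min_eq_left (hu.2.trans hds)]
  rw [he]
  exact h

/-- The Markov property in integrated form. -/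
theorem IsMarkovJump.setLIntegral_eq [IsFiniteMeasure Pr] (hX : p.IsMarkovJump P Pr) {s t : ℝ≥0} (hst : s ≤ t)
    (y : S) {ψ : Ω → ℝ≥0∞} (hψ : Measurable[p.sigmaXUpTo s] ψ) :
    ∫⁻ ω in p.X t ⁻¹' {y}, ψ ω ∂Pr = ∫⁻ ω, ψ ω * ENNReal.ofReal (P s t (p.X s ω) y) ∂Pr :=
  setLIntegral_eq_of_condExp (hX.sigmaXUpTo_le s) (D := Set.univ) (hX.measurable t (measurableSet_singleton y))
    ((hX.markov s t hst y).mono fun _ h _ => h) hψ (fun _ h => absurd (Set.mem_univ _) h)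

/-- The conditional probability given `X` that `N` has the increments `k`. -/
noncomputable def poissonWeight (p : RewardProcess Ω S) (β : ℝ≥0 → S → ℝ) (n : ℕ) (s : ℕ → ℝ≥0) (k : ℕ → ℕ)
    (ω : Ω) : ℝ :=
  ∏ i ∈ Finset.range n,
    (Real.exp (-∫ u in Set.Ioc (s i) (s (i + 1)), β u (p.X u ω) ∂leb) *
      (∫ u in Set.Ioc (s i) (s (i + 1)), β u (p.X u ω) ∂leb) ^ k i / (k i).factorial)

theorem poissonWeight_nonneg (hβ : ∀ u x, 0 ≤ β u x) (n : ℕ) (s : ℕ → ℝ≥0) (k : ℕ → ℕ) (ω : Ω) :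
    0 ≤ p.poissonWeight β n s k ω := by
  refine Finset.prod_nonneg fun i _ => ?_
  have : 0 ≤ ∫ u in Set.Ioc (s i) (s (i + 1)), β u (p.X u ω) ∂leb := integral_nonneg fun u => hβ _ _
  positivity

theorem IsMarkovJump.measurable_poissonWeight (hX : p.IsMarkovJump P Pr)
    (hβm : ∀ x, Measurable fun u => β u x) {n : ℕ} {s : ℕ → ℝ≥0} (hs : Monotone s) (k : ℕ → ℕ) {a : ℝ≥0}
    (ha : s n ≤ a) : Measurable[p.sigmaXUpTo a] (p.poissonWeight β n s k) := by
  refine Finset.measurable_fun_prod _ fun i hi => ?_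
  have h := hX.measurable_setIntegral_upTo hβm (s i) ((hs (Finset.mem_range.1 hi)).trans ha : s (i + 1) ≤ a)
  exact ((Real.measurable_exp.comp h.neg).mul (h.pow_const _)).div_const _

theorem IsCoxCounting.measurableSet_increments (hN : p.IsCoxCounting β Pr) (n : ℕ) (s : ℕ → ℝ≥0)
    (k : ℕ → ℕ) : MeasurableSet {ω | ∀ i < n, p.N (s (i + 1)) ω = p.N (s i) ω + k i} := by
  have : {ω | ∀ i < n, p.N (s (i + 1)) ω = p.N (s i) ω + k i}
      = ⋂ i, ⋂ (_ : i < n), {ω | p.N (s (i + 1)) ω = p.N (s i) ω + k i} := by ext; simp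
  rw [this]
  exact MeasurableSet.iInter fun i => MeasurableSet.iInter fun _ =>
    measurableSet_eq_fun (hN.measurable _) ((hN.measurable _).add_const _)

/-- The Cox property in integrated form. -/
theorem IsCoxCounting.setLIntegral_eq [IsFiniteMeasure Pr] (hX : p.IsMarkovJump P Pr)
    (hN : p.IsCoxCounting β Pr) (n : ℕ) {s : ℕ → ℝ≥0} (hs : Monotone s) (k : ℕ → ℕ) {ψ : Ω → ℝ≥0∞}
    (hψ : Measurable[p.sigmaX] ψ) :
    ∫⁻ ω in {ω | ∀ i < n, p.N (s (i + 1)) ω = p.N (s i) ω + k i}, ψ ω ∂Pr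
      = ∫⁻ ω, ψ ω * ENNReal.ofReal (p.poissonWeight β n s k ω) ∂Pr :=
  setLIntegral_eq_of_condExp hX.sigmaX_le (D := Set.univ) (hN.measurableSet_increments n s k)
    ((hN.poisson n s hs k).mono fun _ h _ => h) hψ (fun _ h => absurd (Set.mem_univ _) h)

theorem _root_.MeasureTheory.lintegral_indicator_one_mul {μ : Measure Ω} {E : Set Ω} (hE : MeasurableSet E)
    (f : Ω → ℝ≥0∞) : ∫⁻ ω, E.indicator 1 ω * f ω ∂μ = ∫⁻ ω in E, f ω ∂μ := by
  rw [← lintegral_indicator hE]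
  congr 1
  ext ω
  by_cases h : ω ∈ E <;> simp [h]

/-- The Markov property with respect to the joint history of `X` and `N`. -/
theorem IsMarkovJump.measure_inter_eq [IsProbabilityMeasure Pr] (hX : p.IsMarkovJump P Pr)
    (hN : p.IsCoxCounting β Pr) (hβm : ∀ x, Measurable fun u => β u x)
    {s t : ℝ≥0} (hst : s ≤ t) (y : S) {E : Set Ω} (hE : MeasurableSet[p.sigmaXNUpTo s] E) :
    Pr (E ∩ p.X t ⁻¹' {y}) = ∫⁻ ω in E, ENNReal.ofReal (P s t (p.X s ω) y) ∂Pr := by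
  have hy : MeasurableSet (p.X t ⁻¹' {y}) := hX.measurable t (measurableSet_singleton y)
  have hPm : Measurable[p.sigmaXUpTo s] fun ω => ENNReal.ofReal (P s t (p.X s ω) y) :=
    (measurable_of_finite fun x => ENNReal.ofReal (P s t x y)).comp (measurable_X_sigmaXUpTo le_rfl)
  have hE' : MeasurableSet E := sup_le (hX.sigmaXUpTo_le s) (hN.sigmaN_le s) _ hE
  have key := measure_eq_of_increments (μ := Pr.restrict (p.X t ⁻¹' {y}))
    (ν := Pr.withDensity fun ω => ENNReal.ofReal (P s t (p.X s ω) y)) hN.measurable hN.zero hN.mono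
    (hX.sigmaXUpTo_le s) s ?_ hE
  · rw [Measure.restrict_apply hE', withDensity_apply _ hE'] at key
    exact key
  intro E1 hE1 n σ hσ _ hσn κ
  have hE1m := hX.sigmaXUpTo_le s _ hE1
  have hcyl := hN.measurableSet_increments n σ κ
  set cyl := {ω | ∀ i < n, p.N (σ (i + 1)) ω = p.N (σ i) ω + κ i} with hcyl_def
  set φ : Ω → ℝ≥0∞ := fun ω => ENNReal.ofReal (p.poissonWeight β n σ κ ω) with hφ
  have hφm : Measurable[p.sigmaXUpTo s] φ :=
    (hX.measurable_poissonWeight hβm hσ κ hσn.le).ennreal_ofReal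
  have hind : Measurable[p.sigmaXUpTo s] (E1.indicator (1 : Ω → ℝ≥0∞)) :=
    measurable_indicator_one hE1
  have hindy : Measurable[p.sigmaX] ((p.X t ⁻¹' {y}).indicator (1 : Ω → ℝ≥0∞)) :=
    measurable_indicator_one (measurable_X_sigmaX t (measurableSet_singleton y))
  have hle := sigmaXUpTo_le_sigmaX (p := p) s
  rw [Measure.restrict_apply (hE1m.inter hcyl), withDensity_apply _ (hE1m.inter hcyl)]
  -- Given `X`, the cylinder has probability `φ`, a function of `X` on `[0, s]` alone. It is
  -- replaced by `φ`, the Markov property of `X` is applied, and the cylinder is put back: the past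
  -- of `N` does not help to predict `X t`.
  calc Pr (E1 ∩ cyl ∩ p.X t ⁻¹' {y})
      = ∫⁻ ω in cyl, E1.indicator 1 ω * (p.X t ⁻¹' {y}).indicator 1 ω ∂Pr := by
        rw [lintegral_indicator_one_mul hE1m, Measure.restrict_restrict hE1m, lintegral_indicator_one hy,
          Measure.restrict_apply hy, Set.inter_comm]
    _ = ∫⁻ ω, E1.indicator 1 ω * (p.X t ⁻¹' {y}).indicator 1 ω * φ ω ∂Pr :=
        hN.setLIntegral_eq hX n hσ κ ((hind.mono hle le_rfl).mul hindy)
    _ = ∫⁻ ω in p.X t ⁻¹' {y}, E1.indicator 1 ω * φ ω ∂Pr := by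
        rw [← lintegral_indicator_one_mul hy]
        congr 1; ext ω; ring
    _ = ∫⁻ ω, E1.indicator 1 ω * φ ω * ENNReal.ofReal (P s t (p.X s ω) y) ∂Pr :=
        hX.setLIntegral_eq hst y (hind.mul hφm)
    _ = ∫⁻ ω, E1.indicator 1 ω * ENNReal.ofReal (P s t (p.X s ω) y) * φ ω ∂Pr := by
        congr 1; ext ω; ring
    _ = ∫⁻ ω in cyl, E1.indicator 1 ω * ENNReal.ofReal (P s t (p.X s ω) y) ∂Pr :=
        (hN.setLIntegral_eq hX n hσ κ ((hind.mul hPm).mono hle le_rfl)).symm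
    _ = ∫⁻ ω in E1 ∩ cyl, ENNReal.ofReal (P s t (p.X s ω) y) ∂Pr := by
        rw [lintegral_indicator_one_mul hE1m, Measure.restrict_restrict hE1m]

theorem setIntegral_path_le {Cβ : ℝ} (hβ : ∀ u x, 0 ≤ β u x) (hβC : ∀ u x, β u x ≤ Cβ) {a b : ℝ≥0}
    (hab : a ≤ b) (ω : Ω) : ∫ u in Set.Ioc a b, β u (p.X u ω) ∂leb ≤ Cβ * (b - a) :=
  (le_abs_self _).trans (norm_setIntegral_leb_Ioc_le hab fun u _ => by
    rw [abs_of_nonneg (hβ _ _)]; exact hβC _ _)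

/-- The compensator of `N` given `X` and the past of `N`. -/
theorem IsCoxCounting.setLIntegral_increment [IsProbabilityMeasure Pr] (hX : p.IsMarkovJump P Pr)
    (hN : p.IsCoxCounting β Pr) (hβm : ∀ x, Measurable fun u => β u x) (hβ : ∀ u x, 0 ≤ β u x) {Cβ : ℝ}
    (hβC : ∀ u x, β u x ≤ Cβ) {a b : ℝ≥0} (hab : a ≤ b) {E : Set Ω}
    (hE : MeasurableSet[p.sigmaX ⊔ p.sigmaN a] E) :
    ∫⁻ ω in E, ((p.N b ω - p.N a ω : ℕ) : ℝ≥0∞) ∂Pr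
      = ∫⁻ ω in E, ENNReal.ofReal (∫ u in Set.Ioc a b, β u (p.X u ω) ∂leb) ∂Pr := by
  have hE' : MeasurableSet E := sup_le hX.sigmaX_le (hN.sigmaN_le a) _ hE
  set l : Ω → ℝ := fun ω => ∫ u in Set.Ioc a b, β u (p.X u ω) ∂leb with hl
  have hl0 : ∀ ω, 0 ≤ l ω := fun ω => integral_nonneg fun u => hβ _ _
  have hlm : Measurable[p.sigmaX] l :=
    (hX.measurable_setIntegral_upTo hβm a (le_refl b)).mono (sigmaXUpTo_le_sigmaX b) le_rfl
  have hfin : IsFiniteMeasure (Pr.withDensity fun ω => ENNReal.ofReal (l ω)) := by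
    refine isFiniteMeasure_withDensity (ne_of_lt ?_)
    calc ∫⁻ ω, ENNReal.ofReal (l ω) ∂Pr ≤ ∫⁻ _ω, ENNReal.ofReal (Cβ * (b - a)) ∂Pr :=
          lintegral_mono fun ω => ENNReal.ofReal_le_ofReal (setIntegral_path_le hβ hβC hab ω)
      _ < ⊤ := by rw [lintegral_const, measure_univ, mul_one]; exact ENNReal.ofReal_lt_top
  have key := measure_eq_of_increments (μ := Pr.withDensity fun ω => ENNReal.ofReal (l ω))
    (ν := Pr.withDensity fun ω => ((p.N b ω - p.N a ω : ℕ) : ℝ≥0∞)) hN.measurable hN.zero hN.mono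
    hX.sigmaX_le a ?_ hE
  · rw [withDensity_apply _ hE', withDensity_apply _ hE'] at key
    exact key.symm
  intro E1 hE1 n σ hσ _ hσn κ
  have hE1m := hX.sigmaX_le _ hE1
  have hcyl := hN.measurableSet_increments n σ κ
  set cyl := {ω | ∀ i < n, p.N (σ (i + 1)) ω = p.N (σ i) ω + κ i} with hcyl_def
  set φ : Ω → ℝ≥0∞ := fun ω => ENNReal.ofReal (p.poissonWeight β n σ κ ω) with hφ
  have hφm : Measurable[p.sigmaX] φ :=
    ((hX.measurable_poissonWeight hβm hσ κ le_rfl).mono (sigmaXUpTo_le_sigmaX _) le_rfl).ennreal_ofReal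
  have hind : Measurable[p.sigmaX] (E1.indicator (1 : Ω → ℝ≥0∞)) :=
    measurable_indicator_one hE1
  set w : ℕ → Ω → ℝ≥0∞ := fun k ω => ENNReal.ofReal (Real.exp (-l ω) * l ω ^ k / k.factorial) with hw
  have hwm : ∀ k, Measurable[p.sigmaX] (w k) := fun k =>
    (((Real.measurable_exp.comp hlm.neg).mul (hlm.pow_const _)).div_const _).ennreal_ofReal
  -- The interval `(a, b]` is appended to the partition, and the conditional probability acquires
  -- the Poisson factor `w k`.
  have hstep : ∀ k : ℕ, Pr (E1 ∩ (cyl ∩ {ω | p.N b ω = p.N a ω + k})) = ∫⁻ ω, E1.indicator 1 ω * (φ ω * w k ω) ∂Pr := by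
    intro k
    set σ' : ℕ → ℝ≥0 := fun i => if i ≤ n then σ i else b with hσ'
    set κ' : ℕ → ℕ := fun i => if i < n then κ i else k with hκ'
    have hσ'm : Monotone σ' := by
      intro i j hij
      simp only [hσ']
      split_ifs with h1 h2
      · exact hσ hij
      · exact (hσ h1).trans (hσn.le.trans hab)
      · omega
      · rfl
    have e1 : cyl ∩ {ω | p.N b ω = p.N a ω + k} = {ω | ∀ i < n + 1, p.N (σ' (i + 1)) ω = p.N (σ' i) ω + κ' i} := by
      ext ω
      simp only [hcyl_def, Set.mem_inter_iff, Set.mem_ofPred_eq, Nat.lt_succ_iff_lt_or_eq, or_imp, forall_and, forall_eq]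
      refine and_congr (forall₂_congr fun i hi => ?_) ?_
      · simp [hσ', hκ', hi, hi.le, Nat.succ_le_iff.2 hi]
      · simp [hσ', hκ', hσn]
    have e2 : ∀ ω, ENNReal.ofReal (p.poissonWeight β (n + 1) σ' κ' ω) = φ ω * w k ω := by
      intro ω
      simp only [hφ, hw]
      rw [← ENNReal.ofReal_mul (poissonWeight_nonneg hβ _ _ _ _)]
      congr 1
      rw [poissonWeight, Finset.prod_range_succ, poissonWeight]
      congr 1
      · refine Finset.prod_congr rfl fun i hi => ?_
        rw [Finset.mem_range] at hi
        simp [hσ', hκ', hi, hi.le, Nat.succ_le_iff.2 hi]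
      · simp [hσ', hκ', hσn, hl]
    have h1 := hN.setLIntegral_eq hX (n + 1) hσ'm κ' hind
    rw [← e1] at h1
    simp_rw [e2] at h1
    rw [← h1, lintegral_indicator_one hE1m, Measure.restrict_apply hE1m]
  rw [withDensity_apply _ (hE1m.inter hcyl), withDensity_apply _ (hE1m.inter hcyl)]
  have hA : ∀ ω, ((p.N b ω - p.N a ω : ℕ) : ℝ≥0∞)
      = ∑' k : ℕ, (k : ℝ≥0∞) * {ω | p.N b ω = p.N a ω + k}.indicator 1 ω := by
    intro ω
    have hle : p.N a ω ≤ p.N b ω := hN.mono ω hab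
    rw [tsum_eq_single (p.N b ω - p.N a ω)]
    · rw [Set.indicator_of_mem]
      · simp
      · simp only [Set.mem_ofPred_eq]; omega
    · intro k hk
      rw [Set.indicator_of_notMem, mul_zero]
      simp only [Set.mem_ofPred_eq]; omega
  have hkm : ∀ k : ℕ, MeasurableSet {ω | p.N b ω = p.N a ω + k} := fun k =>
    measurableSet_eq_fun (hN.measurable _) ((hN.measurable _).add_const _)
  have hX' := hX.sigmaX_le
  symm
  -- The increment is split according to its value `k`. The sum of `k * w k` is the Poisson mean
  -- `l`, after which `φ` is turned back into the cylinder; this is possible because `l` is a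
  -- function of `X`.
  calc ∫⁻ ω in E1 ∩ cyl, ((p.N b ω - p.N a ω : ℕ) : ℝ≥0∞) ∂Pr
      = ∑' k : ℕ, (k : ℝ≥0∞) * Pr (E1 ∩ (cyl ∩ {ω | p.N b ω = p.N a ω + k})) := by
        simp_rw [hA]
        have hmm : ∀ k : ℕ, Measurable fun ω =>
            (k : ℝ≥0∞) * {ω | p.N b ω = p.N a ω + k}.indicator (1 : Ω → ℝ≥0∞) ω :=
          fun k => measurable_const.mul (measurable_indicator_one (hkm k))
        rw [lintegral_tsum fun k => (hmm k).aemeasurable]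
        refine tsum_congr fun k => ?_
        rw [lintegral_const_mul _ (measurable_indicator_one (hkm k)), lintegral_indicator_one (hkm k),
          Measure.restrict_apply (hkm k), Set.inter_comm, Set.inter_assoc]
    _ = ∑' k : ℕ, ∫⁻ ω, E1.indicator 1 ω * φ ω * ((k : ℝ≥0∞) * w k ω) ∂Pr := by
        refine tsum_congr fun k => ?_
        have hmm : Measurable fun ω => E1.indicator 1 ω * (φ ω * w k ω) :=
          (hind.mul (hφm.mul (hwm k))).mono hX' le_rfl
        rw [hstep k, ← lintegral_const_mul _ hmm]
        congr 1; ext ω; ring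
    _ = ∫⁻ ω, E1.indicator 1 ω * φ ω * ENNReal.ofReal (l ω) ∂Pr := by
        have hmm : ∀ k : ℕ, Measurable fun ω => E1.indicator 1 ω * φ ω * ((k : ℝ≥0∞) * w k ω) :=
          fun k => ((hind.mul hφm).mul ((hwm k).const_mul _)).mono hX' le_rfl
        rw [← lintegral_tsum fun k => (hmm k).aemeasurable]
        congr 1; ext ω
        rw [ENNReal.tsum_mul_left, tsum_mul_ofReal_poisson (hl0 ω)]
    _ = ∫⁻ ω, E1.indicator 1 ω * ENNReal.ofReal (l ω) * φ ω ∂Pr := by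
        congr 1; ext ω; ring
    _ = ∫⁻ ω in cyl, E1.indicator 1 ω * ENNReal.ofReal (l ω) ∂Pr :=
        (hN.setLIntegral_eq hX n hσ κ (hind.mul hlm.ennreal_ofReal)).symm
    _ = ∫⁻ ω in E1 ∩ cyl, ENNReal.ofReal (l ω) ∂Pr := by
        rw [lintegral_indicator_one_mul hE1m, Measure.restrict_restrict hE1m]

end RewardProcess

end MarkovCox

/-! ### Campbell's formula and limits over partitions -/

section Campbell

open scoped ENNReal

variable {Ω : Type*} {_ : MeasurableSpace Ω}

theorem tsum_ite_Ioc_eq_sum (a b : ℕ) (f : ℕ → ℝ≥0∞) :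
    ∑' j, (if a < j ∧ j ≤ b then f j else 0) = ∑ j ∈ Finset.Ioc a b, f j := by
  rw [tsum_eq_sum (s := Finset.Ioc a b)]
  · exact Finset.sum_congr rfl fun j hj => if_pos (Finset.mem_Ioc.1 hj)
  · exact fun j hj => if_neg fun h => hj (Finset.mem_Ioc.2 h)

theorem lintegral_sum_Ioc {μ : Measure Ω} {a b : Ω → ℕ} (ha : Measurable a) (hb : Measurable b)
    {f : ℕ → Ω → ℝ≥0∞} (hf : ∀ j, AEMeasurable (f j) μ) :
    ∫⁻ ω, ∑ j ∈ Finset.Ioc (a ω) (b ω), f j ω ∂μ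
      = ∑' j, ∫⁻ ω in {ω | a ω < j ∧ j ≤ b ω}, f j ω ∂μ := by
  have hm : ∀ j : ℕ, MeasurableSet {ω | a ω < j ∧ j ≤ b ω} := fun j =>
    (ha measurableSet_Iio).inter (hb measurableSet_Ici)
  simp_rw [← lintegral_indicator (hm _)]
  rw [← lintegral_tsum fun j => (hf j).indicator (hm j)]
  refine lintegral_congr fun ω => ?_
  rw [← tsum_ite_Ioc_eq_sum]
  exact tsum_congr fun j => by by_cases h : a ω < j ∧ j ≤ b ω <;> simp [h]

/-- Campbell's formula, deduced from the counts on intervals. -/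
theorem lintegral_sum_hit_eq {μ : Measure Ω} [IsFiniteMeasure μ] {A : ℝ≥0 → Ω → ℕ}
    (hA : ∀ t, Measurable (A t)) (hp : ∀ ω, IsCountingPath fun t => A t ω) {D : ℕ → Set Ω}
    (hD : ∀ j, MeasurableSet (D j)) {s t : ℝ≥0} {q : ℝ≥0 → ℝ≥0∞} (hq : Measurable q)
    (hfin : ∫⁻ u in Set.Ioc s t, q u ∂leb ≠ ⊤)
    (h : ∀ b, s ≤ b → b ≤ t → ∫⁻ ω, ∑ j ∈ Finset.Ioc (A s ω) (A b ω), (D j).indicator 1 ω ∂μ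
      = ∫⁻ u in Set.Ioc s b, q u ∂leb) {g : ℝ≥0 → ℝ≥0∞} (hg : Measurable g) :
    ∫⁻ ω, ∑ j ∈ Finset.Ioc (A s ω) (A t ω), (D j).indicator 1 ω * g (hit (fun t => A t ω) j) ∂μ
      = ∫⁻ u in Set.Ioc s t, g u * q u ∂leb := by
  have hAm : ∀ b (j : ℕ), MeasurableSet {ω | A s ω < j ∧ j ≤ A b ω} := fun b j =>
    (hA s measurableSet_Iio).inter (hA b measurableSet_Ici)
  have hhit := measurable_hit hA hp
  -- Both sides are integrals of `g`: against the intensity `m1` of the marked points in `(s, t]`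
  -- and against `m2` with density `q`. Finite measures that agree on the sets `Iic b` coincide, and
  -- there `hit ≤ b` is a statement about counts.
  set m1 : Measure ℝ≥0 := Measure.sum fun j =>
    (μ.restrict ({ω | A s ω < j ∧ j ≤ A t ω} ∩ D j)).map fun ω => hit (fun t => A t ω) j with hm1
  set m2 : Measure ℝ≥0 := (leb.restrict (Set.Ioc s t)).withDensity q with hm2
  have hm2fin : IsFiniteMeasure m2 := isFiniteMeasure_withDensity hfin
  have hcount : ∀ b, s ≤ b → b ≤ t →
      ∑' j, μ (({ω | A s ω < j ∧ j ≤ A b ω} ∩ D j)) = ∫⁻ u in Set.Ioc s b, q u ∂leb := by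
    intro b hsb hbt
    rw [← h b hsb hbt, lintegral_sum_Ioc (hA s) (hA b) fun j => (measurable_indicator_one (hD j)).aemeasurable]
    refine tsum_congr fun j => ?_
    rw [lintegral_indicator_one (hD j), Measure.restrict_apply (hD j), Set.inter_comm]
  have heq : m1 = m2 := by
    symm
    refine Measure.ext_of_Iic _ _ fun b => ?_
    rw [hm1, Measure.sum_apply _ measurableSet_Iic, hm2, withDensity_apply _ measurableSet_Iic,
      Measure.restrict_restrict measurableSet_Iic]
    have hj : ∀ j : ℕ, ((μ.restrict ({ω | A s ω < j ∧ j ≤ A t ω} ∩ D j)).map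
        fun ω => hit (fun t => A t ω) j) (Set.Iic b)
        = μ ({ω | A s ω < j ∧ j ≤ A (min b t) ω} ∩ D j) := by
      intro j
      rw [Measure.map_apply (hhit j) measurableSet_Iic, Measure.restrict_apply (hhit j measurableSet_Iic)]
      congr 1
      ext ω
      simp only [Set.mem_inter_iff, Set.mem_preimage, Set.mem_Iic, Set.mem_ofPred_eq]
      constructor
      · rintro ⟨h1, ⟨h2, h3⟩, h4⟩
        rw [(hp ω).hit_le_iff ⟨t, h3⟩] at h1
        refine ⟨⟨h2, ?_⟩, h4⟩
        rcases le_total b t with hbt | hbt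
        · rwa [min_eq_left hbt]
        · rwa [min_eq_right hbt]
      · rintro ⟨⟨h2, h3⟩, h4⟩
        have h5 : j ≤ A t ω := h3.trans ((hp ω).mono (min_le_right b t))
        exact ⟨((hp ω).hit_le_iff ⟨t, h5⟩).2 (h3.trans ((hp ω).mono (min_le_left b t))), ⟨h2, h5⟩, h4⟩
    simp_rw [hj]
    have hint : Set.Iic b ∩ Set.Ioc s t = Set.Ioc s (min b t) := by
      ext u
      simp only [Set.mem_inter_iff, Set.mem_Iic, Set.mem_Ioc, le_min_iff]
      tauto
    rcases le_total s (min b t) with hsb | hsb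
    · rw [hcount _ hsb (min_le_right b t), hint]
    · have h1 : ∀ j : ℕ, {ω | A s ω < j ∧ j ≤ A (min b t) ω} ∩ D j = ∅ := by
        intro j
        ext ω
        simp only [Set.mem_inter_iff, Set.mem_ofPred_eq, Set.mem_empty_iff_false, iff_false]
        rintro ⟨⟨h2, h3⟩, -⟩
        have : A (min b t) ω ≤ A s ω := (hp ω).mono hsb
        omega
      simp_rw [h1]
      rw [hint, Set.Ioc_eq_empty (not_lt.2 hsb)]
      simp
  calc ∫⁻ ω, ∑ j ∈ Finset.Ioc (A s ω) (A t ω), (D j).indicator 1 ω * g (hit (fun t => A t ω) j) ∂μ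
      = ∫⁻ u, g u ∂m1 := by
        have hmm : ∀ j, Measurable fun ω => (D j).indicator 1 ω * g (hit (fun t => A t ω) j) :=
          fun j => (measurable_indicator_one (hD j)).mul (hg.comp (hhit j))
        rw [hm1, lintegral_sum_measure, lintegral_sum_Ioc (hA s) (hA t) fun j => (hmm j).aemeasurable]
        refine tsum_congr fun j => ?_
        rw [lintegral_map hg (hhit j), lintegral_indicator_one_mul (hD j),
          Measure.restrict_restrict (hD j), Set.inter_comm]
    _ = ∫⁻ u in Set.Ioc s t, g u * q u ∂leb := by
        rw [heq, hm2, lintegral_withDensity_eq_lintegral_mul _ hq hg]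
        simp [mul_comm]

/-- Limits over partitions of the expectations of an interval function. -/
theorem integral_eq_of_grid {μ : Measure Ω} {F : ℝ≥0 → ℝ≥0 → Ω → ℝ} {V Z : Ω → ℝ}
    {s b : ℝ≥0} (hsb : s ≤ b) (hFint : ∀ c d, s ≤ c → c ≤ d → d ≤ b → Integrable (F c d) μ)
    (hpath : ∀ ω, ∀ᶠ n : ℕ in atTop, ∑ i ∈ Finset.range n, F (grid s b n i) (grid s b n (i + 1)) ω = V ω)
    (hZ : Integrable Z μ)
    (hdom : ∀ n ω, |∑ i ∈ Finset.range n, F (grid s b n i) (grid s b n (i + 1)) ω| ≤ Z ω)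
    {q : ℝ≥0 → ℝ} (hq : IntegrableOn q (Set.Ioc s b) leb) {C : ℝ}
    (hloc : ∀ c d, s ≤ c → c ≤ d → d ≤ b →
      |∫ ω, F c d ω ∂μ - ∫ u in Set.Ioc c d, q u ∂leb| ≤ C * ((d : ℝ) - c) ^ 2) :
    ∫ ω, V ω ∂μ = ∫ u in Set.Ioc s b, q u ∂leb := by
  have hgF : ∀ n i, i < n → Integrable (F (grid s b n i) (grid s b n (i + 1))) μ := fun n i hi =>
    hFint _ _ (left_le_grid _ _ _ _) (grid_mono _ _ _ i.le_succ) (grid_le_right hsb hi)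
  have h1 : Tendsto (fun n : ℕ => ∫ ω, ∑ i ∈ Finset.range n, F (grid s b n i) (grid s b n (i + 1)) ω ∂μ)
      atTop (𝓝 (∫ ω, V ω ∂μ)) := by
    refine tendsto_integral_of_dominated_convergence Z (fun n => ?_) hZ (fun n => ae_of_all _ (hdom n))
      (ae_of_all _ fun ω => tendsto_const_nhds.congr' ?_)
    · exact (integrable_finsetSum _ fun i hi => hgF n i (Finset.mem_range.1 hi)).aestronglyMeasurable
    · filter_upwards [hpath ω] with n hn using hn.symm
  -- The `n` local errors are quadratic in the mesh `(b - s) / n`, so their sum is of order `1 / n`.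
  have h2 : ∀ n : ℕ, 0 < n →
      |∫ ω, ∑ i ∈ Finset.range n, F (grid s b n i) (grid s b n (i + 1)) ω ∂μ - ∫ u in Set.Ioc s b, q u ∂leb|
        ≤ C * ((b : ℝ) - s) ^ 2 / n := by
    intro n hn
    have hsum : ∀ k ≤ n, ∫ u in Set.Ioc s (grid s b n k), q u ∂leb
        = ∑ i ∈ Finset.range k, ∫ u in Set.Ioc (grid s b n i) (grid s b n (i + 1)), q u ∂leb := by
      intro k
      induction k with
      | zero => intro _; simp [grid_zero]
      | succ k ih =>
        intro hk
        rw [Finset.sum_range_succ, ← ih (by omega)]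
        exact setIntegral_leb_Ioc_add (left_le_grid _ _ _ _) (grid_mono _ _ _ k.le_succ)
          (hq.mono_set (Set.Ioc_subset_Ioc_right (grid_le_right hsb hk)))
    have := hsum n le_rfl
    rw [grid_self hsb hn.ne'] at this
    rw [this, integral_finsetSum _ fun i hi => hgF n i (Finset.mem_range.1 hi), ← Finset.sum_sub_distrib]
    refine (Finset.abs_sum_le_sum_abs _ _).trans ?_
    calc ∑ i ∈ Finset.range n, |∫ ω, F (grid s b n i) (grid s b n (i + 1)) ω ∂μ
          - ∫ u in Set.Ioc (grid s b n i) (grid s b n (i + 1)), q u ∂leb|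
        ≤ ∑ i ∈ Finset.range n, C * (((b : ℝ) - s) / n) ^ 2 := by
          refine Finset.sum_le_sum fun i hi => ?_
          rw [← grid_succ_sub hsb n i]
          exact hloc _ _ (left_le_grid _ _ _ _) (grid_mono _ _ _ i.le_succ)
            (grid_le_right hsb (Finset.mem_range.1 hi))
      _ = C * ((b : ℝ) - s) ^ 2 / n := by
          rw [Finset.sum_const, Finset.card_range, nsmul_eq_mul]
          have : (n : ℝ) ≠ 0 := by exact_mod_cast hn.ne'
          field_simp
  have h3 : Tendsto (fun n : ℕ => ∫ ω, ∑ i ∈ Finset.range n, F (grid s b n i) (grid s b n (i + 1)) ω ∂μ)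
      atTop (𝓝 (∫ u in Set.Ioc s b, q u ∂leb)) := by
    refine tendsto_iff_dist_tendsto_zero.2 (squeeze_zero' (Eventually.of_forall fun n => dist_nonneg)
      (g := fun n : ℕ => C * ((b : ℝ) - s) ^ 2 / n) ?_ (tendsto_const_div_atTop_nhds_zero_nat _))
    filter_upwards [eventually_gt_atTop 0] with n hn
    exact h2 n hn
  exact tendsto_nhds_unique h1 h3

end Campbell

/-! ### Estimates over short intervals; the number of jumps has finite mean -/

section Compensators

open scoped ENNReal

namespace RewardProcess

variable {S Ω : Type*} [Fintype S] [DecidableEq S] [MeasurableSpace S] [MeasurableSingletonClass S]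
  [MeasurableSpace Ω] {p : RewardProcess Ω S} {Pr : Measure Ω} [IsProbabilityMeasure Pr]
  {β : ℝ≥0 → S → ℝ} {P : ℝ≥0 → ℝ≥0 → Matrix S S ℝ} {Q : ℝ≥0 → Matrix S S ℝ}

theorem IsMarkovJump.sum_measureReal_inter (hX : p.IsMarkovJump P Pr) (u : ℝ≥0) (E : Set Ω) :
    ∑ z, Pr.real (E ∩ p.X u ⁻¹' {z}) = Pr.real E := by
  have h := measureReal_biUnion_finset (μ := Pr.restrict E) (s := Finset.univ) (f := fun z => p.X u ⁻¹' {z})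
    (fun z _ z' _ hzz' => Set.disjoint_left.2 fun ω h1 h2 => hzz' (h1.symm.trans h2))
    (fun z _ => hX.measurable u (measurableSet_singleton z))
  have hu : ⋃ z ∈ (Finset.univ : Finset S), p.X u ⁻¹' {z} = Set.univ := by ext; simp
  rw [hu, measureReal_restrict_apply_univ] at h
  rw [h]
  refine Finset.sum_congr rfl fun z _ => ?_
  rw [measureReal_restrict_apply (hX.measurable u (measurableSet_singleton z)), Set.inter_comm]

/-- On `E ∩ {X u = z}` the transition probability is a constant and leaves the integral. -/
theorem IsMarkovJump.measureReal_inter_inter (hX : p.IsMarkovJump P Pr) (hP : IsTransitionFamily Q P)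
    (hN : p.IsCoxCounting β Pr) (hβm : ∀ x, Measurable fun u => β u x) {s u d : ℝ≥0} (hsu : s ≤ u)
    (hud : u ≤ d) {E : Set Ω} (hE : MeasurableSet[p.sigmaXNUpTo s] E) (z x : S) :
    Pr.real (E ∩ p.X u ⁻¹' {z} ∩ p.X d ⁻¹' {x}) = Pr.real (E ∩ p.X u ⁻¹' {z}) * P u d z x := by
  have hz : MeasurableSet[p.sigmaXNUpTo u] (E ∩ p.X u ⁻¹' {z}) :=
    (sigmaXNUpTo_mono hsu _ hE).inter
      ((le_sup_left : p.sigmaXUpTo u ≤ p.sigmaXNUpTo u) _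
        (measurable_X_sigmaXUpTo le_rfl (measurableSet_singleton z)))
  have hz' : MeasurableSet (E ∩ p.X u ⁻¹' {z}) := sup_le (hX.sigmaXUpTo_le u) (hN.sigmaN_le u) _ hz
  have h := hX.measure_inter_eq hN hβm hud x hz
  rw [setLIntegral_congr_fun (g := fun _ => ENNReal.ofReal (P u d z x)) hz'
    (fun ω hω => by simp only [show p.X u ω = z from hω.2]), setLIntegral_const] at h
  rw [Measure.real, h, ENNReal.toReal_mul, ENNReal.toReal_ofReal (hP.nonneg hud z x), mul_comm]
  rfl

/-- `P u d` is the identity up to `Λ (d - u)`, so a weight in the state at time `u` may be moved to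
the state at time `d` at linear cost. With `w = 1` this compares the law of `X` at two times; with
`w = β u` it serves the points of `N`. -/
theorem IsMarkovJump.abs_sum_sub_le (hX : p.IsMarkovJump P Pr) (hP : IsTransitionFamily Q P)
    (hN : p.IsCoxCounting β Pr) (hβm : ∀ x, Measurable fun u => β u x) {Λ : ℝ}
    (hQ : ∀ u x y, |Q u x y| ≤ Λ) {s u d : ℝ≥0} (hsu : s ≤ u)
    (hud : u ≤ d) {E : Set Ω} (hE : MeasurableSet[p.sigmaXNUpTo s] E) (x : S) {w : S → ℝ} {W : ℝ}
    (hw : ∀ z, |w z| ≤ W) :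
    |∑ z, w z * Pr.real (E ∩ p.X u ⁻¹' {z} ∩ p.X d ⁻¹' {x}) - w x * Pr.real (E ∩ p.X u ⁻¹' {x})|
      ≤ W * (Λ * (d - u)) := by
  have hΛ : 0 ≤ Λ := (abs_nonneg _).trans (hQ 0 x x)
  have hW : 0 ≤ W := (abs_nonneg _).trans (hw x)
  have hdu : (0 : ℝ) ≤ d - u := sub_nonneg.2 (by exact_mod_cast hud)
  have e : ∑ z, w z * Pr.real (E ∩ p.X u ⁻¹' {z} ∩ p.X d ⁻¹' {x}) - w x * Pr.real (E ∩ p.X u ⁻¹' {x})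
      = ∑ z, w z * (P u d z x - (1 : Matrix S S ℝ) z x) * Pr.real (E ∩ p.X u ⁻¹' {z}) := by
    simp_rw [hX.measureReal_inter_inter hP hN hβm hsu hud hE, mul_sub, sub_mul, Finset.sum_sub_distrib]
    congr 1
    · exact Finset.sum_congr rfl fun z _ => by ring
    · simp [Matrix.one_apply]
  rw [e]
  calc |∑ z, w z * (P u d z x - (1 : Matrix S S ℝ) z x) * Pr.real (E ∩ p.X u ⁻¹' {z})|
      ≤ ∑ z, |w z * (P u d z x - (1 : Matrix S S ℝ) z x) * Pr.real (E ∩ p.X u ⁻¹' {z})| :=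
        Finset.abs_sum_le_sum_abs _ _
    _ ≤ ∑ z, W * (Λ * (d - u)) * Pr.real (E ∩ p.X u ⁻¹' {z}) := by
        refine Finset.sum_le_sum fun z _ => ?_
        rw [abs_mul, abs_mul, abs_of_nonneg (measureReal_nonneg (μ := Pr))]
        refine mul_le_mul_of_nonneg_right ?_ measureReal_nonneg
        exact mul_le_mul (hw z) (hP.abs_sub_one_le hQ hud z x) (abs_nonneg _) hW
    _ = W * (Λ * (d - u)) * Pr.real E := by rw [← Finset.mul_sum, hX.sum_measureReal_inter]
    _ ≤ W * (Λ * (d - u)) * 1 :=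
        mul_le_mul_of_nonneg_left measureReal_le_one (mul_nonneg hW (mul_nonneg hΛ hdu))
    _ = _ := mul_one _

theorem IsMarkovJump.measurable_measureReal_inter (hX : p.IsMarkovJump P Pr) (E : Set Ω) (x : S) :
    Measurable fun u => Pr.real (E ∩ p.X u ⁻¹' {x}) := by
  have hm : MeasurableSet ((fun q : ℝ≥0 × Ω => p.X q.1 q.2) ⁻¹' {x}) :=
    measurable_uncurry_of_right_cont hX.measurable (fun ω t => hX.right_cont t ω) (measurableSet_singleton x)
  have h := measurable_measure_prodMk_left (ν := Pr.restrict E) hm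
  have e : (fun u => Pr.real (E ∩ p.X u ⁻¹' {x}))
      = fun u => (Pr.restrict E (Prod.mk u ⁻¹' ((fun q : ℝ≥0 × Ω => p.X q.1 q.2) ⁻¹' {x}))).toReal := by
    ext u
    rw [Measure.restrict_apply (measurable_prodMk_left hm), Measure.real, Set.inter_comm]
    rfl
  rw [e]
  exact h.ennreal_toReal

theorem IsMarkovJump.measurable_jumpCount (hX : p.IsMarkovJump P Pr) (t : ℝ≥0) :
    Measurable fun ω => jumpCount (fun t => p.X t ω) t :=
  _root_.measurable_jumpCount hX.measurable hX.isJumpPath t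

/-- The expected number of jumps in a bounded interval is finite. -/
theorem IsMarkovJump.integrable_jumpCount_sub (hX : p.IsMarkovJump P Pr) (hP : IsTransitionFamily Q P)
    (hN : p.IsCoxCounting β Pr) (hβm : ∀ x, Measurable fun u => β u x) {Λ : ℝ}
    (hQ : ∀ u x y, |Q u x y| ≤ Λ) {s t : ℝ≥0} (hst : s ≤ t) :
    Integrable (fun ω => (jumpCount (fun t => p.X t ω) t : ℝ) - jumpCount (fun t => p.X t ω) s) Pr := by
  set F : ℝ≥0 → ℝ≥0 → Ω → ℝ := fun c d ω => if p.X c ω ≠ p.X d ω then (1 : ℝ) else 0 with hF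
  have hpre : ∀ u x, MeasurableSet (p.X u ⁻¹' {x}) := fun u x => hX.measurable u (measurableSet_singleton x)
  have hset : ∀ c d, MeasurableSet {ω | p.X c ω ≠ p.X d ω} := by
    intro c d
    have : {ω | p.X c ω = p.X d ω} = ⋃ x, p.X c ⁻¹' {x} ∩ p.X d ⁻¹' {x} := by
      ext ω; simp [eq_comm]
    change MeasurableSet {ω | p.X c ω = p.X d ω}ᶜ
    rw [this]
    exact (MeasurableSet.iUnion fun x => (hpre c x).inter (hpre d x)).compl
  have hFm : ∀ c d, Measurable (F c d) := fun c d => Measurable.ite (hset c d) measurable_const measurable_const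
  have hF0 : ∀ c d ω, 0 ≤ F c d ω := fun c d ω => by simp only [hF]; split_ifs <;> norm_num
  set C : ℝ := ∑ _x : S, ∑ _y : S, Λ with hC
  have hFle : ∀ c d, c ≤ d → ∫⁻ ω, ENNReal.ofReal (F c d ω) ∂Pr ≤ ENNReal.ofReal (C * (d - c)) := by
    intro c d hcd
    have h1 : ∀ ω, ENNReal.ofReal (F c d ω) = {ω | p.X c ω ≠ p.X d ω}.indicator 1 ω := by
      intro ω
      by_cases h : p.X c ω = p.X d ω <;> simp [hF, h]
    simp_rw [h1]
    rw [lintegral_indicator_one (hset c d), ← ENNReal.ofReal_toReal (measure_ne_top Pr _)]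
    refine ENNReal.ofReal_le_ofReal ?_
    change Pr.real _ ≤ _
    have hsub : {ω | p.X c ω ≠ p.X d ω}
        ⊆ ⋃ x ∈ Finset.univ, ⋃ y ∈ Finset.univ.erase x, p.X c ⁻¹' {x} ∩ p.X d ⁻¹' {y} := by
      intro ω hω
      simp only [Finset.mem_univ, Finset.mem_erase, and_true, Set.iUnion_true, Set.mem_iUnion, Set.mem_inter_iff]
      exact ⟨p.X c ω, p.X d ω, fun h => hω h.symm, rfl, rfl⟩
    refine (measureReal_mono hsub (measure_ne_top _ _)).trans ?_
    refine (measureReal_biUnion_finset_le _ _).trans ?_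
    rw [hC, Finset.sum_mul]
    refine Finset.sum_le_sum fun x _ => ?_
    refine (measureReal_biUnion_finset_le _ _).trans ?_
    rw [Finset.sum_mul]
    have hΛ : 0 ≤ Λ := (abs_nonneg _).trans (hQ 0 x x)
    have hdc : (0 : ℝ) ≤ d - c := sub_nonneg.2 (by exact_mod_cast hcd)
    refine (Finset.sum_le_sum fun y hy => ?_).trans
      (Finset.sum_le_sum_of_subset_of_nonneg (Finset.erase_subset x _) fun _ _ _ => mul_nonneg hΛ hdc)
    have h2 := hX.measureReal_inter_inter hP hN hβm le_rfl hcd (E := Set.univ) MeasurableSet.univ x y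
    rw [Set.univ_inter] at h2
    rw [h2]
    have h3 := hP.abs_sub_one_le hQ hcd x y
    rw [Matrix.one_apply_ne (Finset.ne_of_mem_erase hy).symm, sub_zero, abs_of_nonneg (hP.nonneg hcd x y)] at h3
    exact (mul_le_of_le_one_left (hP.nonneg hcd x y) measureReal_le_one).trans h3
  refine ⟨(((measurable_from_top (f := fun n : ℕ => (n : ℝ))).comp (hX.measurable_jumpCount t)).sub
    ((measurable_from_top (f := fun n : ℕ => (n : ℝ))).comp (hX.measurable_jumpCount s))).aestronglyMeasurable, ?_⟩
  rw [hasFiniteIntegral_iff_ofReal (ae_of_all _ fun ω => sub_nonneg.2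
    (by exact_mod_cast (hX.isJumpPath ω).jumpCount_mono hst))]
  -- The partition counts converge to the number of jumps and have means at most `C (t - s)` for
  -- every `n ≥ 1`. Fatou's lemma is used because no dominating variable is at hand yet; the number
  -- of jumps itself will be one later.
  have hlim : ∀ ω, ENNReal.ofReal ((jumpCount (fun t => p.X t ω) t : ℝ) - jumpCount (fun t => p.X t ω) s)
      = liminf (fun n : ℕ => ENNReal.ofReal (∑ i ∈ Finset.range n, F (grid s t n i) (grid s t n (i + 1)) ω)) atTop := by
    intro ω
    refine (Tendsto.liminf_eq (tendsto_const_nhds.congr' ?_)).symm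
    filter_upwards [(hX.isJumpPath ω).eventually_sum_grid_change hst] with n hn
    rw [← hn]
    congr 1
    refine Finset.sum_congr rfl fun i _ => ?_
    simp only [hF]
    congr
  simp_rw [hlim]
  refine (lintegral_liminf_le fun n => (Finset.measurable_fun_sum _ fun i _ => hFm _ _).ennreal_ofReal).trans_lt ?_
  have hb : ∀ n : ℕ, 0 < n → ∫⁻ ω, ENNReal.ofReal (∑ i ∈ Finset.range n, F (grid s t n i) (grid s t n (i + 1)) ω) ∂Pr
      ≤ ENNReal.ofReal (C * (t - s)) := by
    intro n hn
    simp_rw [ENNReal.ofReal_sum_of_nonneg fun i _ => hF0 _ _ _]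
    rw [lintegral_finsetSum _ fun i _ => (hFm _ _).ennreal_ofReal]
    calc _ ≤ ∑ i ∈ Finset.range n, ENNReal.ofReal (C * ((t - s) / n)) := by
          refine Finset.sum_le_sum fun i _ => ?_
          rw [← grid_succ_sub hst n i]
          exact hFle _ _ (grid_mono _ _ _ i.le_succ)
      _ = ENNReal.ofReal (C * (t - s)) := by
          rw [Finset.sum_const, Finset.card_range, nsmul_eq_mul, ← ENNReal.ofReal_natCast,
            ← ENNReal.ofReal_mul (Nat.cast_nonneg _)]
          have : (n : ℝ) ≠ 0 := by exact_mod_cast hn.ne'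
          congr 1
          field_simp
  refine (liminf_le_of_frequently_le' (Eventually.frequently ?_)).trans_lt
    (ENNReal.ofReal_lt_top (r := C * (t - s)))
  filter_upwards [eventually_gt_atTop 0] with n hn using hb n hn

end RewardProcess

end Compensators

/-! ### Compensators of transitions of `X` and of points of `N` -/

section CompensatorFormulas

open scoped ENNReal

/-- Consecutive states of a jump path differ. -/
theorem IsJumpPath.apply_hit_ne {S : Type*} {x : ℝ≥0 → S} (hx : IsJumpPath x) {j : ℕ} {t : ℝ≥0} (hj : 0 < j)
    (hjt : j ≤ jumpCount x t) :
    x (hit (jumpCount x) (j - 1)) ≠ x (hit (jumpCount x) j) := by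
  have hc := hx.isCountingPath_jumpCount
  set T := hit (jumpCount x) j with hT
  have hTj : j ≤ jumpCount x T := (hc.hit_le_iff ⟨t, hjt⟩).1 le_rfl
  have hlt : ∀ v, v < T → jumpCount x v < j := fun v hv => by
    rw [← not_le, ← hc.hit_le_iff ⟨t, hjt⟩, not_le]; exact hv
  have hTpos : 0 < T := by
    rw [pos_iff_ne_zero]
    intro h0
    rw [h0, jumpCount_zero] at hTj
    omega
  obtain ⟨U, hU, hUle⟩ := hx.exists_nhds_jumpCount_le T
  have hTU : T ∈ U := mem_of_mem_nhds hU
  have : (𝓝[<] T).NeBot := nhdsLT_neBot_of_exists_lt ⟨0, hTpos⟩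
  have hJv : ∀ᶠ v in 𝓝[<] T, jumpCount x v = j - 1 := by
    filter_upwards [nhdsWithin_le_nhds hU, self_mem_nhdsWithin] with v hv hvT
    have h1 := hUle v hv T hTU (le_of_lt hvT)
    have h2 := hlt v hvT
    omega
  -- Just before `T` the path is in the state with index `j - 1`. Were this also the state at `T`,
  -- then `T` would be no jump time and the count could not increase there.
  intro heq
  have hxv : ∀ᶠ v in 𝓝[<] T, x v = x T := by
    filter_upwards [hJv] with v hv
    rw [← hx.apply_hit_jumpCount v, hv, heq]
  obtain ⟨ε, hε, hb⟩ := Metric.eventually_nhds_iff.1 (hx.eventually_notMem_jumpTimes T)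
  obtain ⟨v, ⟨hv1, hv2⟩, hvT⟩ := ((hJv.and (nhdsWithin_le_nhds (Metric.ball_mem_nhds T hε))).and
    self_mem_nhdsWithin).exists
  have hvT : v < T := hvT
  have hno : ∀ u ∈ Set.Ioc v T, u ∉ jumpTimes x := by
    intro u hu hu'
    have hd : dist u T < ε := by
      have hv2 : dist v T < ε := hv2
      rw [NNReal.dist_eq, abs_lt] at hv2
      rw [NNReal.dist_eq, abs_lt]
      have h1 : (v : ℝ) < u := by exact_mod_cast hu.1
      have h2 : (u : ℝ) ≤ T := by exact_mod_cast hu.2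
      constructor <;> linarith [hv2.1]
    have := hb hd hu'
    subst this
    exact hu' hxv
  have := jumpCount_eq_of_disjoint hvT.le hno
  omega

namespace RewardProcess

variable {S Ω : Type*} [Fintype S] [DecidableEq S] [MeasurableSpace S] [MeasurableSingletonClass S]
  [MeasurableSpace Ω] {p : RewardProcess Ω S} {Pr : Measure Ω} [IsProbabilityMeasure Pr]
  {β : ℝ≥0 → S → ℝ} {P : ℝ≥0 → ℝ≥0 → Matrix S S ℝ} {Q : ℝ≥0 → Matrix S S ℝ}

theorem IsMarkovJump.measurable_uncurry (hX : p.IsMarkovJump P Pr) :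
    Measurable fun q : ℝ≥0 × Ω => p.X q.1 q.2 :=
  measurable_uncurry_of_right_cont hX.measurable fun ω t => hX.right_cont t ω

theorem IsMarkovJump.measurable_X_hit (hX : p.IsMarkovJump P Pr) {A : ℝ≥0 → Ω → ℕ} (hA : ∀ t, Measurable (A t))
    (hp : ∀ ω, IsCountingPath fun t => A t ω) (k : ℕ) :
    Measurable fun ω => p.X (hit (fun t => A t ω) k) ω :=
  hX.measurable_uncurry.comp ((measurable_hit hA hp k).prodMk measurable_id)

theorem IsMarkovJump.setIntegral_comp_X (hX : p.IsMarkovJump P Pr) (u : ℝ≥0) (f : S → ℝ) (E : Set Ω) :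
    ∫ ω in E, f (p.X u ω) ∂Pr = ∑ z, f z * Pr.real (E ∩ p.X u ⁻¹' {z}) := by
  have hz : ∀ z, MeasurableSet (p.X u ⁻¹' {z}) := fun z => hX.measurable u (measurableSet_singleton z)
  have e : ∀ ω, f (p.X u ω) = ∑ z, (p.X u ⁻¹' {z}).indicator (fun _ => f z) ω := by
    intro ω
    rw [Finset.sum_eq_single (p.X u ω)]
    · simp
    · intro z _ hzz
      exact Set.indicator_of_notMem (fun h => hzz h.symm) _
    · simp
  simp_rw [e]
  rw [integral_finsetSum _ fun z _ => (integrable_const _).indicator (hz z)]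
  refine Finset.sum_congr rfl fun z _ => ?_
  rw [integral_indicator_const _ (hz z), measureReal_restrict_apply (hz z), smul_eq_mul, mul_comm, Set.inter_comm]

/-- Tonelli, with `Pr.real (E ∩ {X u = x})` unfolded as an integral over `E`. It turns an integral
in time back into the mean of a path integral. -/
theorem IsMarkovJump.lintegral_ofReal_mul_measureReal (hX : p.IsMarkovJump P Pr) {E : Set Ω} (x : S)
    {c : ℝ≥0 → ℝ} (hc : Measurable c) (hc0 : ∀ u, 0 ≤ c u) {g : ℝ≥0 → ℝ≥0∞} (hg : Measurable g) (s t : ℝ≥0) :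
    ∫⁻ u in Set.Ioc s t, g u * ENNReal.ofReal (c u * Pr.real (E ∩ p.X u ⁻¹' {x})) ∂leb
      = ∫⁻ ω in E, ∫⁻ u in Set.Ioc s t, (p.X u ⁻¹' {x}).indicator 1 ω * (ENNReal.ofReal (c u) * g u) ∂leb ∂Pr := by
  have hm : MeasurableSet ((fun q : ℝ≥0 × Ω => p.X q.1 q.2) ⁻¹' {x}) :=
    hX.measurable_uncurry (measurableSet_singleton x)
  have hjm : Measurable fun q : ℝ≥0 × Ω =>
      (p.X q.1 ⁻¹' {x}).indicator (1 : Ω → ℝ≥0∞) q.2 * (ENNReal.ofReal (c q.1) * g q.1) :=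
    (measurable_indicator_one hm).mul ((hc.ennreal_ofReal.mul hg).comp measurable_fst)
  rw [← lintegral_lintegral_swap hjm.aemeasurable]
  refine lintegral_congr fun u => ?_
  rw [lintegral_mul_const _ (measurable_indicator_one (hX.measurable u (measurableSet_singleton x))),
    lintegral_indicator_one (hX.measurable u (measurableSet_singleton x)),
    Measure.restrict_apply (hX.measurable u (measurableSet_singleton x)), ENNReal.ofReal_mul (hc0 u),
    Measure.real, ENNReal.ofReal_toReal (measure_ne_top _ _), Set.inter_comm]
  ring

theorem IsMarkovJump.integrableOn_mul_measureReal (hX : p.IsMarkovJump P Pr) (E : Set Ω) (x : S)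
    {c : ℝ≥0 → ℝ} (hc : Measurable c) {C : ℝ} (hC : ∀ u, |c u| ≤ C) (s t : ℝ≥0) :
    IntegrableOn (fun u => c u * Pr.real (E ∩ p.X u ⁻¹' {x})) (Set.Ioc s t) leb := by
  refine integrableOn_leb_Ioc_of_bound (hc.mul (hX.measurable_measureReal_inter E x)) (C := C) fun u => ?_
  rw [abs_mul, abs_of_nonneg (measureReal_nonneg (μ := Pr))]
  exact (mul_le_of_le_one_right (abs_nonneg _) measureReal_le_one).trans (hC u)

/-- The compensator of the number of jumps from `x` to `y`. -/
theorem IsMarkovJump.integral_transitions (hX : p.IsMarkovJump P Pr) (hP : IsTransitionFamily Q P)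
    (hN : p.IsCoxCounting β Pr) (hβm : ∀ x, Measurable fun u => β u x) {Λ : ℝ}
    (hQm : ∀ x y, Measurable fun u => Q u x y) (hQ : ∀ u x y, |Q u x y| ≤ Λ) {s b : ℝ≥0} (hsb : s ≤ b)
    {E : Set Ω} (hE : MeasurableSet[p.sigmaXNUpTo s] E) {x y : S} (hxy : x ≠ y) :
    ∫ ω in E, ∑ j ∈ Finset.Ioc (jumpCount (fun t => p.X t ω) s) (jumpCount (fun t => p.X t ω) b),
        (if p.X (hit (jumpCount fun t => p.X t ω) (j - 1)) ω = x ∧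
          p.X (hit (jumpCount fun t => p.X t ω) j) ω = y then (1 : ℝ) else 0) ∂Pr
      = ∫ u in Set.Ioc s b, Q u x y * Pr.real (E ∩ p.X u ⁻¹' {x}) ∂leb := by
  have hΛ : 0 ≤ Λ := (abs_nonneg _).trans (hQ 0 x y)
  have hpre : ∀ u x, MeasurableSet (p.X u ⁻¹' {x}) := fun u x => hX.measurable u (measurableSet_singleton x)
  have hE' : MeasurableSet E := sup_le (hX.sigmaXUpTo_le s) (hN.sigmaN_le s) _ hE
  have hFE : ∀ c d, (fun ω => if p.X c ω = x ∧ p.X d ω = y then (1 : ℝ) else 0)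
      = (p.X c ⁻¹' {x} ∩ p.X d ⁻¹' {y}).indicator fun _ => (1 : ℝ) := by
    intro c d; ext ω
    by_cases h : p.X c ω = x ∧ p.X d ω = y
    · rw [if_pos h, Set.indicator_of_mem (show ω ∈ p.X c ⁻¹' {x} ∩ p.X d ⁻¹' {y} from h)]
    · rw [if_neg h, Set.indicator_of_notMem (show ω ∉ p.X c ⁻¹' {x} ∩ p.X d ⁻¹' {y} from h)]
  refine integral_eq_of_grid (F := fun c d ω => if p.X c ω = x ∧ p.X d ω = y then (1 : ℝ) else 0)
    (C := Fintype.card S * Λ ^ 2 + Λ * Λ) hsb ?_ ?_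
    (hX.integrable_jumpCount_sub hP hN hβm hQ hsb).integrableOn ?_
    (hX.integrableOn_mul_measureReal E x (hQm x y) (fun u => hQ u x y) s b) ?_
  · intro c d _ _ _
    have h : Integrable _ (Pr.restrict E) := (integrable_const (1 : ℝ)).indicator ((hpre c x).inter (hpre d y))
    rwa [← hFE c d] at h
  · intro ω
    convert (hX.isJumpPath ω).eventually_sum_grid_transition hxy hsb using 4 <;> congr
  · intro n ω
    have h0 : ∀ c d, 0 ≤ (if p.X c ω = x ∧ p.X d ω = y then (1 : ℝ) else 0) := fun c d => by
      split_ifs <;> norm_num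
    rw [abs_of_nonneg (Finset.sum_nonneg fun i _ => h0 _ _)]
    have hJ := (hX.isJumpPath ω).jumpCount_mono
    rcases Nat.eq_zero_or_pos n with rfl | hn
    · simpa using hJ hsb
    -- An observed transition needs a jump in its interval, so the telescoping sum of jump counts
    -- dominates, uniformly in `n`.
    have htel := Finset.sum_range_sub (fun i => (jumpCount (fun t => p.X t ω) (grid s b n i) : ℝ)) n
    rw [grid_zero, grid_self hsb hn.ne'] at htel
    rw [← htel]
    refine Finset.sum_le_sum fun i _ => ?_
    have hle := hJ (grid_mono s b n i.le_succ)
    split_ifs with h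
    · have hlt := lt_of_le_of_ne hle fun he => hxy (by
        rw [← h.1, ← h.2]
        exact (hX.isJumpPath ω).eq_of_jumpCount_eq (grid_mono s b n i.le_succ) he)
      have : (jumpCount (fun t => p.X t ω) (grid s b n i) : ℝ) + 1 ≤ jumpCount (fun t => p.X t ω) (grid s b n (i + 1)) := by
        exact_mod_cast hlt
      linarith
    · exact sub_nonneg.2 (by exact_mod_cast hle)
  · intro c d hsc hcd hdb
    simp only [hFE c d]
    rw [integral_indicator_const _ ((hpre c x).inter (hpre d y)), smul_eq_mul, mul_one,
      measureReal_restrict_apply ((hpre c x).inter (hpre d y)), Set.inter_comm, ← Set.inter_assoc,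
      hX.measureReal_inter_inter hP hN hβm hsc hcd hE, (hP.forward c d hcd x y).2, Matrix.one_apply_ne hxy,
      zero_add, ← integral_const_mul, ← integral_sub ((hP.forward c d hcd x y).1.const_mul _)
      (hX.integrableOn_mul_measureReal E x (hQm x y) (fun u => hQ u x y) c d)]
    have hdc : (0 : ℝ) ≤ d - c := sub_nonneg.2 (by exact_mod_cast hcd)
    refine (norm_setIntegral_leb_Ioc_le hcd (C := (Fintype.card S * Λ ^ 2 + Λ * Λ) * (d - c)) fun u hu => ?_).trans_eq
      (by ring)
    have hud : (u : ℝ) - c ≤ d - c := by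
      have : (u : ℝ) ≤ d := by exact_mod_cast hu.2
      linarith
    have h1 := hP.abs_mul_sub_le hQ hu.1.le x y
    have h2 := hX.abs_sum_sub_le hP hN hβm hQ hsc hu.1.le hE x (w := fun _ => 1) (W := 1) (fun _ => by simp)
    have h3 : ∑ z, (1 : ℝ) * Pr.real (E ∩ p.X c ⁻¹' {z} ∩ p.X u ⁻¹' {x}) = Pr.real (E ∩ p.X u ⁻¹' {x}) := by
      simp_rw [one_mul]
      rw [← hX.sum_measureReal_inter c (E ∩ p.X u ⁻¹' {x})]
      exact Finset.sum_congr rfl fun z _ => by rw [Set.inter_right_comm]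
    rw [h3, one_mul, one_mul] at h2
    -- Two errors arise: from replacing `P Q` by `Q`, and from replacing the law of `X` at `c` by
    -- that at `u`. Each is linear in `d - c`, and integration over `(c, d]` supplies the second
    -- power.
    have e : Pr.real (E ∩ p.X c ⁻¹' {x}) * (P c u * Q u) x y - Q u x y * Pr.real (E ∩ p.X u ⁻¹' {x})
        = Pr.real (E ∩ p.X c ⁻¹' {x}) * ((P c u * Q u) x y - Q u x y)
          - Q u x y * (Pr.real (E ∩ p.X u ⁻¹' {x}) - Pr.real (E ∩ p.X c ⁻¹' {x})) := by ring
    rw [e]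
    refine (abs_sub _ _).trans ?_
    rw [abs_mul, abs_mul, abs_of_nonneg (measureReal_nonneg (μ := Pr)), add_mul]
    refine add_le_add ?_ ?_
    · refine (mul_le_of_le_one_left (abs_nonneg _) measureReal_le_one).trans (h1.trans ?_)
      exact mul_le_mul_of_nonneg_left hud (by positivity)
    · rw [mul_assoc]
      exact mul_le_mul (hQ u x y) (h2.trans (mul_le_mul_of_nonneg_left hud hΛ)) (abs_nonneg _) hΛ

/-- The compensator of the number of points of `N` in state `x`. -/
theorem IsMarkovJump.integral_points (hX : p.IsMarkovJump P Pr) (hP : IsTransitionFamily Q P)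
    (hN : p.IsCoxCounting β Pr) (hβm : ∀ x, Measurable fun u => β u x) {Λ : ℝ}
    (hQ : ∀ u x y, |Q u x y| ≤ Λ) (hβ : ∀ u x, 0 ≤ β u x) {Cβ : ℝ} (hβC : ∀ u x, β u x ≤ Cβ)
    {s b : ℝ≥0} (hsb : s ≤ b) {E : Set Ω} (hE : MeasurableSet[p.sigmaXNUpTo s] E) (x : S) :
    Integrable (fun ω => (p.N b ω : ℝ) - p.N s ω) Pr ∧
    ∫ ω in E, ∑ k ∈ Finset.Ioc (p.N s ω) (p.N b ω),
        (if p.X (hit (fun t => p.N t ω) k) ω = x then (1 : ℝ) else 0) ∂Pr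
      = ∫ u in Set.Ioc s b, β u x * Pr.real (E ∩ p.X u ⁻¹' {x}) ∂leb := by
  have hCβ : 0 ≤ Cβ := (hβ 0 x).trans (hβC 0 x)
  have hΛ : 0 ≤ Λ := (abs_nonneg _).trans (hQ 0 x x)
  have hβabs : ∀ u z, |β u z| ≤ Cβ := fun u z => by rw [abs_of_nonneg (hβ u z)]; exact hβC u z
  have hpre : ∀ u x, MeasurableSet (p.X u ⁻¹' {x}) := fun u x => hX.measurable u (measurableSet_singleton x)
  have hE' : MeasurableSet E := sup_le (hX.sigmaXUpTo_le s) (hN.sigmaN_le s) _ hE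
  have hNm : ∀ t, Measurable fun ω => (p.N t ω : ℝ) := fun t =>
    (measurable_from_top (f := fun n : ℕ => (n : ℝ))).comp (hN.measurable t)
  have hcast : ∀ {c d : ℝ≥0}, c ≤ d → ∀ ω, ENNReal.ofReal ((p.N d ω : ℝ) - p.N c ω) = ((p.N d ω - p.N c ω : ℕ) : ℝ≥0∞) := by
    intro c d hcd ω
    rw [← Nat.cast_sub (hN.mono ω hcd), ENNReal.ofReal_natCast]
  have hnn : ∀ {c d : ℝ≥0}, c ≤ d → ∀ ω, (0 : ℝ) ≤ (p.N d ω : ℝ) - p.N c ω := fun hcd ω =>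
    sub_nonneg.2 (by exact_mod_cast hN.mono ω hcd)
  have hInt : ∀ {c d : ℝ≥0}, c ≤ d → Integrable (fun ω => (p.N d ω : ℝ) - p.N c ω) Pr := by
    intro c d hcd
    refine ⟨((hNm d).sub (hNm c)).aestronglyMeasurable, ?_⟩
    rw [hasFiniteIntegral_iff_ofReal (ae_of_all _ (hnn hcd))]
    simp_rw [hcast hcd]
    have h := hN.setLIntegral_increment hX hβm hβ hβC hcd (E := Set.univ) MeasurableSet.univ
    rw [Measure.restrict_univ] at h
    rw [h]
    calc ∫⁻ ω, ENNReal.ofReal (∫ u in Set.Ioc c d, β u (p.X u ω) ∂leb) ∂Pr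
        ≤ ∫⁻ _ω, ENNReal.ofReal (Cβ * (d - c)) ∂Pr :=
          lintegral_mono fun ω => ENNReal.ofReal_le_ofReal (setIntegral_path_le hβ hβC hcd ω)
      _ < ⊤ := by rw [lintegral_const, measure_univ, mul_one]; exact ENNReal.ofReal_lt_top
  refine ⟨hInt hsb, ?_⟩
  have hFE : ∀ c d, (fun ω => if p.X d ω = x then ((p.N d ω : ℝ) - p.N c ω) else 0)
      = (p.X d ⁻¹' {x}).indicator fun ω => (p.N d ω : ℝ) - p.N c ω := by
    intro c d; ext ω
    by_cases h : p.X d ω = x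
    · rw [if_pos h, Set.indicator_of_mem (show ω ∈ p.X d ⁻¹' {x} from h)]
    · rw [if_neg h, Set.indicator_of_notMem (show ω ∉ p.X d ⁻¹' {x} from h)]
  refine integral_eq_of_grid (F := fun c d ω => if p.X d ω = x then ((p.N d ω : ℝ) - p.N c ω) else 0)
    (C := Cβ * Λ) hsb ?_ ?_ (hInt hsb).integrableOn ?_
    (hX.integrableOn_mul_measureReal E x (hβm x) (fun u => hβabs u x) s b) ?_
  · intro c d _ hcd _
    have h : Integrable _ (Pr.restrict E) := (hInt hcd).integrableOn.indicator (hpre d x)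
    rwa [← hFE c d] at h
  · exact fun ω => (hX.isJumpPath ω).eventually_sum_grid_count (hN.isCountingPath ω) x hsb
  · intro n ω
    have h0 : ∀ i, 0 ≤ (if p.X (grid s b n (i + 1)) ω = x then
        ((p.N (grid s b n (i + 1)) ω : ℝ) - p.N (grid s b n i) ω) else 0) := fun i => by
      split_ifs
      · exact hnn (grid_mono s b n i.le_succ) ω
      · exact le_rfl
    rw [abs_of_nonneg (Finset.sum_nonneg fun i _ => h0 _)]
    rcases Nat.eq_zero_or_pos n with rfl | hn
    · simpa using hN.mono ω hsb
    have htel := Finset.sum_range_sub (fun i => (p.N (grid s b n i) ω : ℝ)) n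
    rw [grid_zero, grid_self hsb hn.ne'] at htel
    rw [← htel]
    refine Finset.sum_le_sum fun i _ => ?_
    split_ifs
    · exact le_rfl
    · exact hnn (grid_mono s b n i.le_succ) ω
  · intro c d hsc hcd hdb
    simp only [hFE c d]
    have hEd : MeasurableSet (E ∩ p.X d ⁻¹' {x}) := hE'.inter (hpre d x)
    -- The event involves `X` at the later time `d`. For this reason the compensator of `N` is
    -- needed relative to all of `X` together with the past of `N`.
    have hEc : MeasurableSet[p.sigmaX ⊔ p.sigmaN c] (E ∩ p.X d ⁻¹' {x}) := by
      refine MeasurableSet.inter ?_ ?_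
      · exact sup_le_sup (sigmaXUpTo_le_sigmaX c) le_rfl _ (sigmaXNUpTo_mono hsc _ hE)
      · exact (le_sup_left : p.sigmaX ≤ p.sigmaX ⊔ p.sigmaN c) _ (measurable_X_sigmaX d (measurableSet_singleton x))
    have hjoint : StronglyMeasurable fun q : Ω × ℝ≥0 => β q.2 (p.X q.2 q.1) :=
      (((measurable_from_prod_countable_left hβm : Measurable fun q : ℝ≥0 × S => β q.1 q.2).comp
        (measurable_fst.prodMk hX.measurable_uncurry)).comp measurable_swap).stronglyMeasurable
    have hlm : Measurable fun ω => ∫ u in Set.Ioc c d, β u (p.X u ω) ∂leb :=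
      hjoint.integral_prod_right.measurable
    have h1 : ∫ ω in E, (p.X d ⁻¹' {x}).indicator (fun ω => (p.N d ω : ℝ) - p.N c ω) ω ∂Pr
        = ∫ ω in E ∩ p.X d ⁻¹' {x}, ∫ u in Set.Ioc c d, β u (p.X u ω) ∂leb ∂Pr := by
      rw [integral_indicator (hpre d x), Measure.restrict_restrict (hpre d x), Set.inter_comm,
        integral_eq_lintegral_of_nonneg_ae (ae_of_all _ (hnn hcd)) ((hNm d).sub (hNm c)).aestronglyMeasurable,
        integral_eq_lintegral_of_nonneg_ae (ae_of_all _ fun ω => integral_nonneg fun u => hβ _ _)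
          hlm.aestronglyMeasurable]
      simp_rw [hcast hcd]
      rw [hN.setLIntegral_increment hX hβm hβ hβC hcd hEc]
    have h2 : ∫ ω in E ∩ p.X d ⁻¹' {x}, ∫ u in Set.Ioc c d, β u (p.X u ω) ∂leb ∂Pr
        = ∫ u in Set.Ioc c d, ∑ z, β u z * Pr.real (E ∩ p.X u ⁻¹' {z} ∩ p.X d ⁻¹' {x}) ∂leb := by
      rw [integral_integral_swap]
      · refine integral_congr_ae (ae_of_all _ fun u => ?_)
        dsimp only
        rw [hX.setIntegral_comp_X u (β u)]
        exact Finset.sum_congr rfl fun z _ => by rw [Set.inter_right_comm]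
      · exact Integrable.of_bound hjoint.aestronglyMeasurable Cβ (ae_of_all _ fun q => hβabs _ _)
    rw [h1, h2, ← integral_sub]
    · refine (norm_setIntegral_leb_Ioc_le hcd (C := Cβ * Λ * (d - c)) fun u hu => ?_).trans_eq (by ring)
      have hud : (d : ℝ) - u ≤ d - c := by
        have : (c : ℝ) ≤ u := by exact_mod_cast hu.1.le
        linarith
      refine (hX.abs_sum_sub_le hP hN hβm hQ (hsc.trans hu.1.le) hu.2 hE x (w := β u) (W := Cβ)
        (fun z => hβabs u z)).trans ?_
      rw [mul_assoc]
      exact mul_le_mul_of_nonneg_left (mul_le_mul_of_nonneg_left hud hΛ) hCβ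
    · refine integrable_finsetSum _ fun z _ => ?_
      have := hX.integrableOn_mul_measureReal (E ∩ p.X d ⁻¹' {x}) z (hβm z) (fun u => hβabs u z) c d
      refine this.congr (ae_of_all _ fun u => ?_)
      simp only [Set.inter_right_comm]
    · exact hX.integrableOn_mul_measureReal E x (hβm x) (fun u => hβabs u x) c d

end RewardProcess

end CompensatorFormulas

/-! ### The Lévy system of `X` and marked sums over the points of `N` -/

section CompensatorSums

open scoped ENNReal

theorem measurable_sum_Ioc {Ω M : Type*} {_ : MeasurableSpace Ω} [AddCommMonoid M] [MeasurableSpace M]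
    [MeasurableAdd₂ M] {a b : Ω → ℕ} (ha : Measurable a) (hb : Measurable b) {f : ℕ → Ω → M}
    (hf : ∀ j, Measurable (f j)) : Measurable fun ω => ∑ j ∈ Finset.Ioc (a ω) (b ω), f j ω := by
  have h : Measurable fun q : (ℕ × ℕ) × Ω => ∑ j ∈ Finset.Ioc q.1.1 q.1.2, f j q.2 :=
    measurable_from_prod_countable_right fun n =>
      (Finset.measurable_fun_sum (Finset.Ioc n.1 n.2) fun j _ => hf j :)
  exact h.comp ((ha.prodMk hb).prodMk measurable_id)

theorem indicator_one_mul_of_mem {Ω : Type*} {A : Set Ω} {ω : Ω} (h : ω ∈ A) (c : ℝ≥0∞) :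
    A.indicator 1 ω * c = c := by
  rw [Set.indicator_of_mem h, Pi.one_apply, one_mul]

theorem indicator_one_mul_of_notMem {Ω : Type*} {A : Set Ω} {ω : Ω} (h : ω ∉ A) (c : ℝ≥0∞) :
    A.indicator 1 ω * c = 0 := by
  rw [Set.indicator_of_notMem h, zero_mul]

theorem abs_sum_Ioc_ite_le {a b : ℕ} (hab : a ≤ b) (D : ℕ → Prop) [DecidablePred D] :
    |∑ j ∈ Finset.Ioc a b, (if D j then (1 : ℝ) else 0)| ≤ (b : ℝ) - a := by
  rw [Finset.sum_boole, abs_of_nonneg (Nat.cast_nonneg _), ← Nat.cast_sub hab, ← Nat.card_Ioc]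
  exact_mod_cast Finset.card_filter_le _ _

theorem ofReal_sum_Ioc_ite {Ω : Type*} (a b : ℕ) (D : ℕ → Ω → Prop) (ω : Ω) [∀ j, Decidable (D j ω)] :
    ENNReal.ofReal (∑ j ∈ Finset.Ioc a b, (if D j ω then (1 : ℝ) else 0))
      = ∑ j ∈ Finset.Ioc a b, {ω | D j ω}.indicator 1 ω := by
  rw [ENNReal.ofReal_sum_of_nonneg fun j _ => by split_ifs <;> norm_num]
  refine Finset.sum_congr rfl fun j _ => ?_
  by_cases h : D j ω <;> simp [h]

namespace RewardProcess

variable {S Ω : Type*} [Fintype S] [DecidableEq S] [MeasurableSpace S] [MeasurableSingletonClass S]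
  [MeasurableSpace Ω] {p : RewardProcess Ω S} {Pr : Measure Ω} [IsProbabilityMeasure Pr]
  {β : ℝ≥0 → S → ℝ} {P : ℝ≥0 → ℝ≥0 → Matrix S S ℝ} {Q : ℝ≥0 → Matrix S S ℝ}

/-- Campbell's formula for `Pr` restricted to `E`: equality of mean counts on all intervals `(s, b]`
is upgraded to sums whose weight depends on the time of the point. -/
theorem IsMarkovJump.lintegral_sum_marked (hX : p.IsMarkovJump P Pr) {A : ℝ≥0 → Ω → ℕ}
    (hA : ∀ t, Measurable (A t)) (hp : ∀ ω, IsCountingPath fun t => A t ω) {D : ℕ → Ω → Prop}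
    [∀ j ω, Decidable (D j ω)] (hD : ∀ j, MeasurableSet {ω | D j ω}) {s t : ℝ≥0} {E : Set Ω} (x : S)
    (hAint : ∀ b, s ≤ b → b ≤ t → Integrable (fun ω => (A b ω : ℝ) - A s ω) Pr)
    {c : ℝ≥0 → ℝ} (hc : Measurable c) (hc0 : ∀ u, 0 ≤ c u) {C : ℝ} (hC : ∀ u, c u ≤ C)
    (h : ∀ b, s ≤ b → b ≤ t → ∫ ω in E, ∑ j ∈ Finset.Ioc (A s ω) (A b ω), (if D j ω then (1 : ℝ) else 0) ∂Pr
      = ∫ u in Set.Ioc s b, c u * Pr.real (E ∩ p.X u ⁻¹' {x}) ∂leb)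
    {g : ℝ≥0 → ℝ≥0∞} (hg : Measurable g) :
    ∫⁻ ω in E, ∑ j ∈ Finset.Ioc (A s ω) (A t ω), {ω | D j ω}.indicator 1 ω * g (hit (fun t => A t ω) j) ∂Pr
      = ∫⁻ ω in E, ∫⁻ u in Set.Ioc s t, (p.X u ⁻¹' {x}).indicator 1 ω * (ENNReal.ofReal (c u) * g u) ∂leb ∂Pr := by
  have hcabs : ∀ u, |c u| ≤ C := fun u => by rw [abs_of_nonneg (hc0 u)]; exact hC u
  have hqm : Measurable fun u => c u * Pr.real (E ∩ p.X u ⁻¹' {x}) := hc.mul (hX.measurable_measureReal_inter E x)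
  have hq0 : ∀ u, 0 ≤ c u * Pr.real (E ∩ p.X u ⁻¹' {x}) := fun u => mul_nonneg (hc0 u) measureReal_nonneg
  have hqi := fun b => hX.integrableOn_mul_measureReal E x hc hcabs s b
  rw [← hX.lintegral_ofReal_mul_measureReal x hc hc0 hg]
  refine lintegral_sum_hit_eq hA hp hD hqm.ennreal_ofReal ?_ (fun b hsb hbt => ?_) hg
  · exact ((hasFiniteIntegral_iff_ofReal (ae_of_all _ hq0)).1 (hqi t).2).ne
  · rw [← ofReal_integral_eq_lintegral_ofReal (hqi b) (ae_of_all _ hq0), ← h b hsb hbt,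
      ofReal_integral_eq_lintegral_ofReal]
    · refine lintegral_congr fun ω => ?_
      rw [ofReal_sum_Ioc_ite]
    · refine (hAint b hsb hbt).integrableOn.mono' ?_ (ae_of_all _ fun ω => ?_)
      · exact (measurable_sum_Ioc (hA s) (hA b) fun j =>
          Measurable.ite (hD j) measurable_const measurable_const).aestronglyMeasurable
      · exact abs_sum_Ioc_ite_le ((hp ω).mono hsb) _
    · exact ae_of_all _ fun ω => Finset.sum_nonneg fun j _ => by split_ifs <;> norm_num

/-- The Lévy system of the jump process `X`. -/
theorem IsMarkovJump.setLIntegral_sum_jumps (hX : p.IsMarkovJump P Pr) (hP : IsTransitionFamily Q P)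
    (hN : p.IsCoxCounting β Pr) (hβm : ∀ x, Measurable fun u => β u x) {Λ : ℝ}
    (hQm : ∀ x y, Measurable fun u => Q u x y) (hQ : ∀ u x y, |Q u x y| ≤ Λ)
    (hQ0 : ∀ u x y, x ≠ y → 0 ≤ Q u x y) {s t : ℝ≥0}
    {g : ℝ≥0 → S → S → ℝ≥0∞} (hg : ∀ x y, Measurable fun u => g u x y)
    {E : Set Ω} (hE : MeasurableSet[p.sigmaXNUpTo s] E) :
    ∫⁻ ω in E, ∑ j ∈ Finset.Ioc (p.J s ω) (p.J t ω), g (p.T j ω) (p.Y (j - 1) ω) (p.Y j ω) ∂Pr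
      = ∫⁻ ω in E, ∫⁻ u in Set.Ioc s t, ∑ y ∈ Finset.univ.erase (p.X u ω),
          ENNReal.ofReal (Q u (p.X u ω) y) * g u (p.X u ω) y ∂leb ∂Pr := by
  have hA := hX.measurable_jumpCount
  have hp := fun ω => (hX.isJumpPath ω).isCountingPath_jumpCount
  have hT : ∀ j, Measurable fun ω => hit (jumpCount fun t => p.X t ω) j := measurable_hit hA hp
  have hY : ∀ j, Measurable fun ω => p.X (hit (jumpCount fun t => p.X t ω) j) ω := hX.measurable_X_hit hA hp
  have hD : ∀ (x y : S) (j : ℕ), MeasurableSet {ω | p.X (hit (jumpCount fun t => p.X t ω) (j - 1)) ω = x ∧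
      p.X (hit (jumpCount fun t => p.X t ω) j) ω = y} := fun x y j =>
    (hY (j - 1) (measurableSet_singleton x)).inter (hY j (measurableSet_singleton y))
  have key : ∀ x, ∀ y ∈ Finset.univ.erase x, _ := fun x y hy =>
    hX.lintegral_sum_marked (E := E) hA hp (hD x y) x
      (fun b hsb _ => hX.integrable_jumpCount_sub hP hN hβm hQ hsb) (hQm x y)
      (fun u => hQ0 u x y (Finset.ne_of_mem_erase hy).symm) (fun u => (le_abs_self _).trans (hQ u x y))
      (fun b hsb (_ : b ≤ t) => hX.integral_transitions hP hN hβm hQm hQ hsb hE (Finset.ne_of_mem_erase hy).symm)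
      (hg x y)
  -- The jumps are sorted by the pair of states before and after. Diagonal pairs may be left out
  -- because consecutive states differ.
  have hL : ∀ ω, ∑ j ∈ Finset.Ioc (p.J s ω) (p.J t ω), g (p.T j ω) (p.Y (j - 1) ω) (p.Y j ω)
      = ∑ x, ∑ y ∈ Finset.univ.erase x, ∑ j ∈ Finset.Ioc (jumpCount (fun t => p.X t ω) s) (jumpCount (fun t => p.X t ω) t),
        {ω | p.X (hit (jumpCount fun t => p.X t ω) (j - 1)) ω = x ∧
          p.X (hit (jumpCount fun t => p.X t ω) j) ω = y}.indicator 1 ω * g (hit (jumpCount fun t => p.X t ω) j) x y := by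
    intro ω
    simp_rw [Finset.sum_comm (s := Finset.univ.erase _)]
    rw [Finset.sum_comm]
    refine Finset.sum_congr rfl fun j hj => ?_
    have hj' : jumpCount (fun t => p.X t ω) s < j ∧ j ≤ jumpCount (fun t => p.X t ω) t := Finset.mem_Ioc.1 hj
    have hne := (hX.isJumpPath ω).apply_hit_ne (by omega : 0 < j) hj'.2
    rw [Finset.sum_eq_single (p.Y (j - 1) ω), Finset.sum_eq_single (p.Y j ω)]
    · exact (indicator_one_mul_of_mem (by exact ⟨rfl, rfl⟩) _).symm
    · intro y _ hy
      exact indicator_one_mul_of_notMem (fun h => hy h.2.symm) _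
    · intro h
      exact absurd (Finset.mem_erase.2 ⟨fun h' => hne h'.symm, Finset.mem_univ _⟩) h
    · intro x _ hx
      exact Finset.sum_eq_zero fun y _ => indicator_one_mul_of_notMem (fun h => hx h.1.symm) _
    · exact fun h => absurd (Finset.mem_univ _) h
  have hR : ∀ ω u, ∑ y ∈ Finset.univ.erase (p.X u ω), ENNReal.ofReal (Q u (p.X u ω) y) * g u (p.X u ω) y
      = ∑ x, ∑ y ∈ Finset.univ.erase x, (p.X u ⁻¹' {x}).indicator 1 ω * (ENNReal.ofReal (Q u x y) * g u x y) := by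
    intro ω u
    symm
    rw [Finset.sum_eq_single (p.X u ω)]
    · refine Finset.sum_congr rfl fun y _ => ?_
      exact (indicator_one_mul_of_mem (by exact rfl) _)
    · intro x _ hx
      exact Finset.sum_eq_zero fun y _ => by
        exact indicator_one_mul_of_notMem (fun h => hx h.symm) _
    · exact fun h => absurd (Finset.mem_univ _) h
  have hLm : ∀ x y, Measurable fun ω => ∑ j ∈ Finset.Ioc (jumpCount (fun t => p.X t ω) s) (jumpCount (fun t => p.X t ω) t),
        {ω | p.X (hit (jumpCount fun t => p.X t ω) (j - 1)) ω = x ∧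
          p.X (hit (jumpCount fun t => p.X t ω) j) ω = y}.indicator (1 : Ω → ℝ≥0∞) ω
            * g (hit (jumpCount fun t => p.X t ω) j) x y := fun x y =>
    measurable_sum_Ioc (hA s) (hA t) fun j => (measurable_indicator_one (hD x y j)).mul ((hg x y).comp (hT j))
  have hRm : ∀ x y, Measurable fun q : Ω × ℝ≥0 =>
      (p.X q.2 ⁻¹' {x}).indicator (1 : Ω → ℝ≥0∞) q.1 * (ENNReal.ofReal (Q q.2 x y) * g q.2 x y) := fun x y =>
    (measurable_indicator_one ((hX.measurable_uncurry.comp measurable_swap) (measurableSet_singleton x))).mul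
      (((hQm x y).ennreal_ofReal.mul (hg x y)).comp measurable_snd)
  simp_rw [hL, hR]
  rw [lintegral_finsetSum _ fun x _ => Finset.measurable_fun_sum _ fun y _ => hLm x y]
  have hRx : ∀ ω, ∫⁻ u in Set.Ioc s t, ∑ x, ∑ y ∈ Finset.univ.erase x,
      (p.X u ⁻¹' {x}).indicator 1 ω * (ENNReal.ofReal (Q u x y) * g u x y) ∂leb
      = ∑ x, ∑ y ∈ Finset.univ.erase x, ∫⁻ u in Set.Ioc s t,
      (p.X u ⁻¹' {x}).indicator 1 ω * (ENNReal.ofReal (Q u x y) * g u x y) ∂leb := by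
    intro ω
    have hm : ∀ x y, Measurable fun u =>
      (p.X u ⁻¹' {x}).indicator (1 : Ω → ℝ≥0∞) ω * (ENNReal.ofReal (Q u x y) * g u x y) := fun x y =>
      (hRm x y).comp (measurable_const.prodMk measurable_id)
    rw [lintegral_finsetSum _ fun x _ => Finset.measurable_fun_sum _ fun y _ => hm x y]
    exact Finset.sum_congr rfl fun x _ => lintegral_finsetSum _ fun y _ => hm x y
  simp_rw [hRx]
  have hIm : ∀ x y, Measurable fun ω => ∫⁻ u in Set.Ioc s t,
      (p.X u ⁻¹' {x}).indicator 1 ω * (ENNReal.ofReal (Q u x y) * g u x y) ∂leb := fun x y =>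
    (hRm x y).lintegral_prod_right
  rw [lintegral_finsetSum _ fun x _ => Finset.measurable_fun_sum _ fun y _ => hIm x y]
  refine Finset.sum_congr rfl fun x _ => ?_
  rw [lintegral_finsetSum _ fun y _ => hLm x y, lintegral_finsetSum _ fun y _ => hIm x y]
  exact Finset.sum_congr rfl fun y hy => key x y hy

/-- The compensator of marked sums over the points of `N`. -/
theorem IsMarkovJump.setLIntegral_sum_points (hX : p.IsMarkovJump P Pr) (hP : IsTransitionFamily Q P)
    (hN : p.IsCoxCounting β Pr) (hβm : ∀ x, Measurable fun u => β u x) {Λ : ℝ}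
    (hQ : ∀ u x y, |Q u x y| ≤ Λ) (hβ : ∀ u x, 0 ≤ β u x) {Cβ : ℝ} (hβC : ∀ u x, β u x ≤ Cβ)
    {s t : ℝ≥0} {g : ℝ≥0 → S → ℝ≥0∞} (hg : ∀ x, Measurable fun u => g u x)
    {E : Set Ω} (hE : MeasurableSet[p.sigmaXNUpTo s] E) :
    ∫⁻ ω in E, ∑ k ∈ Finset.Ioc (p.N s ω) (p.N t ω), g (p.eventTime k ω) (p.X (p.eventTime k ω) ω) ∂Pr
      = ∫⁻ ω in E, ∫⁻ u in Set.Ioc s t, ENNReal.ofReal (β u (p.X u ω)) * g u (p.X u ω) ∂leb ∂Pr := by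
  have hA := hN.measurable
  have hp := hN.isCountingPath
  have hT : ∀ j, Measurable fun ω => hit (fun t => p.N t ω) j := measurable_hit hA hp
  have hY : ∀ j, Measurable fun ω => p.X (hit (fun t => p.N t ω) j) ω := hX.measurable_X_hit hA hp
  have hD : ∀ (x : S) (j : ℕ), MeasurableSet {ω | p.X (hit (fun t => p.N t ω) j) ω = x} := fun x j =>
    hY j (measurableSet_singleton x)
  have key : ∀ x, _ := fun x =>
    hX.lintegral_sum_marked (E := E) hA hp (hD x) x
      (fun b hsb _ => (hX.integral_points hP hN hβm hQ hβ hβC hsb hE x).1) (hβm x)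
      (fun u => hβ u x) (fun u => hβC u x)
      (fun b hsb (_ : b ≤ t) => (hX.integral_points hP hN hβm hQ hβ hβC hsb hE x).2) (hg x)
  have hL : ∀ ω, ∑ k ∈ Finset.Ioc (p.N s ω) (p.N t ω), g (p.eventTime k ω) (p.X (p.eventTime k ω) ω)
      = ∑ x, ∑ j ∈ Finset.Ioc (p.N s ω) (p.N t ω),
        {ω | p.X (hit (fun t => p.N t ω) j) ω = x}.indicator 1 ω * g (hit (fun t => p.N t ω) j) x := by
    intro ω
    rw [Finset.sum_comm]
    refine Finset.sum_congr rfl fun j hj => ?_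
    rw [Finset.sum_eq_single (p.X (p.eventTime j ω) ω)]
    · exact (indicator_one_mul_of_mem (by exact rfl) _).symm
    · intro x _ hx
      exact indicator_one_mul_of_notMem (fun h => hx h.symm) _
    · exact fun h => absurd (Finset.mem_univ _) h
  have hR : ∀ ω u, ENNReal.ofReal (β u (p.X u ω)) * g u (p.X u ω)
      = ∑ x, (p.X u ⁻¹' {x}).indicator 1 ω * (ENNReal.ofReal (β u x) * g u x) := by
    intro ω u
    symm
    rw [Finset.sum_eq_single (p.X u ω)]
    · exact indicator_one_mul_of_mem (by exact rfl) _
    · intro x _ hx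
      exact indicator_one_mul_of_notMem (fun h => hx h.symm) _
    · exact fun h => absurd (Finset.mem_univ _) h
  have hLm : ∀ x, Measurable fun ω => ∑ j ∈ Finset.Ioc (p.N s ω) (p.N t ω),
      {ω | p.X (hit (fun t => p.N t ω) j) ω = x}.indicator (1 : Ω → ℝ≥0∞) ω * g (hit (fun t => p.N t ω) j) x := fun x =>
    measurable_sum_Ioc (hA s) (hA t) fun j => (measurable_indicator_one (hD x j)).mul ((hg x).comp (hT j))
  have hRm : ∀ x, Measurable fun q : Ω × ℝ≥0 =>
      (p.X q.2 ⁻¹' {x}).indicator (1 : Ω → ℝ≥0∞) q.1 * (ENNReal.ofReal (β q.2 x) * g q.2 x) := fun x =>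
    (measurable_indicator_one ((hX.measurable_uncurry.comp measurable_swap) (measurableSet_singleton x))).mul
      (((hβm x).ennreal_ofReal.mul (hg x)).comp measurable_snd)
  simp_rw [hL, hR]
  rw [lintegral_finsetSum _ fun x _ => hLm x]
  have hRx : ∀ ω, ∫⁻ u in Set.Ioc s t, ∑ x, (p.X u ⁻¹' {x}).indicator 1 ω * (ENNReal.ofReal (β u x) * g u x) ∂leb
      = ∑ x, ∫⁻ u in Set.Ioc s t, (p.X u ⁻¹' {x}).indicator 1 ω * (ENNReal.ofReal (β u x) * g u x) ∂leb := by
    intro ω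
    exact lintegral_finsetSum _ fun x _ => (hRm x).comp (measurable_const.prodMk measurable_id)
  simp_rw [hRx]
  rw [lintegral_finsetSum _ fun x _ => (hRm x).lintegral_prod_right]
  exact Finset.sum_congr rfl fun x _ => key x

end RewardProcess

end CompensatorSums

/-! ### Conditionally independent real random variables -/

section CondLaw

open scoped ENNReal

/-- On `D`, given the σ-algebra `𝒳`, the random variables `ρ i`, `i ∈ I`, are independent with laws `κ i`. -/
def HasCondLaw {Ω ι : Type*} (𝒳 : MeasurableSpace Ω) {m0 : MeasurableSpace Ω} (μ : Measure Ω)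
    (ρ : ι → Ω → ℝ) (κ : ι → Ω → Measure ℝ) (D : Set Ω) (I : Finset ι) : Prop :=
  ∀ (u : ι → ℝ) (E : Set Ω), MeasurableSet[𝒳] E → E ⊆ D →
    μ (E ∩ {ω | ∀ i ∈ I, ρ i ω ≤ u i}) = ∫⁻ ω in E, ∏ i ∈ I, κ i ω (Set.Iic (u i)) ∂μ

variable {Ω ι : Type*} [DecidableEq ι] {𝒳 m0 : MeasurableSpace Ω} {μ : Measure[m0] Ω}
  {ρ : ι → Ω → ℝ} {κ : ι → Ω → Measure ℝ} {D : Set Ω} {I I' : Finset ι} {C : ℝ}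

theorem measurableSet_forall_le (hρ : ∀ i, Measurable (ρ i)) (I : Finset ι) (u : ι → ℝ) :
    MeasurableSet {ω | ∀ i ∈ I, ρ i ω ≤ u i} := by
  have : {ω | ∀ i ∈ I, ρ i ω ≤ u i} = ⋂ i ∈ I, {ω | ρ i ω ≤ u i} := by ext; simp
  rw [this]
  exact Finset.measurableSet_biInter _ fun i _ => measurableSet_le (hρ i) measurable_const

theorem measurable_prod_measure_Iic (hκ : ∀ i, Measurable (κ i)) (I : Finset ι) (u : ι → ℝ) :
    Measurable fun ω => ∏ i ∈ I, κ i ω (Set.Iic (u i)) :=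
  Finset.measurable_fun_prod _ fun i _ => (Measure.measurable_coe measurableSet_Iic).comp (hκ i)

theorem HasCondLaw.subset_left (h : HasCondLaw 𝒳 μ ρ κ D I) {D' : Set Ω} (hD : D' ⊆ D) :
    HasCondLaw 𝒳 μ ρ κ D' I := fun u E hE hED => h u E hE (hED.trans hD)

/-- With all bounds equal to `C` the product of the laws is `1`, so the exceptional part of `D` is
null. -/
theorem HasCondLaw.ae_le [IsFiniteMeasure μ] (h : HasCondLaw 𝒳 μ ρ κ D I) (h𝒳 : 𝒳 ≤ m0)
    (hρ : ∀ i, Measurable (ρ i)) (hD : MeasurableSet[𝒳] D) (hC : ∀ i ω, κ i ω (Set.Iic C) = 1) :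
    ∀ᵐ ω ∂μ, ω ∈ D → ∀ i ∈ I, ρ i ω ≤ C := by
  have h1 := h (fun _ => C) D hD subset_rfl
  simp only [hC, Finset.prod_const_one, lintegral_const, one_mul, Measure.restrict_apply_univ] at h1
  have hm := measurableSet_forall_le hρ I fun _ => C
  have h2 := measure_sdiff (μ := μ) (Set.inter_subset_left (s := D) (t := {ω | ∀ i ∈ I, ρ i ω ≤ C}))
    ((h𝒳 D hD).inter hm).nullMeasurableSet (measure_ne_top _ _)
  rw [h1, tsub_self] at h2
  filter_upwards [measure_eq_zero_iff_ae_notMem.1 h2] with ω hω hωD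
  by_contra hcon
  exact hω ⟨hωD, fun hh => hcon hh.2⟩

/-- A bound `-1/(n+1)` on one variable and `C` on the others describes a null event in `D`;
countably many `n` exhaust the negative values. -/
theorem HasCondLaw.ae_nonneg [IsFiniteMeasure μ] (h : HasCondLaw 𝒳 μ ρ κ D I) (h𝒳 : 𝒳 ≤ m0)
    (hρ : ∀ i, Measurable (ρ i)) (hD : MeasurableSet[𝒳] D) (hC : ∀ i ω, κ i ω (Set.Iic C) = 1)
    (h0 : ∀ i ω, κ i ω (Set.Iio 0) = 0) {i : ι} (hi : i ∈ I) :
    ∀ᵐ ω ∂μ, ω ∈ D → 0 ≤ ρ i ω := by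
  have key : ∀ n : ℕ, ∀ᵐ ω ∂μ, ω ∈ D → (∀ l ∈ I, ρ l ω ≤ C) → -(1 / ((n : ℝ) + 1)) < ρ i ω := by
    intro n
    have hn : -(1 / ((n : ℝ) + 1)) < 0 := neg_lt_zero.2 (by positivity)
    have h1 := h (fun l => if l = i then -(1 / ((n : ℝ) + 1)) else C) D hD subset_rfl
    rw [show (fun ω => ∏ l ∈ I, κ l ω (Set.Iic (if l = i then -(1 / ((n : ℝ) + 1)) else C))) = fun _ => 0 from
      funext fun ω => Finset.prod_eq_zero hi (by
        rw [if_pos rfl]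
        exact measure_mono_null (Set.Iic_subset_Iio.2 hn) (h0 i ω)), lintegral_zero] at h1
    filter_upwards [measure_eq_zero_iff_ae_notMem.1 h1] with ω hω hωD hle
    by_contra hcon
    refine hω ⟨hωD, fun l hl => ?_⟩
    split_ifs with hli
    · subst hli; exact not_lt.1 hcon
    · exact hle l hl
  filter_upwards [ae_all_iff.2 key, h.ae_le h𝒳 hρ hD hC] with ω hω hle hωD
  refine le_of_forall_pos_lt_add fun ε hε => ?_
  obtain ⟨n, hn⟩ := exists_nat_one_div_lt hε
  have := hω n hωD (hle hωD)
  linarith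

/-- The bound `C` is almost surely no constraint, which disposes of the surplus variables. -/
theorem HasCondLaw.subset_right [IsFiniteMeasure μ] (h : HasCondLaw 𝒳 μ ρ κ D I') (h𝒳 : 𝒳 ≤ m0)
    (hρ : ∀ i, Measurable (ρ i)) (hD : MeasurableSet[𝒳] D) (hC : ∀ i ω, κ i ω (Set.Iic C) = 1)
    (hI : I ⊆ I') : HasCondLaw 𝒳 μ ρ κ D I := by
  intro u E hE hED
  have h1 := h (fun l => if l ∈ I then u l else C) E hE hED
  have h2 : ∀ ω, ∏ l ∈ I', κ l ω (Set.Iic (if l ∈ I then u l else C)) = ∏ l ∈ I, κ l ω (Set.Iic (u l)) := by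
    intro ω
    rw [← Finset.prod_subset hI]
    · exact Finset.prod_congr rfl fun l hl => by rw [if_pos hl]
    · exact fun l _ hl => by rw [if_neg hl, hC]
  simp only [h2] at h1
  rw [← h1]
  refine measure_congr ?_
  filter_upwards [h.ae_le h𝒳 hρ hD hC] with ω hω
  refine propext (and_congr_right fun hωE => ⟨fun hh l hl => ?_, fun hh l hl => ?_⟩)
  · split_ifs with hli
    · exact hh l hli
    · exact hω (hED hωE) l hl
  · simpa [hl] using hh l (hI hl)

/-- Integration of `𝒳`-measurable functions over a cell. -/
theorem HasCondLaw.setLIntegral_inter_forall_le [IsFiniteMeasure μ] (h : HasCondLaw 𝒳 μ ρ κ D I) (h𝒳 : 𝒳 ≤ m0)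
    (hρ : ∀ i, Measurable (ρ i)) (hκ : ∀ i, Measurable (κ i)) (u : ι → ℝ) {E : Set Ω} (hE : MeasurableSet[𝒳] E)
    (hED : E ⊆ D) {F : Ω → ℝ≥0∞} (hF : Measurable[𝒳] F) :
    ∫⁻ ω in E ∩ {ω | ∀ i ∈ I, ρ i ω ≤ u i}, F ω ∂μ
      = ∫⁻ ω, F ω * (E.indicator 1 ω * ∏ i ∈ I, κ i ω (Set.Iic (u i))) ∂μ := by
  have hEm := h𝒳 E hE
  have hm := hEm.inter (measurableSet_forall_le hρ I u)
  rw [← lintegral_indicator_one_mul hm]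
  simp only [mul_comm (Set.indicator _ 1 _) (F _)]
  refine lintegral_mul_eq_of_forall_setLIntegral_eq h𝒳 (measurable_indicator_one hm).aemeasurable
    ((measurable_indicator_one hEm).mul (measurable_prod_measure_Iic hκ I u)).aemeasurable (fun E' hE' => ?_) hF
  simp only [Pi.mul_apply]
  rw [lintegral_indicator_one hm, Measure.restrict_apply hm, Set.inter_comm, ← Set.inter_assoc,
    h u (E' ∩ E) (hE'.inter hE) (Set.inter_subset_right.trans hED), lintegral_indicator_one_mul hEm,
    Measure.restrict_restrict hEm, Set.inter_comm]

/-- Mean of a further random variable on a cell. -/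
theorem HasCondLaw.setLIntegral_ofReal [IsFiniteMeasure μ] {i : ι} (hi : i ∉ I)
    (h : HasCondLaw 𝒳 μ ρ κ D (insert i I)) (h𝒳 : 𝒳 ≤ m0)
    (hρ : ∀ i, Measurable (ρ i)) (hκ : ∀ i, Measurable (κ i)) (u : ι → ℝ) {E : Set Ω} (hE : MeasurableSet[𝒳] E)
    (hED : E ⊆ D) :
    ∫⁻ ω in E ∩ {ω | ∀ i ∈ I, ρ i ω ≤ u i}, ENNReal.ofReal (ρ i ω) ∂μ
      = ∫⁻ ω in E, (∏ i ∈ I, κ i ω (Set.Iic (u i))) * ∫⁻ z, ENNReal.ofReal z ∂(κ i ω) ∂μ := by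
  have hEm := h𝒳 E hE
  have hm := hEm.inter (measurableSet_forall_le hρ I u)
  have hpm := measurable_prod_measure_Iic hκ I u
  have hκy : ∀ y, Measurable fun ω => κ i ω (Set.Iic y) := fun y =>
    (Measure.measurable_coe measurableSet_Iic).comp (hκ i)
  have hκz : Measurable fun ω => ∫⁻ z, ENNReal.ofReal z ∂(κ i ω) :=
    (Measure.measurable_lintegral ENNReal.measurable_ofReal).comp (hκ i)
  -- On the cell, `ρ i` is distributed as the mixture of the laws `κ i ω` weighted by the
  -- conditional probability of the cell. On half-lines this is the hypothesis with one more bound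
  -- `y` at `i`.
  have hmeas : (μ.restrict (E ∩ {ω | ∀ i ∈ I, ρ i ω ≤ u i})).map (ρ i)
      = ((μ.restrict E).withDensity fun ω => ∏ i ∈ I, κ i ω (Set.Iic (u i))).bind (κ i) := by
    have : IsFiniteMeasure ((μ.restrict (E ∩ {ω | ∀ i ∈ I, ρ i ω ≤ u i})).map (ρ i)) :=
      Measure.isFiniteMeasure_map _ _
    refine Measure.ext_of_Iic _ _ fun y => ?_
    rw [Measure.map_apply (hρ i) measurableSet_Iic, Measure.restrict_apply (hρ i measurableSet_Iic),
      Measure.bind_apply measurableSet_Iic (hκ i).aemeasurable,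
      lintegral_withDensity_eq_lintegral_mul _ hpm (hκy y)]
    have h1 := h (Function.update u i y) E hE hED
    have h2 : ρ i ⁻¹' Set.Iic y ∩ (E ∩ {ω | ∀ i ∈ I, ρ i ω ≤ u i})
        = E ∩ {ω | ∀ l ∈ insert i I, ρ l ω ≤ Function.update u i y l} := by
      ext ω
      simp only [Set.mem_inter_iff, Set.mem_preimage, Set.mem_Iic, Set.mem_ofPred_eq, Finset.mem_insert,
        forall_eq_or_imp, Function.update_self]
      have : (∀ l ∈ I, ρ l ω ≤ Function.update u i y l) ↔ ∀ l ∈ I, ρ l ω ≤ u l :=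
        forall₂_congr fun l hl => by rw [Function.update_of_ne (ne_of_mem_of_not_mem hl hi)]
      rw [this]
      tauto
    rw [h2, h1]
    refine lintegral_congr fun ω => ?_
    rw [Finset.prod_insert hi, Function.update_self, mul_comm, Pi.mul_apply]
    congr 1
    exact Finset.prod_congr rfl fun l hl => by rw [Function.update_of_ne (ne_of_mem_of_not_mem hl hi)]
  have h3 := lintegral_map (μ := μ.restrict (E ∩ {ω | ∀ i ∈ I, ρ i ω ≤ u i})) ENNReal.measurable_ofReal (hρ i)
  rw [← h3, hmeas, Measure.lintegral_bind (hκ i).aemeasurable ENNReal.measurable_ofReal.aemeasurable,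
    lintegral_withDensity_eq_lintegral_mul _ hpm hκz]
  rfl

end CondLaw

/-! ### The lump-sum rewards and their conditional laws -/

section Lumps

open scoped ENNReal

/-- Half-lines form a π-system generating the Borel sets, so measurable cdf's make the law itself a
measurable function of time. -/
theorem RewardModel.A1.measurable_G {S : Type*} {m : RewardModel S} (h : m.A1) (x y : S) :
    Measurable fun t => (m.G t x y : Measure ℝ) := by
  refine Measurable.measure_of_isPiSystem_of_isProbabilityMeasure (borel_eq_generateFrom_Iic ℝ) isPiSystem_Iic ?_
  rintro _ ⟨z, rfl⟩
  simpa only [ProbabilityTheory.ofReal_cdf] using (h.G x y z).ennreal_ofReal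

theorem RewardModel.A1.measurable_K {S : Type*} {m : RewardModel S} (h : m.A1) (x : S) :
    Measurable fun t => (m.K t x : Measure ℝ) := by
  refine Measurable.measure_of_isPiSystem_of_isProbabilityMeasure (borel_eq_generateFrom_Iic ℝ) isPiSystem_Iic ?_
  rintro _ ⟨z, rfl⟩
  simpa only [ProbabilityTheory.ofReal_cdf] using (h.K x z).ennreal_ofReal

theorem RewardModel.exists_lump_bound {S : Type*} [Fintype S] {m : RewardModel S} (h4 : m.A4) : ∃ C : ℝ, 0 ≤ C ∧ (∀ t x y, (m.G t x y : Measure ℝ) (Set.Iic C) = 1) ∧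
    (∀ t x, (m.H t x : Measure ℝ) (Set.Iic C) = 1) ∧ ∀ t x, (m.K t x : Measure ℝ) (Set.Iic C) = 1 := by
  obtain ⟨c, hG, hH, hK⟩ := h4.lump
  have hc : ∀ x, c x ≤ ∑ y, |c y| := fun x =>
    (le_abs_self _).trans (Finset.single_le_sum (f := fun y => |c y|) (fun _ _ => abs_nonneg _) (Finset.mem_univ x))
  have key : ∀ (κ : Measure ℝ) [IsProbabilityMeasure κ] x, κ (Set.Iic (c x)) = 1 → κ (Set.Iic (∑ y, |c y|)) = 1 :=
    fun κ _ x h => le_antisymm prob_le_one (h ▸ measure_mono (Set.Iic_subset_Iic.2 (hc x)))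
  exact ⟨∑ y, |c y|, Finset.sum_nonneg fun _ _ => abs_nonneg _, fun t x y => key _ x (hG t x y).2,
    fun t x => key _ x (hH t x).2, fun t x => key _ x (hK t x).2⟩

/-- Indices of the first `a` jump rewards, `b` scheduled rewards and `c` external rewards. -/
def rewardIdx (a b c : ℕ) : Finset (ℕ ⊕ ℕ ⊕ ℕ) :=
  (Finset.range a).disjSum ((Finset.range b).disjSum (Finset.range c))

theorem inl_mem_rewardIdx {a b c j : ℕ} : Sum.inl j ∈ rewardIdx a b c ↔ j < a := by
  simp [rewardIdx]

theorem inr_inl_mem_rewardIdx {a b c i : ℕ} : Sum.inr (Sum.inl i) ∈ rewardIdx a b c ↔ i < b := by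
  simp [rewardIdx]

theorem inr_inr_mem_rewardIdx {a b c k : ℕ} : Sum.inr (Sum.inr k) ∈ rewardIdx a b c ↔ k < c := by
  simp [rewardIdx]

theorem rewardIdx_subset {a b c a' b' c' : ℕ} (ha : a ≤ a') (hb : b ≤ b') (hc : c ≤ c') :
    rewardIdx a b c ⊆ rewardIdx a' b' c' :=
  Finset.disjSum_mono (Finset.range_mono ha) (Finset.disjSum_mono (Finset.range_mono hb) (Finset.range_mono hc))

namespace RewardProcess

variable {S Ω : Type*}

/-- The lump-sum rewards as a single family. -/
def reward (p : RewardProcess Ω S) : ℕ ⊕ ℕ ⊕ ℕ → Ω → ℝ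
  | Sum.inl j => p.jumpReward (j + 1)
  | Sum.inr (Sum.inl i) => p.schedReward (i + 1)
  | Sum.inr (Sum.inr k) => p.extReward (k + 1)

/-- The conditional laws of the lump-sum rewards. -/
noncomputable def rewardLaw (p : RewardProcess Ω S) (m : RewardModel S) : ℕ ⊕ ℕ ⊕ ℕ → Ω → Measure ℝ
  | Sum.inl j => fun ω => m.G (p.T (j + 1) ω) (p.Y j ω) (p.Y (j + 1) ω)
  | Sum.inr (Sum.inl i) => fun ω => m.H (m.τ (i + 1)) (p.X (m.τ (i + 1)) ω)
  | Sum.inr (Sum.inr k) => fun ω => m.K (p.eventTime (k + 1) ω) (p.X (p.eventTime (k + 1) ω) ω)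

/-- The event that there are at least `a` jumps and at least `c` external events. -/
def atLeast (p : RewardProcess Ω S) (a c : ℕ) : Set Ω := {ω | (∃ t, a ≤ p.J t ω) ∧ ∃ t, c ≤ p.N t ω}

/-- The process stopped at `s`. -/
def stopped (p : RewardProcess Ω S) (s : ℝ≥0) : RewardProcess Ω S :=
  { p with X := fun t => p.X (min t s), N := fun t => p.N (min t s) }

/-- The laws of rewards already collected by time `s` depend only on the past. Through the stopped
process this makes conditional probabilities of cells measurable with respect to `X` and `N` up to
`s`. -/
theorem rewardLaw_stopped {p : RewardProcess Ω S} {m : RewardModel S} {s : ℝ≥0} {ω : Ω} {a b c : ℕ}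
    (hpX : IsJumpPath fun t => p.X t ω) (hpN : IsCountingPath fun t => p.N t ω)
    (ha : a ≤ p.J s ω) (hb : ∀ i < b, m.τ (i + 1) ≤ s) (hc : c ≤ p.N s ω) {l : ℕ ⊕ ℕ ⊕ ℕ}
    (hl : l ∈ rewardIdx a b c) : (p.stopped s).rewardLaw m l ω = p.rewardLaw m l ω := by
  have hA := hpX.isCountingPath_jumpCount
  have hT : ∀ j ≤ p.J s ω, (p.stopped s).T j ω = p.T j ω ∧ p.T j ω ≤ s := by
    intro j hj
    refine ⟨?_, (hA.hit_le_iff ⟨s, hj⟩).2 hj⟩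
    rw [show p.T j ω = hit (jumpCount fun t => p.X t ω) j from rfl, ← hA.hit_stopped hj]
    show hit (jumpCount fun t => p.X (min t s) ω) j = _
    congr 1
    ext t
    exact jumpCount_stopped (fun t => p.X t ω) s t
  have hY : ∀ j ≤ p.J s ω, (p.stopped s).Y j ω = p.Y j ω := by
    intro j hj
    show p.X (min ((p.stopped s).T j ω) s) ω = p.X (p.T j ω) ω
    rw [(hT j hj).1, min_eq_left (hT j hj).2]
  rcases l with j | i | k
  · have hj := (inl_mem_rewardIdx.1 hl).trans_le ha
    simp only [rewardLaw, (hT (j + 1) hj).1, hY j hj.le, hY (j + 1) hj]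
  · show (m.H (m.τ (i + 1)) (p.X (min (m.τ (i + 1)) s) ω) : Measure ℝ) = _
    rw [min_eq_left (hb i (inr_inl_mem_rewardIdx.1 hl))]
    rfl
  · have hk : k + 1 ≤ p.N s ω := (inr_inr_mem_rewardIdx.1 hl).trans_le hc
    have h1 : (p.stopped s).eventTime (k + 1) ω = p.eventTime (k + 1) ω := hpN.hit_stopped hk
    have h2 : p.eventTime (k + 1) ω ≤ s := (hpN.hit_le_iff ⟨s, hk⟩).2 hk
    simp only [rewardLaw, h1]
    show (m.K _ (p.X (min (p.eventTime (k + 1) ω) s) ω) : Measure ℝ) = _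
    rw [min_eq_left h2]

variable [Fintype S] [DecidableEq S] [MeasurableSpace S] [MeasurableSingletonClass S]

/-- The σ-algebra on `Ω` is a free parameter: the result is applied to the stopped process with
`sigmaXNUpTo s` as well as to the process itself with `sigmaXN` and with the ambient σ-algebra. -/
theorem measurable_rewardLaw {p : RewardProcess Ω S} {m : RewardModel S} (h1 : m.A1) {_ : MeasurableSpace Ω}
    (hX : ∀ t, Measurable (p.X t)) (hN : ∀ t, Measurable (p.N t)) (hpX : ∀ ω, IsJumpPath fun t => p.X t ω)
    (hpN : ∀ ω, IsCountingPath fun t => p.N t ω) (l : ℕ ⊕ ℕ ⊕ ℕ) : Measurable (p.rewardLaw m l) := by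
  have hXu := measurable_uncurry_of_right_cont hX fun ω t => (hpX ω).right_cont t
  have hT : ∀ j, Measurable (p.T j) := fun j =>
    measurable_hit (fun t => measurable_jumpCount hX hpX t) (fun ω => (hpX ω).isCountingPath_jumpCount) j
  have hY : ∀ j, Measurable (p.Y j) := fun j => hXu.comp ((hT j).prodMk measurable_id)
  rcases l with j | i | k
  · have hG : Measurable fun q : ℝ≥0 × S × S => (m.G q.1 q.2.1 q.2.2 : Measure ℝ) :=
      measurable_from_prod_countable_left fun q => h1.measurable_G q.1 q.2
    exact hG.comp ((hT (j + 1)).prodMk ((hY j).prodMk (hY (j + 1))))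
  · exact (measurable_of_finite fun x => (m.H (m.τ (i + 1)) x : Measure ℝ)).comp (hX _)
  · have hK : Measurable fun q : ℝ≥0 × S => (m.K q.1 q.2 : Measure ℝ) :=
      measurable_from_prod_countable_left fun x => h1.measurable_K x
    have he : Measurable (p.eventTime (k + 1)) := measurable_hit hN hpN (k + 1)
    exact hK.comp (he.prodMk (hXu.comp (he.prodMk measurable_id)))

variable [MeasurableSpace Ω] {p : RewardProcess Ω S} {m : RewardModel S} {Pr : Measure Ω} [IsProbabilityMeasure Pr]
  {β : ℝ≥0 → S → ℝ} {P : ℝ≥0 → ℝ≥0 → Matrix S S ℝ}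

theorem HasLumpLaws.measurable_reward (hL : p.HasLumpLaws m Pr) (l : ℕ ⊕ ℕ ⊕ ℕ) : Measurable (p.reward l) := by
  rcases l with j | i | k
  exacts [hL.measurable_jump _, hL.measurable_sched _, hL.measurable_ext _]

theorem IsMarkovJump.measurableSet_atLeast (hX : p.IsMarkovJump P Pr) (hN : p.IsCoxCounting β Pr) (a c : ℕ) :
    MeasurableSet[p.sigmaXN] (p.atLeast a c) := by
  have : p.atLeast a c = (⋃ n : ℕ, {ω | a ≤ p.J n ω}) ∩ ⋃ n : ℕ, {ω | c ≤ p.N n ω} := by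
    ext ω
    simp only [atLeast, Set.mem_inter_iff, Set.mem_iUnion, Set.mem_ofPred_eq]
    refine and_congr ⟨?_, fun ⟨n, hn⟩ => ⟨n, hn⟩⟩ ⟨?_, fun ⟨n, hn⟩ => ⟨n, hn⟩⟩
    · rintro ⟨t, ht⟩
      obtain ⟨n, hn⟩ := exists_nat_ge t
      exact ⟨n, ht.trans ((hX.isJumpPath ω).isCountingPath_jumpCount.mono hn)⟩
    · rintro ⟨t, ht⟩
      obtain ⟨n, hn⟩ := exists_nat_ge t
      exact ⟨n, ht.trans (hN.mono ω hn)⟩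
  rw [this]
  refine MeasurableSet.inter (MeasurableSet.iUnion fun n => ?_) (MeasurableSet.iUnion fun n => ?_)
  · exact _root_.measurable_jumpCount (X := p.X) (fun t => measurable_X_sigmaXN t) hX.isJumpPath n measurableSet_Ici
  · exact measurable_N_sigmaXN _ measurableSet_Ici

/-- The set `atLeast a c` enters because nothing is known about rewards whose jump or external event
does not occur. -/
theorem HasLumpLaws.hasCondLaw (hL : p.HasLumpLaws m Pr) (hX : p.IsMarkovJump P Pr) (hN : p.IsCoxCounting β Pr)
    (a b c : ℕ) :
    HasCondLaw p.sigmaXN Pr p.reward (p.rewardLaw m) (p.atLeast a c) (rewardIdx a b c) := by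
  intro u E hE hED
  have hm := measurableSet_forall_le hL.measurable_reward (rewardIdx a b c) u
  have hset : {ω | ∀ l ∈ rewardIdx a b c, p.reward l ω ≤ u l}
      = {ω | (∀ j < a, p.jumpReward (j + 1) ω ≤ u (Sum.inl j)) ∧
          (∀ i < b, p.schedReward (i + 1) ω ≤ u (Sum.inr (Sum.inl i))) ∧
          (∀ k < c, p.extReward (k + 1) ω ≤ u (Sum.inr (Sum.inr k)))} := by
    ext ω
    simp only [Set.mem_ofPred_eq, Sum.forall, inl_mem_rewardIdx, inr_inl_mem_rewardIdx, inr_inr_mem_rewardIdx, reward]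
  have h := setLIntegral_eq_of_condExp (hX.sigmaXN_le hN) (μ := Pr) (D := p.atLeast a c) hm
    (ψ := E.indicator 1) (φ := fun ω => (∏ j ∈ Finset.range a, ProbabilityTheory.cdf
            (m.G (p.T (j + 1) ω) (p.Y j ω) (p.Y (j + 1) ω) : Measure ℝ) (u (Sum.inl j))) *
        (∏ i ∈ Finset.range b, ProbabilityTheory.cdf
            (m.H (m.τ (i + 1)) (p.X (m.τ (i + 1)) ω) : Measure ℝ) (u (Sum.inr (Sum.inl i)))) *
        (∏ k ∈ Finset.range c, ProbabilityTheory.cdf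
            (m.K (p.eventTime (k + 1) ω) (p.X (p.eventTime (k + 1) ω) ω) : Measure ℝ) (u (Sum.inr (Sum.inr k)))))
    (by
      rw [hset]
      filter_upwards [hL.law a b c (fun j => u (Sum.inl j)) (fun i => u (Sum.inr (Sum.inl i)))
        fun k => u (Sum.inr (Sum.inr k))] with ω hω hωD
      exact hω hωD.1 hωD.2)
    (@measurable_indicator_one Ω p.sigmaXN E hE) (fun ω hω => Set.indicator_of_notMem (fun h => hω (hED h)) _)
  have hEm := hX.sigmaXN_le hN E hE
  rw [lintegral_indicator_one hEm, Measure.restrict_apply hEm] at h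
  rw [h, lintegral_indicator_one_mul hEm]
  refine lintegral_congr fun ω => ?_
  have h0 : ∀ (κ : Measure ℝ) x, 0 ≤ ProbabilityTheory.cdf κ x := fun κ x => ProbabilityTheory.cdf_nonneg κ x
  rw [ENNReal.ofReal_mul (mul_nonneg (Finset.prod_nonneg fun _ _ => h0 _ _) (Finset.prod_nonneg fun _ _ => h0 _ _)),
    ENNReal.ofReal_mul (Finset.prod_nonneg fun _ _ => h0 _ _), ENNReal.ofReal_prod_of_nonneg fun _ _ => h0 _ _,
    ENNReal.ofReal_prod_of_nonneg fun _ _ => h0 _ _, ENNReal.ofReal_prod_of_nonneg fun _ _ => h0 _ _]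
  simp only [ProbabilityTheory.ofReal_cdf, rewardIdx, Finset.prod_disjSum, rewardLaw, mul_assoc]

theorem rewardLaw_Iio_zero (h4 : m.A4) (l : ℕ ⊕ ℕ ⊕ ℕ) (ω : Ω) : p.rewardLaw m l ω (Set.Iio 0) = 0 := by
  obtain ⟨c, hG, hH, hK⟩ := h4.lump
  rcases l with j | i | k
  exacts [(hG _ _ _).1, (hH _ _).1, (hK _ _).1]

end RewardProcess

end Lumps

/-! ### Cells and compensators on cells -/

section Cells

open scoped ENNReal

/-- The set in `numScheduled` contains `0` as `t_0 = 0`, and is bounded as `t_i → ∞`; so its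
supremum is attained. -/
theorem RewardModel.tau_le_iff {S : Type*} (m : RewardModel S) {i : ℕ} {s : ℝ≥0} :
    m.τ i ≤ s ↔ i ≤ m.numScheduled s := by
  have hb : BddAbove {i | m.τ i ≤ s} := by
    obtain ⟨n, hn⟩ := (m.τ_tendsto.eventually_gt_atTop s).exists
    exact ⟨n, fun i hi => le_of_not_gt fun h => absurd (hn.trans (m.τ_strictMono h)) (not_lt.2 hi)⟩
  refine ⟨fun h => le_csSup hb h, fun h => ?_⟩
  have hmem : m.numScheduled s ∈ {i | m.τ i ≤ s} :=
    Nat.sSup_mem ⟨0, by simp [m.τ_zero]⟩ hb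
  exact (m.τ_strictMono.monotone h).trans hmem

theorem measurable_setLIntegral_path {S Ω : Type*} [Countable S] [MeasurableSpace S]
    [MeasurableSingletonClass S] {_ : MeasurableSpace Ω} {X : ℝ≥0 → Ω → S}
    (hX : ∀ t, Measurable (X t)) (hr : ∀ ω t, ∀ᶠ s in 𝓝[>] t, X s ω = X t ω)
    {f : ℝ≥0 → S → ℝ≥0∞} (hf : ∀ x, Measurable fun u => f u x) (c d : ℝ≥0) :
    Measurable fun ω => ∫⁻ u in Set.Ioc c d, f u (X u ω) ∂leb := by
  have hf' : Measurable fun q : ℝ≥0 × S => f q.1 q.2 := measurable_from_prod_countable_left hf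
  have h1 : Measurable fun q : ℝ≥0 × Ω => f q.1 (X q.1 q.2) :=
    hf'.comp (measurable_fst.prodMk (measurable_uncurry_of_right_cont hX hr))
  exact (h1.comp measurable_swap).lintegral_prod_right'

namespace RewardProcess

variable {S Ω : Type*}

/-- The part of `E` on which there are `a` jumps and `c` external events until time `s`. -/
def countSet (p : RewardProcess Ω S) (s : ℝ≥0) (a c : ℕ) (E : Set Ω) : Set Ω :=
  E ∩ {ω | p.J s ω = a ∧ p.N s ω = c}

/-- The part of `p.countSet s a c E` on which the lump-sum rewards collected until time `s` are bounded by `u`. -/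
def cell (p : RewardProcess Ω S) (m : RewardModel S) (s : ℝ≥0) (a c : ℕ) (E : Set Ω) (u : ℕ ⊕ ℕ ⊕ ℕ → ℝ) : Set Ω :=
  p.countSet s a c E ∩ {ω | ∀ l ∈ rewardIdx a (m.numScheduled s) c, p.reward l ω ≤ u l}

/-- The conditional probability of a cell given `X` and `N`. -/
noncomputable def cellWeight (p : RewardProcess Ω S) (m : RewardModel S) (s : ℝ≥0) (a c : ℕ) (E : Set Ω)
    (u : ℕ ⊕ ℕ ⊕ ℕ → ℝ) (ω : Ω) : ℝ≥0∞ :=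
  (p.countSet s a c E).indicator 1 ω *
    ∏ l ∈ rewardIdx a (m.numScheduled s) c, p.rewardLaw m l ω (Set.Iic (u l))

theorem countSet_subset_atLeast {p : RewardProcess Ω S} (s : ℝ≥0) (a c : ℕ) (E : Set Ω) :
    p.countSet s a c E ⊆ p.atLeast a c :=
  fun _ h => ⟨⟨s, h.2.1.ge⟩, ⟨s, h.2.2.ge⟩⟩

variable [Fintype S] [DecidableEq S] [MeasurableSpace S] [MeasurableSingletonClass S]
variable [MeasurableSpace Ω] {p : RewardProcess Ω S} {m : RewardModel S} {Pr : Measure Ω} [IsProbabilityMeasure Pr]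
  {P : ℝ≥0 → ℝ≥0 → Matrix S S ℝ} {s t : ℝ≥0} {E : Set Ω}

theorem measurable_N_sigmaXNUpTo {v : ℝ≥0} (h : v ≤ s) : Measurable[p.sigmaXNUpTo s] (p.N v) :=
  (measurable_N_sigmaN h).mono le_sup_right le_rfl

theorem measurable_X_sigmaXNUpTo {v : ℝ≥0} (h : v ≤ s) : Measurable[p.sigmaXNUpTo s] (p.X v) :=
  (measurable_X_sigmaXUpTo h).mono le_sup_left le_rfl

theorem IsMarkovJump.measurable_J_sigmaXNUpTo (hX : p.IsMarkovJump P Pr) {v : ℝ≥0} (h : v ≤ s) :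
    Measurable[p.sigmaXNUpTo s] (p.J v) := by
  have h1 := @_root_.measurable_jumpCount S Ω _ _ _ (p.sigmaXNUpTo s) (fun t => p.X (min t s))
    (fun t => measurable_X_sigmaXNUpTo (min_le_right t s)) (fun ω => (hX.isJumpPath ω).stopped s) v
  have h2 : p.J v = fun ω => jumpCount (fun t => p.X (min t s) ω) v := by
    ext ω
    rw [jumpCount_stopped (fun t => p.X t ω) s v, min_eq_left h]
    rfl
  rw [h2]
  exact h1

theorem IsMarkovJump.measurable_J_sigmaXN (hX : p.IsMarkovJump P Pr) (v : ℝ≥0) : Measurable[p.sigmaXN] (p.J v) :=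
  (hX.measurable_J_sigmaXNUpTo le_rfl).mono (sigmaXNUpTo_le_sigmaXN v) le_rfl

theorem IsMarkovJump.measurableSet_countSet (hX : p.IsMarkovJump P Pr) (a c : ℕ)
    (hE : MeasurableSet[p.sigmaXNUpTo s] E) : MeasurableSet[p.sigmaXNUpTo s] (p.countSet s a c E) :=
  hE.inter ((hX.measurable_J_sigmaXNUpTo le_rfl (measurableSet_singleton a)).inter
    (measurable_N_sigmaXNUpTo le_rfl (measurableSet_singleton c)))

/-- Where the counts are `a` and `c`, the laws in the weight are those of the process stopped at
`s`; elsewhere the indicator vanishes. -/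
theorem IsMarkovJump.measurable_cellWeight (hX : p.IsMarkovJump P Pr) (hN : p.IsCoxCounting m.β Pr) (h1 : m.A1)
    (a c : ℕ) (hE : MeasurableSet[p.sigmaXNUpTo s] E) (u : ℕ ⊕ ℕ ⊕ ℕ → ℝ) :
    Measurable[p.sigmaXNUpTo s] (p.cellWeight m s a c E u) := by
  have h2 : p.cellWeight m s a c E u = fun ω => (p.countSet s a c E).indicator 1 ω *
      ∏ l ∈ rewardIdx a (m.numScheduled s) c, (p.stopped s).rewardLaw m l ω (Set.Iic (u l)) := by
    ext ω
    by_cases h : ω ∈ p.countSet s a c E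
    · rw [cellWeight]
      congr 1
      refine Finset.prod_congr rfl fun l hl => ?_
      rw [rewardLaw_stopped (hX.isJumpPath ω) (hN.isCountingPath ω) h.2.1.ge (fun i hi => m.tau_le_iff.2 hi) h.2.2.ge hl]
    · rw [cellWeight, Set.indicator_of_notMem h, zero_mul, zero_mul]
  rw [h2]
  refine (measurable_indicator_one (hX.measurableSet_countSet a c hE)).mul
    (measurable_prod_measure_Iic (fun l => ?_) _ u)
  have hX' : ∀ t, Measurable[p.sigmaXNUpTo s] ((p.stopped s).X t) :=
    fun t => measurable_X_sigmaXNUpTo (p := p) (min_le_right t s)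
  have hN' : ∀ t, Measurable[p.sigmaXNUpTo s] ((p.stopped s).N t) :=
    fun t => measurable_N_sigmaXNUpTo (p := p) (min_le_right t s)
  exact RewardProcess.measurable_rewardLaw h1 hX' hN' (fun ω => (hX.isJumpPath ω).stopped s)
    (fun ω => (hN.isCountingPath ω).stopped s) l

theorem IsMarkovJump.measurable_rewardLaw (hX : p.IsMarkovJump P Pr) (hN : p.IsCoxCounting m.β Pr) (h1 : m.A1)
    (l : ℕ ⊕ ℕ ⊕ ℕ) : Measurable (p.rewardLaw m l) :=
  RewardProcess.measurable_rewardLaw h1 hX.measurable hN.measurable hX.isJumpPath hN.isCountingPath l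

theorem IsMarkovJump.measurable_rewardLaw_sigmaXN (hX : p.IsMarkovJump P Pr) (hN : p.IsCoxCounting m.β Pr) (h1 : m.A1)
    (l : ℕ ⊕ ℕ ⊕ ℕ) : Measurable[p.sigmaXN] (p.rewardLaw m l) :=
  RewardProcess.measurable_rewardLaw h1 measurable_X_sigmaXN measurable_N_sigmaXN hX.isJumpPath hN.isCountingPath l

theorem HasLumpLaws.measurableSet_cell (hL : p.HasLumpLaws m Pr) (hX : p.IsMarkovJump P Pr)
    (hN : p.IsCoxCounting m.β Pr) (a c : ℕ) (hE : MeasurableSet[p.sigmaXNUpTo s] E) (u : ℕ ⊕ ℕ ⊕ ℕ → ℝ) :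
    MeasurableSet (p.cell m s a c E u) :=
  (hX.sigmaXN_le hN _ (sigmaXNUpTo_le_sigmaXN s _ (hX.measurableSet_countSet a c hE))).inter
    (measurableSet_forall_le hL.measurable_reward _ u)

theorem HasLumpLaws.setLIntegral_cell (hL : p.HasLumpLaws m Pr) (hX : p.IsMarkovJump P Pr)
    (hN : p.IsCoxCounting m.β Pr) (h1 : m.A1) (a c : ℕ) (hE : MeasurableSet[p.sigmaXNUpTo s] E)
    (u : ℕ ⊕ ℕ ⊕ ℕ → ℝ) {F : Ω → ℝ≥0∞} (hF : Measurable[p.sigmaXN] F) :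
    ∫⁻ ω in p.cell m s a c E u, F ω ∂Pr = ∫⁻ ω, p.cellWeight m s a c E u ω * F ω ∂Pr := by
  rw [cell, (hL.hasCondLaw hX hN a (m.numScheduled s) c).setLIntegral_inter_forall_le (hX.sigmaXN_le hN)
    hL.measurable_reward (hX.measurable_rewardLaw hN h1) u
    (sigmaXNUpTo_le_sigmaXN s _ (hX.measurableSet_countSet a c hE)) (countSet_subset_atLeast s a c E) hF]
  exact lintegral_congr fun ω => mul_comm _ _

/-- Compensators of functionals of `X` and `N` given `X` and `N` on `[0, s]` are compensators on cells. -/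
theorem HasLumpLaws.setLIntegral_cell_congr (hL : p.HasLumpLaws m Pr) (hX : p.IsMarkovJump P Pr)
    (hN : p.IsCoxCounting m.β Pr) (h1 : m.A1) (a c : ℕ) (hE : MeasurableSet[p.sigmaXNUpTo s] E)
    (u : ℕ ⊕ ℕ ⊕ ℕ → ℝ) {F G : Ω → ℝ≥0∞} (hF : Measurable[p.sigmaXN] F) (hG : Measurable[p.sigmaXN] G)
    (h : ∀ E, MeasurableSet[p.sigmaXNUpTo s] E → ∫⁻ ω in E, F ω ∂Pr = ∫⁻ ω in E, G ω ∂Pr) :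
    ∫⁻ ω in p.cell m s a c E u, F ω ∂Pr = ∫⁻ ω in p.cell m s a c E u, G ω ∂Pr := by
  have hle := hX.sigmaXN_le hN
  rw [hL.setLIntegral_cell hX hN h1 a c hE u hF, hL.setLIntegral_cell hX hN h1 a c hE u hG]
  exact lintegral_mul_eq_of_forall_setLIntegral_eq ((sigmaXNUpTo_le_sigmaXN s).trans hle)
    (hF.mono hle le_rfl).aemeasurable (hG.mono hle le_rfl).aemeasurable h (hX.measurable_cellWeight hN h1 a c hE u)

/-- The Markov property on cells. -/
theorem HasLumpLaws.setLIntegral_cell_markov (hL : p.HasLumpLaws m Pr) (hX : p.IsMarkovJump P Pr)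
    (hN : p.IsCoxCounting m.β Pr) (h1 : m.A1) (a c : ℕ) (hE : MeasurableSet[p.sigmaXNUpTo s] E)
    (u : ℕ ⊕ ℕ ⊕ ℕ → ℝ) (hst : s ≤ t) (y : S) :
    ∫⁻ ω in p.cell m s a c E u, (p.X t ⁻¹' {y}).indicator 1 ω ∂Pr
      = ∫⁻ ω in p.cell m s a c E u, ENNReal.ofReal (P s t (p.X s ω) y) ∂Pr := by
  have hy := measurable_X_sigmaXN (p := p) t (measurableSet_singleton y)
  refine hL.setLIntegral_cell_congr hX hN h1 a c hE u (measurable_indicator_one hy)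
    ((measurable_of_finite fun x => ENNReal.ofReal (P s t x y)).comp (measurable_X_sigmaXN s)) fun E' hE' => ?_
  rw [← hX.measure_inter_eq hN h1.β hst y hE', lintegral_indicator_one (hX.measurable t (measurableSet_singleton y)),
    Measure.restrict_apply (hX.measurable t (measurableSet_singleton y)), Set.inter_comm]

/-- Mean on a cell of a lump-sum reward that is collected after time `s`. -/
theorem HasLumpLaws.setLIntegral_cell_reward (hL : p.HasLumpLaws m Pr) (hX : p.IsMarkovJump P Pr)
    (hN : p.IsCoxCounting m.β Pr) (h1 : m.A1) (h4 : m.A4) (a c : ℕ) (hE : MeasurableSet[p.sigmaXNUpTo s] E)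
    (u : ℕ ⊕ ℕ ⊕ ℕ → ℝ) {D : Set Ω} (hD : MeasurableSet[p.sigmaXN] D) {l : ℕ ⊕ ℕ ⊕ ℕ}
    (hl : l ∉ rewardIdx a (m.numScheduled s) c) {a' b' c' : ℕ}
    (hI : insert l (rewardIdx a (m.numScheduled s) c) ⊆ rewardIdx a' b' c')
    (hD' : p.countSet s a c E ∩ D ⊆ p.atLeast a' c') :
    ∫⁻ ω in p.cell m s a c E u ∩ D, ENNReal.ofReal (p.reward l ω) ∂Pr
      = ∫⁻ ω in D, p.cellWeight m s a c E u ω * ∫⁻ z, ENNReal.ofReal z ∂(p.rewardLaw m l ω) ∂Pr := by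
  have hle := hX.sigmaXN_le hN
  obtain ⟨C, -, hG, hH, hK⟩ := RewardModel.exists_lump_bound h4
  have hC : ∀ l ω, p.rewardLaw m l ω (Set.Iic C) = 1 := by
    rintro (j | i | k) ω
    exacts [hG _ _ _, hH _ _, hK _ _]
  have hcs := sigmaXNUpTo_le_sigmaXN s _ (hX.measurableSet_countSet a c hE)
  -- The joint law of the collected rewards and the reward `l` is extracted from a larger family
  -- `a'`, `b'`, `c'` whose jumps and events all occur on `countSet ∩ D`.
  have hlaw := (((hL.hasCondLaw hX hN a' b' c').subset_right hle hL.measurable_reward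
    (hX.measurableSet_atLeast hN a' c') hC hI).subset_left hD').setLIntegral_ofReal hl hle hL.measurable_reward
    (hX.measurable_rewardLaw hN h1) u (hcs.inter hD) subset_rfl
  rw [cell, Set.inter_right_comm, hlaw, ← Measure.restrict_restrict (hle _ hcs),
    ← lintegral_indicator_one_mul (hle _ hcs)]
  exact lintegral_congr fun ω => (mul_assoc _ _ _).symm

/-- The compensator on cells of the lump-sum rewards `e (j - 1)` collected at the points of a counting process. -/
theorem HasLumpLaws.setLIntegral_cell_sum (hL : p.HasLumpLaws m Pr) (hX : p.IsMarkovJump P Pr)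
    (hN : p.IsCoxCounting m.β Pr) (h1 : m.A1) (h4 : m.A4) (a c : ℕ) (hE : MeasurableSet[p.sigmaXNUpTo s] E)
    (u : ℕ ⊕ ℕ ⊕ ℕ → ℝ) {A : ℝ≥0 → Ω → ℕ} (hA : ∀ t, Measurable[p.sigmaXN] (A t)) (e : ℕ → ℕ ⊕ ℕ ⊕ ℕ)
    (he : ∀ j, ∀ ω ∈ p.countSet s a c E, A s ω < j → e (j - 1) ∉ rewardIdx a (m.numScheduled s) c)
    (he' : ∀ j, ∃ a' c', insert (e (j - 1)) (rewardIdx a (m.numScheduled s) c) ⊆ rewardIdx a' (m.numScheduled s) c' ∧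
      ∀ ω ∈ p.countSet s a c E, A s ω < j → j ≤ A t ω → ω ∈ p.atLeast a' c')
    {V : Ω → ℝ≥0∞} (hV : Measurable[p.sigmaXN] V)
    (h : ∀ E, MeasurableSet[p.sigmaXNUpTo s] E →
      ∫⁻ ω in E, ∑ j ∈ Finset.Ioc (A s ω) (A t ω), ∫⁻ z, ENNReal.ofReal z ∂(p.rewardLaw m (e (j - 1)) ω) ∂Pr
        = ∫⁻ ω in E, V ω ∂Pr) :
    ∫⁻ ω in p.cell m s a c E u, ∑ j ∈ Finset.Ioc (A s ω) (A t ω), ENNReal.ofReal (p.reward (e (j - 1)) ω) ∂Pr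
      = ∫⁻ ω in p.cell m s a c E u, V ω ∂Pr := by
  have hle := hX.sigmaXN_le hN
  have hA' := fun t => (hA t).mono hle le_rfl
  have hmean : ∀ j, Measurable[p.sigmaXN] fun ω => ∫⁻ z, ENNReal.ofReal z ∂(p.rewardLaw m (e (j - 1)) ω) := fun j =>
    (Measure.measurable_lintegral ENNReal.measurable_ofReal).comp (hX.measurable_rewardLaw_sigmaXN hN h1 (e (j - 1)))
  have hw : Measurable (p.cellWeight m s a c E u) :=
    (hX.measurable_cellWeight hN h1 a c hE u).mono ((sigmaXNUpTo_le_sigmaXN s).trans hle) le_rfl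
  have hwm : ∀ j, Measurable fun ω => p.cellWeight m s a c E u ω *
      ∫⁻ z, ENNReal.ofReal z ∂(p.rewardLaw m (e (j - 1)) ω) := fun j => hw.mul ((hmean j).mono hle le_rfl)
  have hDm : ∀ j : ℕ, MeasurableSet[p.sigmaXN] {ω | A s ω < j ∧ j ≤ A t ω} := fun j =>
    (hA s measurableSet_Iio).inter (hA t measurableSet_Ici)
  rw [← hL.setLIntegral_cell_congr hX hN h1 a c hE u (measurable_sum_Ioc (hA s) (hA t) hmean) hV h,
    hL.setLIntegral_cell hX hN h1 a c hE u (measurable_sum_Ioc (hA s) (hA t) hmean)]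
  simp only [Finset.mul_sum]
  rw [lintegral_sum_Ioc (hA' s) (hA' t) fun j => ((hL.measurable_reward (e (j - 1))).ennreal_ofReal).aemeasurable,
    lintegral_sum_Ioc (hA' s) (hA' t) fun j => (hwm j).aemeasurable]
  refine tsum_congr fun j => ?_
  rw [Measure.restrict_restrict (hle _ (hDm j)), Set.inter_comm]
  -- Rewards are numbered from `1`, their indices in `rewardIdx` from `0`. If the index is already
  -- among those constrained by the cell, the cell contains no point with `A s < j ≤ A t` and both
  -- sides are zero.
  by_cases hl : e (j - 1) ∈ rewardIdx a (m.numScheduled s) c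
  · have hempty : ∀ ω ∈ {ω | A s ω < j ∧ j ≤ A t ω}, ω ∉ p.countSet s a c E :=
      fun ω hω hE => he j ω hE hω.1 hl
    have h2 : p.cell m s a c E u ∩ {ω | A s ω < j ∧ j ≤ A t ω} = ∅ :=
      Set.eq_empty_of_forall_notMem fun ω hω => hempty ω hω.2 hω.1.1
    rw [h2, Measure.restrict_empty, lintegral_zero_measure]
    refine (setLIntegral_eq_zero (hle _ (hDm j)) fun ω hω => ?_).symm
    rw [cellWeight, Set.indicator_of_notMem (hempty ω hω), zero_mul, zero_mul]
    rfl
  · obtain ⟨a', c', hI, hD'⟩ := he' j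
    exact hL.setLIntegral_cell_reward hX hN h1 h4 a c hE u (hDm j) hl hI fun ω hω => hD' ω hω.1 hω.2.1 hω.2.2

end RewardProcess

end Cells

/-! ### Bounds and measurability of the rates of the model -/

section ModelBounds

open scoped ENNReal

/-- The law lives on `[0, C]`, so restriction to `Ici 0` loses nothing, and the real means that
define the rates agree with the extended integrals of the compensators. -/
theorem ofReal_setIntegral_Ici {κ : Measure ℝ} [IsProbabilityMeasure κ] {C : ℝ} (h0 : κ (Set.Iio 0) = 0)
    (hC : κ (Set.Iic C) = 1) :
    ENNReal.ofReal (∫ z in Set.Ici 0, z ∂κ) = ∫⁻ z, ENNReal.ofReal z ∂κ ∧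
      0 ≤ ∫ z in Set.Ici 0, z ∂κ ∧ ∫ z in Set.Ici 0, z ∂κ ≤ C := by
  have h1 : ∀ᵐ z ∂κ, 0 ≤ z := by
    filter_upwards [measure_eq_zero_iff_ae_notMem.1 h0] with z hz
    exact not_lt.1 hz
  have h2 : ∀ᵐ z ∂κ, z ≤ C := by
    rw [← prob_compl_eq_zero_iff measurableSet_Iic] at hC
    filter_upwards [measure_eq_zero_iff_ae_notMem.1 hC] with z hz
    exact not_not.1 hz
  have h3 : κ.restrict (Set.Ici 0) = κ := Measure.restrict_eq_self_of_ae_mem h1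
  have hi : Integrable (fun z : ℝ => z) κ := by
    refine Integrable.of_bound (C := C) measurable_id.aestronglyMeasurable ?_
    filter_upwards [h1, h2] with z hz hzC
    rwa [Real.norm_of_nonneg hz]
  rw [h3]
  refine ⟨ofReal_integral_eq_lintegral_ofReal hi h1, integral_nonneg_of_ae h1, ?_⟩
  have := integral_mono_ae hi (integrable_const C) h2
  simpa using this

namespace RewardModel

variable {S : Type*} [Fintype S] [DecidableEq S] {m : RewardModel S}

theorem A2.diag_eq (h2 : m.A2) (u : ℝ≥0) (x : S) : m.Q u x x = -∑ y ∈ Finset.univ.erase x, m.Q u x y := by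
  have := (h2.rate u).2 x
  rw [← Finset.add_sum_erase _ _ (Finset.mem_univ x)] at this
  linarith

theorem A2.offDiag_nonneg (h2 : m.A2) (u : ℝ≥0) (x y : S) (hxy : x ≠ y) : 0 ≤ m.Q u x y := (h2.rate u).1 x y hxy

theorem A2.mem_B (h2 : m.A2) (u : ℝ≥0) {x y : S} : (x, y) ∈ m.B ↔ 0 < m.Q u x y := by
  rw [← h2.indep u]
  rfl

theorem A2.ne_of_mem_B (h2 : m.A2) {x y : S} (h : (x, y) ∈ m.B) : x ≠ y := by
  rintro rfl
  have h3 : m.Q 1 x x ≤ 0 := by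
    rw [h2.diag_eq]
    exact neg_nonpos.2 (Finset.sum_nonneg fun y hy => h2.offDiag_nonneg 1 x y (Finset.ne_of_mem_erase hy).symm)
  exact absurd ((h2.mem_B 1).1 h) (not_lt.2 h3)

theorem A2.eq_zero (h2 : m.A2) (u : ℝ≥0) {x y : S} (hxy : x ≠ y) (h : (x, y) ∉ m.B) : m.Q u x y = 0 :=
  le_antisymm (not_lt.1 fun h' => h ((h2.mem_B u).2 h')) (h2.offDiag_nonneg u x y hxy)

/-- Off the diagonal an entry is bounded on `B` and zero elsewhere, and a diagonal entry is minus
the rest of its row. The sum of all the bounds serves every entry. -/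
theorem exists_Q_bound (h2 : m.A2) (h3 : m.A3) : ∃ Λ : ℝ, ∀ u x y, |m.Q u x y| ≤ Λ := by
  have hb : ∀ x y, ∃ b : ℝ, 0 ≤ b ∧ ∀ u, x ≠ y → |m.Q u x y| ≤ b := by
    intro x y
    by_cases h : (x, y) ∈ m.B
    · obtain ⟨b, hb⟩ := (h3 x y h).2
      have hle : ∀ u, |m.Q u x y| ≤ b := fun u => by
        rw [abs_of_pos ((h2.mem_B u).1 h)]
        exact hb ⟨u, rfl⟩
      exact ⟨b, (abs_nonneg _).trans (hle 0), fun u _ => hle u⟩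
    · exact ⟨0, le_rfl, fun u hxy => by rw [h2.eq_zero u hxy h, abs_zero]⟩
  choose b hb0 hb using hb
  have hrow : ∀ x, ∑ y, b x y ≤ ∑ x, ∑ y, b x y := fun x =>
    Finset.single_le_sum (f := fun x => ∑ y, b x y) (fun x _ => Finset.sum_nonneg fun y _ => hb0 x y) (Finset.mem_univ x)
  refine ⟨∑ x, ∑ y, b x y, fun u x y => le_trans ?_ (hrow x)⟩
  by_cases hxy : x = y
  · subst hxy
    rw [h2.diag_eq, abs_neg]
    refine (Finset.abs_sum_le_sum_abs _ _).trans ?_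
    refine (Finset.sum_le_sum fun y hy => hb x y u (Finset.ne_of_mem_erase hy).symm).trans ?_
    exact Finset.sum_le_sum_of_subset_of_nonneg (Finset.erase_subset _ _) fun y _ _ => hb0 x y
  · exact (hb x y u hxy).trans (Finset.single_le_sum (f := b x) (fun y _ => hb0 x y) (Finset.mem_univ y))

theorem exists_Q_lower (h2 : m.A2) (h3 : m.A3) :
    ∃ ε : ℝ, 0 < ε ∧ ∀ x y, 0 < m.Q 1 x y → ∀ u, ε ≤ m.Q u x y := by
  have h : ∀ q : S × S, ∃ ε : ℝ, 0 < ε ∧ (q ∈ m.B → ∀ u, ε ≤ m.Q u q.1 q.2) := by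
    intro q
    by_cases hq : q ∈ m.B
    · exact ⟨_, (h3 q.1 q.2 hq).1, fun _ u =>
        ciInf_le ⟨0, by rintro _ ⟨v, rfl⟩; exact ((h2.mem_B v).1 hq).le⟩ u⟩
    · exact ⟨1, one_pos, fun h => absurd h hq⟩
  choose ε hε h using h
  rcases isEmpty_or_nonempty S with hS | hS
  · exact ⟨1, one_pos, fun x => hS.elim x⟩
  · obtain ⟨q, hq⟩ := Finite.exists_min ε
    exact ⟨ε q, hε q, fun x y hxy u => (hq (x, y)).trans (h (x, y) hxy u)⟩

theorem measurable_setIntegral_Ici {T : Type*} [MeasurableSpace T] {κ : T → Measure ℝ} [∀ t, IsProbabilityMeasure (κ t)]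
    (hκ : Measurable κ) : Measurable fun t => ∫ z in Set.Ici (0 : ℝ), z ∂(κ t) := by
  let k : ProbabilityTheory.Kernel T ℝ := ⟨κ, hκ⟩
  have : ProbabilityTheory.IsMarkovKernel k := ⟨fun t => inferInstanceAs (IsProbabilityMeasure (κ t))⟩
  have h : StronglyMeasurable fun q : T × ℝ => (Set.Ici (0 : ℝ)).indicator (fun z => z) q.2 :=
    ((measurable_id.indicator measurableSet_Ici).comp measurable_snd).stronglyMeasurable
  have h' := (h.integral_kernel_prod_right' (κ := k)).measurable
  simp only [integral_indicator (measurableSet_Ici (a := (0 : ℝ)))] at h'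
  exact h'

theorem A1.measurable_gamma1 (h1 : m.A1) (x : S) : Measurable fun u => m.gamma1 u x :=
  Finset.measurable_fun_sum _ fun y _ => (h1.Q x y).mul (measurable_setIntegral_Ici (h1.measurable_G x y))

theorem A1.measurable_gamma2 (h1 : m.A1) (x : S) : Measurable fun u => m.gamma2 u x :=
  (h1.β x).mul (measurable_setIntegral_Ici (h1.measurable_K x))

theorem A1.measurable_rTilde (h1 : m.A1) (x : S) : Measurable fun u => m.rTilde u x :=
  (h1.r x).add ((h1.measurable_gamma1 x).add (h1.measurable_gamma2 x))

/-- `B` avoids the diagonal, and off the diagonal `Q` vanishes outside `B`; so the sum over `B` is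
the sum over `y ≠ x` produced by the Lévy system. -/
theorem ofReal_gamma1 (h2 : m.A2) (h4 : m.A4) (u : ℝ≥0) (x : S) :
    ENNReal.ofReal (m.gamma1 u x)
      = ∑ y ∈ Finset.univ.erase x, ENNReal.ofReal (m.Q u x y) * ∫⁻ z, ENNReal.ofReal z ∂(m.G u x y : Measure ℝ) := by
  classical
  obtain ⟨C, -, hG, -⟩ := exists_lump_bound h4
  obtain ⟨c, hG0, -⟩ := h4.lump
  have hm := fun y => ofReal_setIntegral_Ici (hG0 u x y).1 (hG u x y)
  have hQ0 : ∀ y ∈ Finset.univ.erase x, 0 ≤ m.Q u x y := fun y hy =>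
    h2.offDiag_nonneg u x y (Finset.ne_of_mem_erase hy).symm
  have h : m.gamma1 u x = ∑ y ∈ Finset.univ.erase x, m.Q u x y * ∫ z in Set.Ici (0 : ℝ), z ∂(m.G u x y : Measure ℝ) := by
    unfold gamma1
    refine Finset.sum_subset (fun y hy => ?_) fun y hy hyB => ?_
    · exact Finset.mem_erase.2 ⟨(h2.ne_of_mem_B (Finset.mem_filter.1 hy).2).symm, Finset.mem_univ _⟩
    · rw [h2.eq_zero u (Finset.ne_of_mem_erase hy).symm
        (fun hB => hyB (Finset.mem_filter.2 ⟨Finset.mem_univ _, hB⟩)), zero_mul]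
  rw [h, ENNReal.ofReal_sum_of_nonneg fun y hy => mul_nonneg (hQ0 y hy) (hm y).2.1]
  refine Finset.sum_congr rfl fun y hy => ?_
  rw [ENNReal.ofReal_mul (hQ0 y hy), (hm y).1]

theorem ofReal_gamma2 (h4 : m.A4) (u : ℝ≥0) (x : S) :
    ENNReal.ofReal (m.gamma2 u x) = ENNReal.ofReal (m.β u x) * ∫⁻ z, ENNReal.ofReal z ∂(m.K u x : Measure ℝ) := by
  obtain ⟨C, -, -, -, hK⟩ := exists_lump_bound h4
  obtain ⟨c, -, -, hK0⟩ := h4.lump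
  unfold gamma2
  rw [ENNReal.ofReal_mul (h4.β_nonneg u x), (ofReal_setIntegral_Ici (hK0 u x).1 (hK u x)).1]

theorem ofReal_h (h4 : m.A4) (u : ℝ≥0) (x : S) :
    ENNReal.ofReal (m.h u x) = ∫⁻ z, ENNReal.ofReal z ∂(m.H u x : Measure ℝ) := by
  obtain ⟨C, -, -, hH, -⟩ := exists_lump_bound h4
  obtain ⟨c, -, hH0, -⟩ := h4.lump
  exact (ofReal_setIntegral_Ici (hH0 u x).1 (hH u x)).1

theorem A2.gamma1_nonneg (h2 : m.A2) (u : ℝ≥0) (x : S) : 0 ≤ m.gamma1 u x := by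
  classical
  exact Finset.sum_nonneg fun y hy => mul_nonneg ((h2.mem_B u).1 (Finset.mem_filter.1 hy).2).le
    (setIntegral_nonneg measurableSet_Ici fun _ hz => hz)

theorem A4.gamma2_nonneg (h4 : m.A4) (u : ℝ≥0) (x : S) : 0 ≤ m.gamma2 u x :=
  mul_nonneg (h4.β_nonneg u x) (setIntegral_nonneg measurableSet_Ici fun _ hz => hz)

theorem h_nonneg (m : RewardModel S) (u : ℝ≥0) (x : S) : 0 ≤ m.h u x :=
  setIntegral_nonneg measurableSet_Ici fun _ hz => hz

theorem exists_uniform_bound {f : ℝ≥0 → S → ℝ} (hf : ∀ x, BddAbove (Set.range fun t => f t x)) :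
    ∃ C : ℝ, 0 ≤ C ∧ ∀ t x, f t x ≤ C := by
  choose b hb using hf
  refine ⟨∑ x, |b x|, Finset.sum_nonneg fun _ _ => abs_nonneg _, fun t x => (hb x ⟨t, rfl⟩).trans ?_⟩
  exact (le_abs_self _).trans
    (Finset.single_le_sum (f := fun x => |b x|) (fun _ _ => abs_nonneg _) (Finset.mem_univ x))

/-- The rates of reward accrual and the mean scheduled rewards are bounded. -/
theorem exists_rate_bound (h2 : m.A2) (h3 : m.A3) (h4 : m.A4) : ∃ C : ℝ, 0 ≤ C ∧ ∀ u x,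
    m.r u x ≤ C ∧ m.gamma1 u x ≤ C ∧ m.gamma2 u x ≤ C ∧ m.h u x ≤ C := by
  obtain ⟨Λ, hΛ⟩ := exists_Q_bound h2 h3
  obtain ⟨C, hC0, hG, hH, hK⟩ := exists_lump_bound h4
  obtain ⟨c, hG0, hH0, hK0⟩ := h4.lump
  classical
  obtain ⟨r, hr0, hr⟩ := exists_uniform_bound h4.r_bdd
  obtain ⟨b, hb0, hb⟩ := exists_uniform_bound h4.β_bdd
  have hg0 : 0 ≤ ∑ _y : S, |Λ| * C := Finset.sum_nonneg fun _ _ => by positivity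
  have hbC : 0 ≤ b * C := by positivity
  refine ⟨r + (∑ _y : S, |Λ| * C) + b * C + C, by positivity, fun u x => ⟨?_, ?_, ?_, ?_⟩⟩
  · linarith [hr u x]
  · have : m.gamma1 u x ≤ ∑ _y : S, |Λ| * C := by
      refine (Finset.sum_le_sum fun y _ => ?_).trans
        (Finset.sum_le_sum_of_subset_of_nonneg (Finset.filter_subset _ _) fun _ _ _ => by positivity)
      have hm := ofReal_setIntegral_Ici (hG0 u x y).1 (hG u x y)
      exact mul_le_mul ((le_abs_self _).trans ((hΛ u x y).trans (le_abs_self _))) hm.2.2 hm.2.1 (abs_nonneg _)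
    linarith
  · have hm := ofReal_setIntegral_Ici (hK0 u x).1 (hK u x)
    have : m.gamma2 u x ≤ b * C := mul_le_mul (hb u x) hm.2.2 hm.2.1 hb0
    linarith
  · have hm := ofReal_setIntegral_Ici (hH0 u x).1 (hH u x)
    have : m.h u x ≤ C := hm.2.2
    linarith

end RewardModel

end ModelBounds

/-! ### From cells to the history -/

section HistoryCells

open scoped ENNReal

namespace RewardProcess

variable {S Ω : Type*} [Fintype S] [DecidableEq S] [MeasurableSpace S] [MeasurableSingletonClass S]
variable [MeasurableSpace Ω] {p : RewardProcess Ω S} {m : RewardModel S} {Pr : Measure Ω} [IsProbabilityMeasure Pr]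
  {P : ℝ≥0 → ℝ≥0 → Matrix S S ℝ} {s t : ℝ≥0} {E : Set Ω}

theorem IsMarkovJump.measurable_setLIntegral_sigmaXN (hX : p.IsMarkovJump P Pr) {f : ℝ≥0 → S → ℝ≥0∞}
    (hf : ∀ x, Measurable fun u => f u x) (c d : ℝ≥0) :
    Measurable[p.sigmaXN] fun ω => ∫⁻ u in Set.Ioc c d, f u (p.X u ω) ∂leb :=
  measurable_setLIntegral_path measurable_X_sigmaXN (fun ω => (hX.isJumpPath ω).right_cont) hf c d

/-- Given `X` and `N`, a jump reward is replaced by its mean under `G`; the Lévy system then turns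
the sum over jumps into the integral of `γ₁`. -/
theorem HasLumpLaws.setLIntegral_cell_jumps (hL : p.HasLumpLaws m Pr) (hX : p.IsMarkovJump P Pr)
    (hP : IsTransitionFamily m.Q P) (hN : p.IsCoxCounting m.β Pr) (h1 : m.A1) (h2 : m.A2) (h3 : m.A3) (h4 : m.A4)
    (a c : ℕ) (hE : MeasurableSet[p.sigmaXNUpTo s] E) (u : ℕ ⊕ ℕ ⊕ ℕ → ℝ) :
    ∫⁻ ω in p.cell m s a c E u, ∑ j ∈ Finset.Ioc (p.J s ω) (p.J t ω), ENNReal.ofReal (p.jumpReward j ω) ∂Pr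
      = ∫⁻ ω in p.cell m s a c E u, ∫⁻ v in Set.Ioc s t, ENNReal.ofReal (m.gamma1 v (p.X v ω)) ∂leb ∂Pr := by
  obtain ⟨Λ, hΛ⟩ := RewardModel.exists_Q_bound h2 h3
  have hgm : ∀ x y, Measurable fun u => ∫⁻ z, ENNReal.ofReal z ∂(m.G u x y : Measure ℝ) := fun x y =>
    (Measure.measurable_lintegral ENNReal.measurable_ofReal).comp (h1.measurable_G x y)
  have hsub : ∀ (f : ℕ → Ω → ℝ≥0∞) ω, ∑ j ∈ Finset.Ioc (p.J s ω) (p.J t ω), f (j - 1 + 1) ω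
      = ∑ j ∈ Finset.Ioc (p.J s ω) (p.J t ω), f j ω := fun f ω =>
    Finset.sum_congr rfl fun j hj => by
      rw [Nat.sub_add_cancel (Nat.one_le_iff_ne_zero.2 (Nat.ne_zero_of_lt (Finset.mem_Ioc.1 hj).1))]
  -- On the relevant event at least `j` jumps occur, so `max a j` jump rewards have known laws.
  -- Writing `j - 1 + 1` instead of `j` matters only for `j = 0`, which no interval `(J s, J t]`
  -- contains.
  have h := hL.setLIntegral_cell_sum hX hN h1 h4 a c hE u (A := p.J) (t := t) hX.measurable_J_sigmaXN Sum.inl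
    (fun j ω hω hj => ?_) (fun j => ⟨max a (j - 1 + 1), c, ?_, fun ω hω hj hj' => ?_⟩)
    (hX.measurable_setLIntegral_sigmaXN (fun x => (h1.measurable_gamma1 x).ennreal_ofReal) s t) fun E' hE' => ?_
  · refine Eq.trans (lintegral_congr fun ω => ?_) h
    exact (hsub (fun j ω => ENNReal.ofReal (p.jumpReward j ω)) ω).symm
  · rw [inl_mem_rewardIdx]
    have := hω.2.1
    omega
  · refine Finset.insert_subset (inl_mem_rewardIdx.2 ?_) (rewardIdx_subset (le_max_left _ _) le_rfl le_rfl)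
    omega
  · refine ⟨⟨t, ?_⟩, ⟨s, hω.2.2.ge⟩⟩
    have := hω.2.1
    omega
  · have h5 := hX.setLIntegral_sum_jumps hP hN h1.β h1.Q hΛ h2.offDiag_nonneg (t := t) hgm hE'
    simp only [← RewardModel.ofReal_gamma1 h2 h4] at h5
    rw [← h5]
    refine lintegral_congr fun ω => Finset.sum_congr rfl fun j hj => ?_
    simp only [rewardLaw]
    rw [Nat.sub_add_cancel (Nat.one_le_iff_ne_zero.2 (Nat.ne_zero_of_lt (Finset.mem_Ioc.1 hj).1))]

theorem HasLumpLaws.setLIntegral_cell_points (hL : p.HasLumpLaws m Pr) (hX : p.IsMarkovJump P Pr)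
    (hP : IsTransitionFamily m.Q P) (hN : p.IsCoxCounting m.β Pr) (h1 : m.A1) (h2 : m.A2) (h3 : m.A3) (h4 : m.A4)
    (a c : ℕ) (hE : MeasurableSet[p.sigmaXNUpTo s] E) (u : ℕ ⊕ ℕ ⊕ ℕ → ℝ) :
    ∫⁻ ω in p.cell m s a c E u, ∑ k ∈ Finset.Ioc (p.N s ω) (p.N t ω), ENNReal.ofReal (p.extReward k ω) ∂Pr
      = ∫⁻ ω in p.cell m s a c E u, ∫⁻ v in Set.Ioc s t, ENNReal.ofReal (m.gamma2 v (p.X v ω)) ∂leb ∂Pr := by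
  obtain ⟨Λ, hΛ⟩ := RewardModel.exists_Q_bound h2 h3
  obtain ⟨b, -, hb⟩ := RewardModel.exists_uniform_bound h4.β_bdd
  have hgm : ∀ x, Measurable fun u => ∫⁻ z, ENNReal.ofReal z ∂(m.K u x : Measure ℝ) := fun x =>
    (Measure.measurable_lintegral ENNReal.measurable_ofReal).comp (h1.measurable_K x)
  have h := hL.setLIntegral_cell_sum hX hN h1 h4 a c hE u (A := p.N) (t := t) measurable_N_sigmaXN
    (fun k => Sum.inr (Sum.inr k))
    (fun j ω hω hj => ?_) (fun j => ⟨a, max c (j - 1 + 1), ?_, fun ω hω hj hj' => ?_⟩)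
    (hX.measurable_setLIntegral_sigmaXN (fun x => (h1.measurable_gamma2 x).ennreal_ofReal) s t) fun E' hE' => ?_
  · refine Eq.trans (lintegral_congr fun ω => Finset.sum_congr rfl fun j hj => ?_) h
    simp only [reward]
    rw [Nat.sub_add_cancel (Nat.one_le_iff_ne_zero.2 (Nat.ne_zero_of_lt (Finset.mem_Ioc.1 hj).1))]
  · rw [inr_inr_mem_rewardIdx]
    have := hω.2.2
    omega
  · refine Finset.insert_subset (inr_inr_mem_rewardIdx.2 ?_) (rewardIdx_subset le_rfl le_rfl (le_max_left _ _))
    omega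
  · refine ⟨⟨s, hω.2.1.ge⟩, ⟨t, ?_⟩⟩
    have := hω.2.2
    omega
  · have h5 := hX.setLIntegral_sum_points hP hN h1.β hΛ h4.β_nonneg hb (t := t) hgm hE'
    simp only [← RewardModel.ofReal_gamma2 h4] at h5
    rw [← h5]
    refine lintegral_congr fun ω => Finset.sum_congr rfl fun j hj => ?_
    simp only [rewardLaw]
    rw [Nat.sub_add_cancel (Nat.one_le_iff_ne_zero.2 (Nat.ne_zero_of_lt (Finset.mem_Ioc.1 hj).1))]

/-- The time of the reward is deterministic and later than `s`, so no further jump or external event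
is required and `D` is the whole space. -/
theorem HasLumpLaws.setLIntegral_cell_sched (hL : p.HasLumpLaws m Pr) (hX : p.IsMarkovJump P Pr)
    (hN : p.IsCoxCounting m.β Pr) (h1 : m.A1) (h4 : m.A4)
    (a c : ℕ) (hE : MeasurableSet[p.sigmaXNUpTo s] E) (u : ℕ ⊕ ℕ ⊕ ℕ → ℝ) {i : ℕ} (hi : m.numScheduled s < i) :
    ∫⁻ ω in p.cell m s a c E u, ENNReal.ofReal (p.schedReward i ω) ∂Pr
      = ∫⁻ ω in p.cell m s a c E u, ENNReal.ofReal (m.h (m.τ i) (p.X (m.τ i) ω)) ∂Pr := by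
  obtain ⟨i, rfl⟩ : ∃ l, i = l + 1 := ⟨i - 1, by omega⟩
  have h := hL.setLIntegral_cell_reward hX hN h1 h4 a c hE u (D := Set.univ) (@MeasurableSet.univ _ p.sigmaXN)
    (l := Sum.inr (Sum.inl i)) (a' := a) (b' := i + 1) (c' := c) (fun hl => by rw [inr_inl_mem_rewardIdx] at hl; omega)
    (Finset.insert_subset (inr_inl_mem_rewardIdx.2 i.lt_succ_self) (rewardIdx_subset le_rfl hi.le le_rfl))
    (Set.inter_subset_left.trans (countSet_subset_atLeast s a c E))
  have hm : Measurable[p.sigmaXN] fun ω => ∫⁻ z, ENNReal.ofReal z ∂(p.rewardLaw m (Sum.inr (Sum.inl i)) ω) :=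
    (Measure.measurable_lintegral ENNReal.measurable_ofReal).comp
      (hX.measurable_rewardLaw_sigmaXN hN h1 (Sum.inr (Sum.inl i)))
  rw [Set.inter_univ, Measure.restrict_univ, ← hL.setLIntegral_cell hX hN h1 a c hE u hm] at h
  refine h.trans (lintegral_congr fun ω => ?_)
  rw [RewardModel.ofReal_h h4]
  rfl

/-- The cells at time `s`. -/
def cells (p : RewardProcess Ω S) (m : RewardModel S) (s : ℝ≥0) : Set (Set Ω) :=
  {A | ∃ (a c : ℕ) (E : Set Ω) (u : ℕ ⊕ ℕ ⊕ ℕ → ℝ), MeasurableSet[p.sigmaXNUpTo s] E ∧ A = p.cell m s a c E u}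

/-- Cells that meet have the same counts, hence constrain the same rewards; the bounds combine to
their minimum. -/
theorem isPiSystem_cells (s : ℝ≥0) : IsPiSystem (p.cells m s) := by
  rintro _ ⟨a, c, E, u, hE, rfl⟩ _ ⟨a', c', E', u', hE', rfl⟩ ⟨ω₀, h₀, h₀'⟩
  obtain rfl : a = a' := h₀.1.2.1.symm.trans h₀'.1.2.1
  obtain rfl : c = c' := h₀.1.2.2.symm.trans h₀'.1.2.2
  refine ⟨a, c, E ∩ E', fun l => min (u l) (u' l), hE.inter hE', ?_⟩
  ext ω
  simp only [cell, countSet, Set.mem_inter_iff, Set.mem_ofPred_eq, le_min_iff, forall_and]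
  tauto

theorem exists_nat_forall_le (I : Finset (ℕ ⊕ ℕ ⊕ ℕ)) (f : ℕ ⊕ ℕ ⊕ ℕ → ℝ) : ∃ n : ℕ, ∀ l ∈ I, f l ≤ n := by
  obtain ⟨n, hn⟩ := exists_nat_ge (∑ l ∈ I, |f l|)
  exact ⟨n, fun l hl => (le_abs_self _).trans
    ((Finset.single_le_sum (f := fun l => |f l|) (fun _ _ => abs_nonneg _) hl).trans hn)⟩

theorem mem_cell_self {s : ℝ≥0} {ω : Ω} {u : ℕ ⊕ ℕ ⊕ ℕ → ℝ} (hω : ω ∈ E)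
    (h : ∀ l ∈ rewardIdx (p.J s ω) (m.numScheduled s) (p.N s ω), p.reward l ω ≤ u l) :
    ω ∈ p.cell m s (p.J s ω) (p.N s ω) E u := ⟨⟨hω, rfl, rfl⟩, h⟩

/-- Only finitely many rewards have been collected by time `s`, so integer bounds on them are
eventually satisfied and an event is a countable union of its cells. -/
theorem sigmaXNUpTo_le_generateFrom_cells (s : ℝ≥0) :
    p.sigmaXNUpTo s ≤ MeasurableSpace.generateFrom (p.cells m s) := by
  intro E hE
  have : E = ⋃ (a : ℕ) (c : ℕ) (n : ℕ), p.cell m s a c E fun _ => n := by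
    ext ω
    simp only [Set.mem_iUnion]
    refine ⟨fun h => ?_, fun ⟨a, c, n, h⟩ => h.1.1⟩
    obtain ⟨n, hn⟩ := exists_nat_forall_le (rewardIdx (p.J s ω) (m.numScheduled s) (p.N s ω)) fun l => p.reward l ω
    exact ⟨_, _, n, mem_cell_self h hn⟩
  rw [this]
  exact MeasurableSet.iUnion fun a => MeasurableSet.iUnion fun c => MeasurableSet.iUnion fun n =>
    MeasurableSpace.measurableSet_generateFrom ⟨a, c, E, fun _ => n, hE, rfl⟩

open scoped Classical in
/-- The reward `l`, if it is collected until time `s`. -/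
noncomputable def collected (p : RewardProcess Ω S) (m : RewardModel S) (s : ℝ≥0) (l : ℕ ⊕ ℕ ⊕ ℕ) (ω : Ω) : ℝ :=
  if l ∈ rewardIdx (p.J s ω) (m.numScheduled s) (p.N s ω) then p.reward l ω else 0

/-- Cells say nothing about rewards not yet collected, hence the value `0` for these. A sublevel set
of a collected reward is a union of cells whose other bounds run through the integers. -/
theorem IsMarkovJump.measurable_collected (hX : p.IsMarkovJump P Pr) (s : ℝ≥0) (l : ℕ ⊕ ℕ ⊕ ℕ) :
    Measurable[MeasurableSpace.generateFrom (p.cells m s)] (p.collected m s l) := by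
  classical
  have hle := sigmaXNUpTo_le_generateFrom_cells (p := p) (m := m) s
  have hI : MeasurableSet[p.sigmaXNUpTo s] {ω | l ∈ rewardIdx (p.J s ω) (m.numScheduled s) (p.N s ω)} :=
    ((hX.measurable_J_sigmaXNUpTo le_rfl).prodMk (measurable_N_sigmaXNUpTo le_rfl))
      (DiscreteMeasurableSpace.forall_measurableSet {q : ℕ × ℕ | l ∈ rewardIdx q.1 (m.numScheduled s) q.2})
  refine measurable_of_Iic fun y => ?_
  have h1 : MeasurableSet[MeasurableSpace.generateFrom (p.cells m s)]
      {ω | l ∈ rewardIdx (p.J s ω) (m.numScheduled s) (p.N s ω) ∧ p.reward l ω ≤ y} := by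
    have : {ω | l ∈ rewardIdx (p.J s ω) (m.numScheduled s) (p.N s ω) ∧ p.reward l ω ≤ y}
        = ⋃ (a : ℕ) (c : ℕ) (n : ℕ) (_ : l ∈ rewardIdx a (m.numScheduled s) c),
          p.cell m s a c Set.univ (Function.update (fun _ => (n : ℝ)) l y) := by
      ext ω
      simp only [Set.mem_iUnion, Set.mem_ofPred_eq]
      constructor
      · rintro ⟨hl, hy⟩
        obtain ⟨n, hn⟩ := exists_nat_forall_le (rewardIdx (p.J s ω) (m.numScheduled s) (p.N s ω)) fun l => p.reward l ω
        refine ⟨_, _, n, hl, mem_cell_self (Set.mem_univ _) fun l' hl' => ?_⟩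
        by_cases hll : l' = l
        · subst hll; rwa [Function.update_self]
        · rw [Function.update_of_ne hll]; exact hn l' hl'
      · rintro ⟨a, c, n, hl, ⟨-, rfl, rfl⟩, h⟩
        refine ⟨hl, ?_⟩
        simpa using h l hl
    rw [this]
    exact MeasurableSet.iUnion fun a => MeasurableSet.iUnion fun c => MeasurableSet.iUnion fun n =>
      MeasurableSet.iUnion fun _ => MeasurableSpace.measurableSet_generateFrom ⟨a, c, _, _, @MeasurableSet.univ _ (p.sigmaXNUpTo s), rfl⟩
  have h2 : p.collected m s l ⁻¹' Set.Iic y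
      = {ω | l ∈ rewardIdx (p.J s ω) (m.numScheduled s) (p.N s ω) ∧ p.reward l ω ≤ y} ∪
        ({ω | l ∈ rewardIdx (p.J s ω) (m.numScheduled s) (p.N s ω)}ᶜ ∩ {_ω | (0 : ℝ) ≤ y}) := by
    ext ω
    by_cases hl : l ∈ rewardIdx (p.J s ω) (m.numScheduled s) (p.N s ω) <;> simp [collected, hl]
  rw [h2]
  exact h1.union ((hle _ hI).compl.inter (MeasurableSet.const _))

/-- What is collected by time `v ≤ s` is collected by `s`, so the three reward sums at `v` are sums
of the variables `collected m s`. -/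
theorem IsMarkovJump.history_le_generateFrom_cells (hX : p.IsMarkovJump P Pr) (hN : p.IsCoxCounting m.β Pr) (s : ℝ≥0) :
    p.history m s ≤ MeasurableSpace.generateFrom (p.cells m s) := by
  have hle := sigmaXNUpTo_le_generateFrom_cells (p := p) (m := m) s
  refine iSup₂_le fun v (hv : v ≤ s) => sup_le (sup_le (sup_le (sup_le ?_ ?_) ?_) ?_) ?_
  · exact ((measurable_X_sigmaXNUpTo hv).mono hle le_rfl).comap_le
  · exact ((measurable_N_sigmaXNUpTo hv).mono hle le_rfl).comap_le
  · refine Measurable.comap_le ?_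
    have h : p.jumpSum v = fun ω => ∑ j ∈ Finset.Ioc 0 (p.J v ω), p.collected m s (Sum.inl (j - 1)) ω := by
      ext ω
      refine Finset.sum_congr rfl fun j hj => ?_
      have hj' : 1 ≤ j ∧ j ≤ p.J v ω := Finset.mem_Icc.1 hj
      have hJ : p.J v ω ≤ p.J s ω := (hX.isJumpPath ω).isCountingPath_jumpCount.mono hv
      rw [collected, if_pos (inl_mem_rewardIdx.2 (by omega))]
      simp only [reward, Nat.sub_add_cancel hj'.1]
    rw [h]
    exact measurable_sum_Ioc (@measurable_const _ _ _ (MeasurableSpace.generateFrom (p.cells m s)) _)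
      ((hX.measurable_J_sigmaXNUpTo hv).mono hle le_rfl) fun j => hX.measurable_collected s _
  · refine Measurable.comap_le ?_
    have h : p.schedSum m v = fun ω => ∑ i ∈ Finset.Ioc 0 (m.numScheduled v), p.collected m s (Sum.inr (Sum.inl (i - 1))) ω := by
      ext ω
      refine Finset.sum_congr rfl fun i hi => ?_
      have hi' := Finset.mem_Icc.1 hi
      have hn : i ≤ m.numScheduled s := m.tau_le_iff.1 ((m.tau_le_iff.2 hi'.2).trans hv)
      rw [collected, if_pos (inr_inl_mem_rewardIdx.2 (by omega))]
      simp only [reward, Nat.sub_add_cancel hi'.1]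
    rw [h]
    exact measurable_sum_Ioc (@measurable_const _ _ _ (MeasurableSpace.generateFrom (p.cells m s)) _)
      (@measurable_const _ _ _ (MeasurableSpace.generateFrom (p.cells m s)) _) fun j => hX.measurable_collected s _
  · refine Measurable.comap_le ?_
    have h : p.extSum v = fun ω => ∑ k ∈ Finset.Ioc 0 (p.N v ω), p.collected m s (Sum.inr (Sum.inr (k - 1))) ω := by
      ext ω
      refine Finset.sum_congr rfl fun k hk => ?_
      have hk' := Finset.mem_Icc.1 hk
      have hNv : p.N v ω ≤ p.N s ω := hN.mono ω hv
      rw [collected, if_pos (inr_inr_mem_rewardIdx.2 (by omega))]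
      simp only [reward, Nat.sub_add_cancel hk'.1]
    rw [h]
    exact measurable_sum_Ioc (@measurable_const _ _ _ (MeasurableSpace.generateFrom (p.cells m s)) _)
      ((measurable_N_sigmaXNUpTo hv).mono hle le_rfl) fun j => hX.measurable_collected s _

/-- Equality of integrals on cells extends to the history. -/
theorem HasLumpLaws.setLIntegral_history_congr (hL : p.HasLumpLaws m Pr) (hX : p.IsMarkovJump P Pr)
    (hN : p.IsCoxCounting m.β Pr) {F G : Ω → ℝ≥0∞} (hF : ∫⁻ ω, F ω ∂Pr ≠ ⊤)
    (h : ∀ (a c : ℕ) (E : Set Ω) (u : ℕ ⊕ ℕ ⊕ ℕ → ℝ), MeasurableSet[p.sigmaXNUpTo s] E →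
      ∫⁻ ω in p.cell m s a c E u, F ω ∂Pr = ∫⁻ ω in p.cell m s a c E u, G ω ∂Pr)
    {A : Set Ω} (hA : MeasurableSet[p.history m s] A) : ∫⁻ ω in A, F ω ∂Pr = ∫⁻ ω in A, G ω ∂Pr := by
  have hle : MeasurableSpace.generateFrom (p.cells m s) ≤ ‹MeasurableSpace Ω› := by
    refine MeasurableSpace.generateFrom_le ?_
    rintro _ ⟨a, c, E, u, hE, rfl⟩
    exact hL.measurableSet_cell hX hN a c hE u
  have hmeas : (Pr.withDensity F).trim hle = (Pr.withDensity G).trim hle := by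
    -- Cells with all bounds equal to an integer form a countable cover of finite mass; finiteness
    -- is needed for `F` only.
    refine @Measure.ext_of_generateFrom_of_cover_subset Ω (MeasurableSpace.generateFrom (p.cells m s)) _ _ (p.cells m s)
      (Set.range fun q : ℕ × ℕ × ℕ => p.cell m s q.1 q.2.1 Set.univ fun _ => q.2.2) rfl
      (isPiSystem_cells s) ?_ (Set.countable_range _) ?_ ?_ ?_
    · rintro _ ⟨q, rfl⟩
      exact ⟨_, _, _, _, @MeasurableSet.univ _ (p.sigmaXNUpTo s), rfl⟩
    · refine Set.eq_univ_of_forall fun ω => ?_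
      obtain ⟨n, hn⟩ := exists_nat_forall_le (rewardIdx (p.J s ω) (m.numScheduled s) (p.N s ω)) fun l => p.reward l ω
      exact ⟨_, ⟨(_, _, n), rfl⟩, mem_cell_self (Set.mem_univ _) hn⟩
    · rintro _ ⟨q, rfl⟩
      have hq : MeasurableSet[MeasurableSpace.generateFrom (p.cells m s)] (p.cell m s q.1 q.2.1 Set.univ fun _ => q.2.2) :=
        MeasurableSpace.measurableSet_generateFrom ⟨_, _, _, _, @MeasurableSet.univ _ (p.sigmaXNUpTo s), rfl⟩
      rw [trim_measurableSet_eq hle hq, withDensity_apply _ (hle _ hq)]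
      exact ne_top_of_le_ne_top hF (setLIntegral_le_lintegral _ _)
    · intro A hA'
      have hAm := MeasurableSpace.measurableSet_generateFrom hA'
      rw [trim_measurableSet_eq hle hAm, trim_measurableSet_eq hle hAm, withDensity_apply _ (hle _ hAm),
        withDensity_apply _ (hle _ hAm)]
      obtain ⟨a, c, E, u, hE, rfl⟩ := hA'
      exact h a c E u hE
  have hAm := hX.history_le_generateFrom_cells hN s A hA
  rw [← withDensity_apply _ (hle _ hAm), ← withDensity_apply _ (hle _ hAm), ← trim_measurableSet_eq hle hAm, hmeas,
    trim_measurableSet_eq hle hAm]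

theorem HasLumpLaws.history_le (hL : p.HasLumpLaws m Pr) (hX : p.IsMarkovJump P Pr)
    (hN : p.IsCoxCounting m.β Pr) (s : ℝ≥0) : p.history m s ≤ ‹MeasurableSpace Ω› := by
  refine (hX.history_le_generateFrom_cells hN s).trans (MeasurableSpace.generateFrom_le ?_)
  rintro _ ⟨a, c, E, u, hE, rfl⟩
  exact hL.measurableSet_cell hX hN a c hE u

end RewardProcess

end HistoryCells

/-! ### Convergence and boundedness of `ν` -/

section Nu

open scoped ENNReal

theorem integrable_exp_neg_mul_leb {κ : ℝ} (hκ : 0 < κ) : Integrable (fun u : ℝ≥0 => Real.exp (-κ * u)) leb := by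
  have h : Integrable (fun u : ℝ => Real.exp (-κ * u)) (leb.map ((↑) : ℝ≥0 → ℝ)) := by
    rw [map_coe_leb]
    exact (integrableOn_Ici_iff_integrableOn_Ioi).2 (exp_neg_integrableOn_Ioi 0 hκ)
  exact (measurableEmbedding_nnrealCoe.integrable_map_iff).1 h

namespace RewardModel

variable {S : Type*} [Fintype S] [DecidableEq S] {m : RewardModel S}

theorem exists_gap (h5 : m.A5) : ∃ g : ℝ, 0 < g ∧ ∀ i k : ℕ, (m.τ i : ℝ) + g * k ≤ m.τ (i + k) := by
  have hb : BddBelow (Set.range fun i : ℕ => (m.τ (i + 1) : ℝ) - m.τ i) :=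
    ⟨0, by rintro _ ⟨i, rfl⟩; exact sub_nonneg.2 (m.τ_strictMono i.lt_succ_self).le⟩
  refine ⟨_, h5, fun i k => ?_⟩
  induction k with
  | zero => simp
  | succ k ih =>
    have := ciInf_le hb (i + k)
    push_cast
    rw [← add_assoc i k 1]
    linarith

/-- The scheduled times after `t`. -/
noncomputable def schedEquiv (m : RewardModel S) (t : ℝ≥0) : ℕ ≃ {i : ℕ // t < m.τ i} where
  toFun k := ⟨k + (m.numScheduled t + 1), not_le.1 fun h => by have := m.tau_le_iff.1 h; omega⟩
  invFun i := i.1 - (m.numScheduled t + 1)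
  left_inv k := by simp
  right_inv i := by
    have : ¬ i.1 ≤ m.numScheduled t := fun h => absurd (m.tau_le_iff.2 h) (not_le.2 i.2)
    ext
    simp only
    omega

theorem exists_osc_bound (h2 : m.A2) (h3 : m.A3) (h4 : m.A4) : ∃ C : ℝ, ∀ u x,
    |m.rTilde u x| ≤ C ∧ |m.h u x| ≤ C := by
  obtain ⟨C, hC0, hC⟩ := exists_rate_bound h2 h3 h4
  refine ⟨3 * C, fun u x => ⟨?_, ?_⟩⟩
  · have h0 : 0 ≤ m.rTilde u x :=
      add_nonneg (h4.r_nonneg u x) (add_nonneg (h2.gamma1_nonneg u x) (h4.gamma2_nonneg u x))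
    rw [abs_of_nonneg h0]
    show m.r u x + (m.gamma1 u x + m.gamma2 u x) ≤ _
    linarith [(hC u x).1, (hC u x).2.1, (hC u x).2.2.1]
  · rw [abs_of_nonneg (m.h_nonneg u x)]
    linarith [(hC u x).2.2.2]

end RewardModel

namespace RewardProcess

variable {S Ω : Type*} [Fintype S] [DecidableEq S] [MeasurableSpace S] [MeasurableSingletonClass S]
variable [MeasurableSpace Ω] {p : RewardProcess Ω S} {m : RewardModel S} {Pr : Measure Ω} [IsProbabilityMeasure Pr]
  {P : ℝ≥0 → ℝ≥0 → Matrix S S ℝ}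

theorem IsMarkovJump.integral_comp_X (hX : p.IsMarkovJump P Pr) (u : ℝ≥0) (f : S → ℝ) :
    ∫ ω, f (p.X u ω) ∂Pr = ∑ z, f z * Pr.real (Set.univ ∩ p.X u ⁻¹' {z}) := by
  rw [← hX.setIntegral_comp_X, Measure.restrict_univ]

theorem IsMarkovJump.integral_comp_X_eq_condMean (hX : p.IsMarkovJump P Pr) (hP : IsTransitionFamily m.Q P)
    (hN : p.IsCoxCounting m.β Pr) (h1 : m.A1) {t u : ℝ≥0} (htu : t ≤ u) (f : S → ℝ) :
    ∫ ω, f (p.X u ω) ∂Pr = ∑ z, Pr.real (Set.univ ∩ p.X t ⁻¹' {z}) * condMean P t z u f := by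
  have huniv : MeasurableSet[p.sigmaXNUpTo t] (Set.univ : Set Ω) := @MeasurableSet.univ _ (p.sigmaXNUpTo t)
  have h : ∀ y, Pr.real (Set.univ ∩ p.X u ⁻¹' {y}) = ∑ z, Pr.real (Set.univ ∩ p.X t ⁻¹' {z}) * P t u z y := by
    intro y
    rw [← hX.sum_measureReal_inter t]
    refine Finset.sum_congr rfl fun z _ => ?_
    rw [Set.inter_right_comm, hX.measureReal_inter_inter hP hN h1.β le_rfl htu huniv]
  rw [hX.integral_comp_X]
  simp only [h, condMean, Finset.mul_sum]
  rw [Finset.sum_comm]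
  exact Finset.sum_congr rfl fun z _ => Finset.sum_congr rfl fun y _ => by ring

/-- Exponential decay of the conditional means of centered functions. -/
theorem IsMarkovJump.exists_centered_bound (hX : p.IsMarkovJump P Pr) (hP : IsTransitionFamily m.Q P)
    (hN : p.IsCoxCounting m.β Pr) (h1 : m.A1) (h2 : m.A2) (h3 : m.A3) :
    ∃ B κ : ℝ, 0 < B ∧ 0 < κ ∧ ∀ (t v : ℝ≥0) (f : S → ℝ) (C : ℝ), (∀ x, |f x| ≤ C) → ∀ x,
      |condMean P t x (t + v) (fun y => f y - ∫ ω, f (p.X (t + v) ω) ∂Pr)| ≤ B * C * Real.exp (-κ * v) := by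
  obtain ⟨Λ, hΛ⟩ := RewardModel.exists_Q_bound h2 h3
  obtain ⟨ε, hε, hQε⟩ := RewardModel.exists_Q_lower h2 h3
  obtain ⟨B, κ, hB, hκ, h⟩ := hP.exists_exp_bound hΛ hε hQε h2.irreducible
  refine ⟨B * 2, κ, by positivity, hκ, fun t v f C hC x => ?_⟩
  have hle : t ≤ t + v := le_self_add
  have hK : ∀ x y, |f x - f y| ≤ 2 * C := fun x y => (abs_sub _ _).trans (by linarith [hC x, hC y])
  have hsum : ∑ z, Pr.real (Set.univ ∩ p.X t ⁻¹' {z}) = 1 := by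
    rw [hX.sum_measureReal_inter, probReal_univ]
  -- The centring term is itself an average of conditional means over the law of `X t`. So the
  -- centred mean averages differences between two starting states, to which exponential forgetting
  -- applies. The oscillation of `f` is at most `2 C`.
  have h6 : condMean P t x (t + v) (fun y => f y - ∫ ω, f (p.X (t + v) ω) ∂Pr)
      = ∑ z, Pr.real (Set.univ ∩ p.X t ⁻¹' {z}) * (condMean P t x (t + v) f - condMean P t z (t + v) f) := by
    have h7 : condMean P t x (t + v) (fun y => f y - ∫ ω, f (p.X (t + v) ω) ∂Pr)
        = condMean P t x (t + v) f - ∫ ω, f (p.X (t + v) ω) ∂Pr := by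
      simp only [condMean, mul_sub, Finset.sum_sub_distrib, ← Finset.sum_mul, hP.sum_eq_one hle, one_mul]
    rw [h7, hX.integral_comp_X_eq_condMean hP hN h1 hle]
    simp only [mul_sub, Finset.sum_sub_distrib, ← Finset.sum_mul, hsum, one_mul]
  rw [h6]
  calc |∑ z, Pr.real (Set.univ ∩ p.X t ⁻¹' {z}) * (condMean P t x (t + v) f - condMean P t z (t + v) f)|
      ≤ ∑ z, Pr.real (Set.univ ∩ p.X t ⁻¹' {z}) * (B * (2 * C) * Real.exp (-κ * v)) := by
        refine (Finset.abs_sum_le_sum_abs _ _).trans (Finset.sum_le_sum fun z _ => ?_)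
        rw [abs_mul, abs_of_nonneg measureReal_nonneg]
        exact mul_le_mul_of_nonneg_left (h t v f (2 * C) hK x z) measureReal_nonneg
    _ = B * 2 * C * Real.exp (-κ * v) := by rw [← Finset.sum_mul, hsum]; ring

theorem IsMarkovJump.measurable_rTildeC (hX : p.IsMarkovJump P Pr) (h1 : m.A1) (x : S) :
    Measurable fun u => p.rTildeC m Pr u x := by
  refine (h1.measurable_rTilde x).sub ?_
  simp only [hX.integral_comp_X]
  exact Finset.measurable_fun_sum _ fun z _ => (h1.measurable_rTilde z).mul (hX.measurable_measureReal_inter _ z)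

theorem IsMarkovJump.measurable_nu1Integrand (hX : p.IsMarkovJump P Pr) (hP : IsTransitionFamily m.Q P)
    (h1 : m.A1) (h2 : m.A2) (h3 : m.A3) (t : ℝ≥0) (x : S) : Measurable (p.nu1Integrand m P Pr t x) := by
  obtain ⟨Λ, hΛ⟩ := RewardModel.exists_Q_bound h2 h3
  exact Finset.measurable_fun_sum _ fun y _ => (hP.continuous_add hΛ t x y).measurable.mul
    ((hX.measurable_rTildeC h1 y).comp (measurable_const_add t))

/-- Bounds for the integrand of `ν₁` and for the terms of `ν₂`. -/
theorem IsMarkovJump.exists_nu_bounds (hX : p.IsMarkovJump P Pr) (hP : IsTransitionFamily m.Q P)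
    (hN : p.IsCoxCounting m.β Pr) (h1 : m.A1) (h2 : m.A2) (h3 : m.A3) (h4 : m.A4) (h5 : m.A5) :
    ∃ D κ ρ : ℝ, 0 < κ ∧ 0 ≤ ρ ∧ ρ < 1 ∧ (∀ t x u, ‖p.nu1Integrand m P Pr t x u‖ ≤ D * Real.exp (-κ * u)) ∧
      ∀ t x k, ‖p.nu2Term m P Pr t x (m.schedEquiv t k)‖ ≤ D * ρ ^ k := by
  obtain ⟨B, κ, hB, hκ, h⟩ := hX.exists_centered_bound hP hN h1 h2 h3
  obtain ⟨C, hC⟩ := RewardModel.exists_osc_bound h2 h3 h4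
  obtain ⟨g, hg, hgap⟩ := RewardModel.exists_gap h5
  refine ⟨B * C, κ, Real.exp (-κ * g), hκ, (Real.exp_pos _).le, ?_,
    fun t x u => h t u _ C (fun y => (hC _ y).1) x, fun t x k => ?_⟩
  · rw [Real.exp_lt_one_iff]
    nlinarith
  · obtain ⟨v, hv⟩ : ∃ v, m.τ (m.schedEquiv t k : ℕ) = t + v := exists_add_of_le (m.schedEquiv t k).2.le
    -- The first scheduled time after `t` may be arbitrarily close to `t`, so the term with index
    -- `k`, counted from `0`, is known to lie only `k` gaps away. Hence the ratio `ρ = exp (-κ g)`.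
    have hv' : g * k ≤ v := by
      have h6 := hgap (m.numScheduled t + 1) k
      have h7 : t < m.τ (m.numScheduled t + 1) := not_le.1 fun h => by have := m.tau_le_iff.1 h; omega
      have h8 : (m.τ (m.numScheduled t + 1 + k) : ℝ) = t + v := by
        rw [add_comm _ k]
        exact_mod_cast hv
      have h7' : (t : ℝ) < m.τ (m.numScheduled t + 1) := h7
      linarith
    have hC0 : 0 ≤ C := (abs_nonneg _).trans (hC 0 x).1
    have h9 := h t v (m.h (t + v)) C (fun y => (hC _ y).2) x
    have h10 : ‖p.nu2Term m P Pr t x (m.schedEquiv t k)‖ ≤ B * C * Real.exp (-κ * v) := by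
      rw [Real.norm_eq_abs, nu2Term, hv]
      exact h9
    refine h10.trans (mul_le_mul_of_nonneg_left ?_ (by positivity))
    rw [← Real.exp_nat_mul, Real.exp_le_exp]
    nlinarith

theorem IsMarkovJump.integrable_nu1Integrand (hX : p.IsMarkovJump P Pr) (hP : IsTransitionFamily m.Q P)
    (hN : p.IsCoxCounting m.β Pr) (h1 : m.A1) (h2 : m.A2) (h3 : m.A3) (h4 : m.A4) (h5 : m.A5) (t : ℝ≥0) (x : S) :
    Integrable (p.nu1Integrand m P Pr t x) leb := by
  obtain ⟨D, κ, ρ, hκ, -, -, h, -⟩ := hX.exists_nu_bounds hP hN h1 h2 h3 h4 h5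
  exact ((integrable_exp_neg_mul_leb hκ).const_mul D).mono'
    (hX.measurable_nu1Integrand hP h1 h2 h3 t x).aestronglyMeasurable (ae_of_all _ (h t x))

theorem IsMarkovJump.summable_nu2Term_schedEquiv (hX : p.IsMarkovJump P Pr) (hP : IsTransitionFamily m.Q P)
    (hN : p.IsCoxCounting m.β Pr) (h1 : m.A1) (h2 : m.A2) (h3 : m.A3) (h4 : m.A4) (h5 : m.A5) (t : ℝ≥0) (x : S) :
    Summable fun k => p.nu2Term m P Pr t x (m.schedEquiv t k) := by
  obtain ⟨D, κ, ρ, hκ, hρ, hρ1, -, h⟩ := hX.exists_nu_bounds hP hN h1 h2 h3 h4 h5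
  exact Summable.of_norm_bounded ((summable_geometric_of_lt_one hρ hρ1).mul_left D) (h t x)

theorem nu2_eq_tsum (t : ℝ≥0) (x : S) :
    p.nu2 m P Pr t x = ∑' k, p.nu2Term m P Pr t x (m.schedEquiv t k) :=
  ((m.schedEquiv t).tsum_eq _).symm

theorem IsMarkovJump.bddAbove_abs_nu (hX : p.IsMarkovJump P Pr) (hP : IsTransitionFamily m.Q P)
    (hN : p.IsCoxCounting m.β Pr) (h1 : m.A1) (h2 : m.A2) (h3 : m.A3) (h4 : m.A4) (h5 : m.A5) :
    BddAbove (Set.range fun q : ℝ≥0 × S => |p.nu m P Pr q.1 q.2|) := by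
  obtain ⟨D, κ, ρ, hκ, hρ, hρ1, h, h'⟩ := hX.exists_nu_bounds hP hN h1 h2 h3 h4 h5
  refine ⟨(∫ u : ℝ≥0, D * Real.exp (-κ * u) ∂leb) + ∑' k, D * ρ ^ k, ?_⟩
  rintro _ ⟨⟨t, x⟩, rfl⟩
  refine (abs_add_le _ _).trans (add_le_add ?_ ?_)
  · rw [← Real.norm_eq_abs]
    exact norm_integral_le_of_norm_le ((integrable_exp_neg_mul_leb hκ).const_mul D) (ae_of_all _ (h t x))
  · rw [nu2_eq_tsum, ← Real.norm_eq_abs]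
    exact tsum_of_norm_bounded ((summable_geometric_of_lt_one hρ hρ1).mul_left D).hasSum (h' t x)

end RewardProcess

end Nu

/-! ### The compensator of the cumulative reward -/

section Increments

open scoped ENNReal

/-- Equality of integrals over all sets of `𝓗` of a non-negative random variable and a bounded one. -/
theorem integrable_and_setIntegral_eq {Ω : Type*} [MeasurableSpace Ω] {μ : Measure Ω} [IsFiniteMeasure μ]
    {Z W : Ω → ℝ} (hZm : Measurable Z) (hZ : ∀ᵐ ω ∂μ, 0 ≤ Z ω) (hW : Integrable W μ) (hW0 : ∀ ω, 0 ≤ W ω)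
    {𝓗 : MeasurableSpace Ω}
    (h : ∀ A, MeasurableSet[𝓗] A → ∫⁻ ω in A, ENNReal.ofReal (Z ω) ∂μ = ∫⁻ ω in A, ENNReal.ofReal (W ω) ∂μ) :
    Integrable Z μ ∧ ∀ A, MeasurableSet[𝓗] A → ∫ ω in A, Z ω ∂μ = ∫ ω in A, W ω ∂μ := by
  have h1 := h Set.univ (@MeasurableSet.univ _ 𝓗)
  rw [Measure.restrict_univ] at h1
  refine ⟨⟨hZm.aestronglyMeasurable, (hasFiniteIntegral_iff_ofReal hZ).2 ?_⟩, fun A hA => ?_⟩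
  · rw [h1]
    exact (hasFiniteIntegral_iff_ofReal (ae_of_all _ hW0)).1 hW.2
  · rw [integral_eq_lintegral_of_nonneg_ae (ae_restrict_of_ae hZ) hZm.aestronglyMeasurable,
      integral_eq_lintegral_of_nonneg_ae (ae_of_all _ hW0) hW.1.restrict, h A hA]

namespace RewardModel

variable {S : Type*} [Fintype S] [DecidableEq S] {m : RewardModel S}

theorem exists_abs_rate_bound (h2 : m.A2) (h3 : m.A3) (h4 : m.A4) : ∃ C : ℝ, ∀ u x,
    |m.r u x| ≤ C ∧ |m.gamma1 u x| ≤ C ∧ |m.gamma2 u x| ≤ C := by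
  obtain ⟨C, hC0, hC⟩ := exists_rate_bound h2 h3 h4
  refine ⟨C, fun u x => ⟨?_, ?_, ?_⟩⟩
  · rw [abs_of_nonneg (h4.r_nonneg u x)]; exact (hC u x).1
  · rw [abs_of_nonneg (h2.gamma1_nonneg u x)]; exact (hC u x).2.1
  · rw [abs_of_nonneg (h4.gamma2_nonneg u x)]; exact (hC u x).2.2.1

end RewardModel

namespace RewardProcess

variable {S Ω : Type*} [Fintype S] [DecidableEq S] [MeasurableSpace S] [MeasurableSingletonClass S]
variable [MeasurableSpace Ω] {p : RewardProcess Ω S} {m : RewardModel S} {Pr : Measure Ω} [IsProbabilityMeasure Pr]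
  {P : ℝ≥0 → ℝ≥0 → Matrix S S ℝ} {s t : ℝ≥0}

theorem IsMarkovJump.integrable_path (hX : p.IsMarkovJump P Pr) {f : ℝ≥0 → S → ℝ}
    (hf : ∀ x, Measurable fun u => f u x) {C : ℝ} (hC : ∀ u x, |f u x| ≤ C) (s t : ℝ≥0) (ω : Ω) :
    IntegrableOn (fun u => f u (p.X u ω)) (Set.Ioc s t) leb := by
  have hf' : Measurable fun q : ℝ≥0 × S => f q.1 q.2 := measurable_from_prod_countable_left hf
  exact integrableOn_leb_Ioc_of_bound
    (hf'.comp (measurable_id.prodMk (hX.measurable_uncurry.comp (measurable_id.prodMk measurable_const))))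
    (C := C) fun u => hC _ _

theorem IsMarkovJump.integrable_setIntegral_path (hX : p.IsMarkovJump P Pr) {f : ℝ≥0 → S → ℝ}
    (hf : ∀ x, Measurable fun u => f u x) {C : ℝ} (hC : ∀ u x, |f u x| ≤ C) (s t : ℝ≥0) :
    Integrable (fun ω => ∫ u in Set.Ioc s t, f u (p.X u ω) ∂leb) Pr := by
  refine Integrable.of_bound (C := C * (leb.real (Set.Ioc s t)))
    (measurable_setIntegral_path hX.measurable (fun ω => (hX.isJumpPath ω).right_cont) hf s t).aestronglyMeasurable
    (ae_of_all _ fun ω => ?_)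
  exact norm_setIntegral_le_of_norm_le_const (leb_Ioc_lt_top s t) fun u _ => hC _ _

theorem IsMarkovJump.setIntegral_setIntegral_path (hX : p.IsMarkovJump P Pr) {f : ℝ≥0 → S → ℝ}
    (hf : ∀ x, Measurable fun u => f u x) {C : ℝ} (hC : ∀ u x, |f u x| ≤ C) (s t : ℝ≥0) (A : Set Ω) :
    ∫ ω in A, ∫ u in Set.Ioc s t, f u (p.X u ω) ∂leb ∂Pr
      = ∫ u in Set.Ioc s t, ∫ ω in A, f u (p.X u ω) ∂Pr ∂leb := by
  have hf' : Measurable fun q : ℝ≥0 × S => f q.1 q.2 := measurable_from_prod_countable_left hf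
  have hm : Measurable fun q : Ω × ℝ≥0 => f q.2 (p.X q.2 q.1) :=
    (hf'.comp (measurable_fst.prodMk hX.measurable_uncurry)).comp measurable_swap
  exact integral_integral_swap (Integrable.of_bound hm.aestronglyMeasurable C (ae_of_all _ fun q => hC _ _))

theorem IsMarkovJump.lintegral_ofReal_path (hX : p.IsMarkovJump P Pr) {f : ℝ≥0 → S → ℝ}
    (hf : ∀ x, Measurable fun u => f u x) {C : ℝ} (hC : ∀ u x, |f u x| ≤ C) (hf0 : ∀ u x, 0 ≤ f u x)
    (s t : ℝ≥0) (ω : Ω) :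
    ∫⁻ u in Set.Ioc s t, ENNReal.ofReal (f u (p.X u ω)) ∂leb
      = ENNReal.ofReal (∫ u in Set.Ioc s t, f u (p.X u ω) ∂leb) :=
  (ofReal_integral_eq_lintegral_ofReal (hX.integrable_path hf hC s t ω) (ae_of_all _ fun _ => hf0 _ _)).symm

theorem HasLumpLaws.ae_reward_nonneg (hL : p.HasLumpLaws m Pr) (hX : p.IsMarkovJump P Pr)
    (hN : p.IsCoxCounting m.β Pr) (h4 : m.A4) {a b c : ℕ} {l : ℕ ⊕ ℕ ⊕ ℕ} (hl : l ∈ rewardIdx a b c) :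
    ∀ᵐ ω ∂Pr, ω ∈ p.atLeast a c → 0 ≤ p.reward l ω := by
  obtain ⟨C, -, hG, hH, hK⟩ := RewardModel.exists_lump_bound h4
  have hC : ∀ l ω, p.rewardLaw m l ω (Set.Iic C) = 1 := by
    rintro (j | i | k) ω
    exacts [hG _ _ _, hH _ _, hK _ _]
  exact (hL.hasCondLaw hX hN a b c).ae_nonneg (hX.sigmaXN_le hN) hL.measurable_reward
    (hX.measurableSet_atLeast hN a c) hC (rewardLaw_Iio_zero h4) hl

theorem HasLumpLaws.ae_jumpReward_nonneg (hL : p.HasLumpLaws m Pr) (hX : p.IsMarkovJump P Pr)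
    (hN : p.IsCoxCounting m.β Pr) (h4 : m.A4) :
    ∀ᵐ ω ∂Pr, ∀ j, 0 < j → ∀ t, j ≤ p.J t ω → 0 ≤ p.jumpReward j ω := by
  refine ae_all_iff.2 fun j => ?_
  rcases Nat.eq_zero_or_pos j with rfl | hj
  · exact ae_of_all _ fun _ h => absurd h (lt_irrefl _)
  · obtain ⟨j, rfl⟩ := Nat.exists_eq_succ_of_ne_zero hj.ne'
    filter_upwards [hL.ae_reward_nonneg hX hN h4 (inl_mem_rewardIdx.2 (Nat.lt_succ_self j) :
      Sum.inl j ∈ rewardIdx (j + 1) 0 0)] with ω hω _ t ht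
    exact hω ⟨⟨t, ht⟩, ⟨0, Nat.zero_le _⟩⟩

theorem HasLumpLaws.ae_extReward_nonneg (hL : p.HasLumpLaws m Pr) (hX : p.IsMarkovJump P Pr)
    (hN : p.IsCoxCounting m.β Pr) (h4 : m.A4) :
    ∀ᵐ ω ∂Pr, ∀ k, 0 < k → ∀ t, k ≤ p.N t ω → 0 ≤ p.extReward k ω := by
  refine ae_all_iff.2 fun j => ?_
  rcases Nat.eq_zero_or_pos j with rfl | hj
  · exact ae_of_all _ fun _ h => absurd h (lt_irrefl _)
  · obtain ⟨j, rfl⟩ := Nat.exists_eq_succ_of_ne_zero hj.ne'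
    filter_upwards [hL.ae_reward_nonneg hX hN h4 (inr_inr_mem_rewardIdx.2 (Nat.lt_succ_self j) :
      Sum.inr (Sum.inr j) ∈ rewardIdx 0 0 (j + 1))] with ω hω _ t ht
    exact hω ⟨⟨0, Nat.zero_le _⟩, ⟨t, ht⟩⟩

theorem HasLumpLaws.ae_schedReward_nonneg (hL : p.HasLumpLaws m Pr) (hX : p.IsMarkovJump P Pr)
    (hN : p.IsCoxCounting m.β Pr) (h4 : m.A4) {i : ℕ} (hi : 0 < i) : ∀ᵐ ω ∂Pr, 0 ≤ p.schedReward i ω := by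
  obtain ⟨i, rfl⟩ := Nat.exists_eq_succ_of_ne_zero hi.ne'
  filter_upwards [hL.ae_reward_nonneg hX hN h4 (inr_inl_mem_rewardIdx.2 (Nat.lt_succ_self i) :
    Sum.inr (Sum.inl i) ∈ rewardIdx 0 (i + 1) 0)] with ω hω
  exact hω ⟨⟨0, Nat.zero_le _⟩, ⟨0, Nat.zero_le _⟩⟩

theorem jumpSum_sub {ω : Ω} (h : p.J s ω ≤ p.J t ω) :
    p.jumpSum t ω - p.jumpSum s ω = ∑ j ∈ Finset.Ioc (p.J s ω) (p.J t ω), p.jumpReward j ω :=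
  sub_eq_of_eq_add' (Finset.sum_Ioc_consecutive (fun j => p.jumpReward j ω) (Nat.zero_le _) h).symm

theorem extSum_sub {ω : Ω} (h : p.N s ω ≤ p.N t ω) :
    p.extSum t ω - p.extSum s ω = ∑ j ∈ Finset.Ioc (p.N s ω) (p.N t ω), p.extReward j ω :=
  sub_eq_of_eq_add' (Finset.sum_Ioc_consecutive (fun j => p.extReward j ω) (Nat.zero_le _) h).symm

theorem schedSum_sub (hst : s ≤ t) (ω : Ω) :
    p.schedSum m t ω - p.schedSum m s ω
      = ∑ i ∈ Finset.Ioc (m.numScheduled s) (m.numScheduled t), p.schedReward i ω :=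
  sub_eq_of_eq_add' (Finset.sum_Ioc_consecutive (fun j => p.schedReward j ω) (Nat.zero_le _)
    (m.tau_le_iff.1 ((m.tau_le_iff.2 le_rfl).trans hst))).symm

/-- The path integral has finite mean, which is what the passage from cells to the history requires;
`Z` may then be any non-negative function. -/
theorem HasLumpLaws.setLIntegral_history_path (hL : p.HasLumpLaws m Pr) (hX : p.IsMarkovJump P Pr)
    (hN : p.IsCoxCounting m.β Pr) {f : ℝ≥0 → S → ℝ}
    (hf : ∀ x, Measurable fun u => f u x) {C : ℝ} (hC : ∀ u x, |f u x| ≤ C) (hf0 : ∀ u x, 0 ≤ f u x)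
    {Z : Ω → ℝ≥0∞} (h : ∀ (a c : ℕ) (E : Set Ω) (u : ℕ ⊕ ℕ ⊕ ℕ → ℝ), MeasurableSet[p.sigmaXNUpTo s] E →
      ∫⁻ ω in p.cell m s a c E u, Z ω ∂Pr
        = ∫⁻ ω in p.cell m s a c E u, ∫⁻ v in Set.Ioc s t, ENNReal.ofReal (f v (p.X v ω)) ∂leb ∂Pr)
    {A : Set Ω} (hA : MeasurableSet[p.history m s] A) :
    ∫⁻ ω in A, Z ω ∂Pr = ∫⁻ ω in A, ENNReal.ofReal (∫ u in Set.Ioc s t, f u (p.X u ω) ∂leb) ∂Pr := by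
  simp only [hX.lintegral_ofReal_path hf hC hf0] at h
  refine (hL.setLIntegral_history_congr hX hN ?_ (fun a c E u hE => (h a c E u hE).symm) hA).symm
  exact ((hasFiniteIntegral_iff_ofReal (ae_of_all _ fun ω => integral_nonneg fun u => hf0 _ _)).1
    (hX.integrable_setIntegral_path hf hC s t).2).ne

/-- Rewards of jumps that occur are almost surely non-negative, so the argument runs in `ℝ≥0∞` and
integrability comes out as a consequence. -/
theorem HasLumpLaws.jumpSum_increment (hL : p.HasLumpLaws m Pr) (hX : p.IsMarkovJump P Pr)
    (hP : IsTransitionFamily m.Q P) (hN : p.IsCoxCounting m.β Pr) (h1 : m.A1) (h2 : m.A2) (h3 : m.A3) (h4 : m.A4)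
    (hst : s ≤ t) :
    Integrable (fun ω => p.jumpSum t ω - p.jumpSum s ω) Pr ∧ ∀ A, MeasurableSet[p.history m s] A →
      ∫ ω in A, (p.jumpSum t ω - p.jumpSum s ω) ∂Pr
        = ∫ ω in A, ∫ u in Set.Ioc s t, m.gamma1 u (p.X u ω) ∂leb ∂Pr := by
  obtain ⟨C, hC⟩ := RewardModel.exists_abs_rate_bound h2 h3 h4
  have hJ : ∀ ω, p.J s ω ≤ p.J t ω := fun ω => (hX.isJumpPath ω).isCountingPath_jumpCount.mono hst
  simp only [fun ω => jumpSum_sub (hJ ω)]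
  have h0 := hL.ae_jumpReward_nonneg hX hN h4
  have h0' : ∀ᵐ ω ∂Pr, ∀ j ∈ Finset.Ioc (p.J s ω) (p.J t ω), 0 ≤ p.jumpReward j ω := by
    filter_upwards [h0] with ω hω j hj
    exact hω j (Nat.zero_lt_of_lt (Finset.mem_Ioc.1 hj).1) t (Finset.mem_Ioc.1 hj).2
  refine integrable_and_setIntegral_eq
    (measurable_sum_Ioc (hX.measurable_jumpCount s) (hX.measurable_jumpCount t) hL.measurable_jump)
    (h0'.mono fun ω hω => Finset.sum_nonneg hω)
    (hX.integrable_setIntegral_path h1.measurable_gamma1 (fun u x => (hC u x).2.1) s t)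
    (fun ω => integral_nonneg fun u => h2.gamma1_nonneg _ _) fun A hA => ?_
  rw [← hL.setLIntegral_history_path hX hN h1.measurable_gamma1 (fun u x => (hC u x).2.1) h2.gamma1_nonneg
    (fun a c E u hE => hL.setLIntegral_cell_jumps hX hP hN h1 h2 h3 h4 a c hE u) hA]
  refine lintegral_congr_ae (ae_restrict_of_ae ?_)
  filter_upwards [h0'] with ω hω
  exact ENNReal.ofReal_sum_of_nonneg hω

theorem HasLumpLaws.extSum_increment (hL : p.HasLumpLaws m Pr) (hX : p.IsMarkovJump P Pr)
    (hP : IsTransitionFamily m.Q P) (hN : p.IsCoxCounting m.β Pr) (h1 : m.A1) (h2 : m.A2) (h3 : m.A3) (h4 : m.A4)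
    (hst : s ≤ t) :
    Integrable (fun ω => p.extSum t ω - p.extSum s ω) Pr ∧ ∀ A, MeasurableSet[p.history m s] A →
      ∫ ω in A, (p.extSum t ω - p.extSum s ω) ∂Pr
        = ∫ ω in A, ∫ u in Set.Ioc s t, m.gamma2 u (p.X u ω) ∂leb ∂Pr := by
  obtain ⟨C, hC⟩ := RewardModel.exists_abs_rate_bound h2 h3 h4
  simp only [fun ω => extSum_sub (hN.mono ω hst)]
  have h0 := hL.ae_extReward_nonneg hX hN h4
  have h0' : ∀ᵐ ω ∂Pr, ∀ j ∈ Finset.Ioc (p.N s ω) (p.N t ω), 0 ≤ p.extReward j ω := by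
    filter_upwards [h0] with ω hω j hj
    exact hω j (Nat.zero_lt_of_lt (Finset.mem_Ioc.1 hj).1) t (Finset.mem_Ioc.1 hj).2
  refine integrable_and_setIntegral_eq
    (measurable_sum_Ioc (hN.measurable s) (hN.measurable t) hL.measurable_ext)
    (h0'.mono fun ω hω => Finset.sum_nonneg hω)
    (hX.integrable_setIntegral_path h1.measurable_gamma2 (fun u x => (hC u x).2.2) s t)
    (fun ω => integral_nonneg fun u => h4.gamma2_nonneg _ _) fun A hA => ?_
  rw [← hL.setLIntegral_history_path hX hN h1.measurable_gamma2 (fun u x => (hC u x).2.2) h4.gamma2_nonneg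
    (fun a c E u hE => hL.setLIntegral_cell_points hX hP hN h1 h2 h3 h4 a c hE u) hA]
  refine lintegral_congr_ae (ae_restrict_of_ae ?_)
  filter_upwards [h0'] with ω hω
  exact ENNReal.ofReal_sum_of_nonneg hω

theorem IsMarkovJump.integrable_comp_X (hX : p.IsMarkovJump P Pr) (u : ℝ≥0) (f : S → ℝ) :
    Integrable (fun ω => f (p.X u ω)) Pr :=
  Integrable.of_bound ((measurable_of_finite f).comp (hX.measurable u)).aestronglyMeasurable (∑ x, ‖f x‖)
    (ae_of_all _ fun ω => Finset.single_le_sum (f := fun x => ‖f x‖) (fun _ _ => norm_nonneg _)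
      (Finset.mem_univ (p.X u ω)))

theorem HasLumpLaws.schedReward_mean (hL : p.HasLumpLaws m Pr) (hX : p.IsMarkovJump P Pr)
    (hN : p.IsCoxCounting m.β Pr) (h1 : m.A1) (h4 : m.A4) {i : ℕ} (hi : m.numScheduled s < i) :
    Integrable (p.schedReward i) Pr ∧ ∀ A, MeasurableSet[p.history m s] A →
      ∫ ω in A, p.schedReward i ω ∂Pr = ∫ ω in A, m.h (m.τ i) (p.X (m.τ i) ω) ∂Pr := by
  have hint := hX.integrable_comp_X (m.τ i) (m.h (m.τ i))
  refine integrable_and_setIntegral_eq (hL.measurable_sched i)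
    (hL.ae_schedReward_nonneg hX hN h4 (Nat.zero_lt_of_lt hi)) hint (fun ω => m.h_nonneg _ _) fun A hA => ?_
  refine (hL.setLIntegral_history_congr hX hN ?_
    (fun a c E u hE => (hL.setLIntegral_cell_sched hX hN h1 h4 a c hE u hi).symm) hA).symm
  exact ((hasFiniteIntegral_iff_ofReal (ae_of_all _ fun ω => m.h_nonneg _ _)).1 hint.2).ne

/-- The mean of the reward collected in `(s, t]` on an event of the history up to time `s`. -/
theorem HasLumpLaws.R_increment (hL : p.HasLumpLaws m Pr) (hX : p.IsMarkovJump P Pr)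
    (hP : IsTransitionFamily m.Q P) (hN : p.IsCoxCounting m.β Pr) (h1 : m.A1) (h2 : m.A2) (h3 : m.A3) (h4 : m.A4)
    (hst : s ≤ t) :
    Integrable (fun ω => p.R m t ω - p.R m s ω) Pr ∧ ∀ A, MeasurableSet[p.history m s] A →
      ∫ ω in A, (p.R m t ω - p.R m s ω) ∂Pr
        = (∫ u in Set.Ioc s t, ∫ ω in A, m.rTilde u (p.X u ω) ∂Pr ∂leb)
          + ∑ i ∈ Finset.Ioc (m.numScheduled s) (m.numScheduled t), ∫ ω in A, m.h (m.τ i) (p.X (m.τ i) ω) ∂Pr := by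
  obtain ⟨C, hC⟩ := RewardModel.exists_abs_rate_bound h2 h3 h4
  obtain ⟨C', hC'⟩ := RewardModel.exists_osc_bound h2 h3 h4
  have hR : ∀ ω, p.R m t ω - p.R m s ω = (∫ u in Set.Ioc s t, m.r u (p.X u ω) ∂leb)
      + (p.jumpSum t ω - p.jumpSum s ω)
      + (∑ i ∈ Finset.Ioc (m.numScheduled s) (m.numScheduled t), p.schedReward i ω)
      + (p.extSum t ω - p.extSum s ω) := by
    intro ω
    have h := setIntegral_leb_Ioc_add zero_le hst (hX.integrable_path h1.r (fun u x => (hC u x).1) 0 t ω)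
    rw [← schedSum_sub hst, R, R, h]
    ring
  have hi1 := hX.integrable_setIntegral_path h1.r (fun u x => (hC u x).1) s t
  obtain ⟨hi2, he2⟩ := hL.jumpSum_increment hX hP hN h1 h2 h3 h4 hst
  obtain ⟨hi4, he4⟩ := hL.extSum_increment hX hP hN h1 h2 h3 h4 hst
  have hi3' : ∀ i ∈ Finset.Ioc (m.numScheduled s) (m.numScheduled t), Integrable (p.schedReward i) Pr := fun i hi =>
    (hL.schedReward_mean hX hN h1 h4 (Finset.mem_Ioc.1 hi).1).1
  have hi3 : Integrable (fun ω => ∑ i ∈ Finset.Ioc (m.numScheduled s) (m.numScheduled t), p.schedReward i ω) Pr :=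
    integrable_finsetSum _ hi3'
  simp only [hR]
  refine ⟨((hi1.add hi2).add hi3).add hi4, fun A hA => ?_⟩
  have hg1 := hX.integrable_setIntegral_path h1.measurable_gamma1 (fun u x => (hC u x).2.1) s t
  have hg2 := hX.integrable_setIntegral_path h1.measurable_gamma2 (fun u x => (hC u x).2.2) s t
  -- The densities of continuous accrual, of jump rewards and of external rewards add up to `r̃`.
  have hsum : ∀ ω, ∫ u in Set.Ioc s t, m.rTilde u (p.X u ω) ∂leb
      = (∫ u in Set.Ioc s t, m.r u (p.X u ω) ∂leb) + ((∫ u in Set.Ioc s t, m.gamma1 u (p.X u ω) ∂leb)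
        + ∫ u in Set.Ioc s t, m.gamma2 u (p.X u ω) ∂leb) := by
    intro ω
    have e1 := hX.integrable_path h1.r (fun u x => (hC u x).1) s t ω
    have e2 := hX.integrable_path h1.measurable_gamma1 (fun u x => (hC u x).2.1) s t ω
    have e3 := hX.integrable_path h1.measurable_gamma2 (fun u x => (hC u x).2.2) s t ω
    have e23 : IntegrableOn (fun u => m.gamma1 u (p.X u ω) + m.gamma2 u (p.X u ω)) (Set.Ioc s t) leb := e2.add e3
    rw [← integral_add e2 e3, ← integral_add e1 e23]
    rfl
  rw [← hX.setIntegral_setIntegral_path h1.measurable_rTilde (fun u x => (hC' u x).1)]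
  simp only [hsum]
  have hi12 : Integrable (fun ω => (∫ u in Set.Ioc s t, m.r u (p.X u ω) ∂leb)
      + (p.jumpSum t ω - p.jumpSum s ω)) Pr := hi1.add hi2
  have hi123 : Integrable (fun ω => (∫ u in Set.Ioc s t, m.r u (p.X u ω) ∂leb)
      + (p.jumpSum t ω - p.jumpSum s ω)
      + ∑ i ∈ Finset.Ioc (m.numScheduled s) (m.numScheduled t), p.schedReward i ω) Pr := hi12.add hi3
  have hg12 : Integrable (fun ω => (∫ u in Set.Ioc s t, m.gamma1 u (p.X u ω) ∂leb)
      + ∫ u in Set.Ioc s t, m.gamma2 u (p.X u ω) ∂leb) Pr := hg1.add hg2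
  rw [integral_add hi123.integrableOn hi4.integrableOn,
    integral_add hi12.integrableOn hi3.integrableOn, integral_add hi1.integrableOn hi2.integrableOn,
    integral_add hi1.integrableOn hg12.integrableOn, integral_add hg1.integrableOn hg2.integrableOn,
    he2 A hA, he4 A hA, integral_finsetSum _ fun i hi => (hi3' i hi).integrableOn,
    Finset.sum_congr rfl fun i hi => (hL.schedReward_mean hX hN h1 h4 (Finset.mem_Ioc.1 hi).1).2 A hA]
  ring

end RewardProcess

end Increments

/-! ### The martingale property -/

section MartingaleProof

open scoped ENNReal

theorem leb_singleton (a : ℝ≥0) : leb {a} = 0 := by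
  have h : ({a} : Set ℝ≥0) = ((↑) : ℝ≥0 → ℝ) ⁻¹' {(a : ℝ)} := by ext; simp
  rw [h, leb_preimage _ (measurableSet_singleton _)]
  exact measure_mono_null Set.inter_subset_left Real.volume_singleton

theorem setIntegral_leb_Ici_sub {q : ℝ≥0 → ℝ} {s t : ℝ≥0} (hst : s ≤ t) (hq : IntegrableOn q (Set.Ici s) leb) :
    (∫ u in Set.Ici s, q u ∂leb) - ∫ u in Set.Ici t, q u ∂leb = ∫ u in Set.Ioc s t, q u ∂leb := by
  have : NullSingletonClass leb := ⟨leb_singleton⟩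
  rw [integral_Ici_eq_integral_Ioi, integral_Ici_eq_integral_Ioi, ← Set.Ioc_union_Ioi_eq_Ioi hst]
  have hq' : IntegrableOn q (Set.Ioi s) leb := hq.mono_set Set.Ioi_subset_Ici_self
  rw [setIntegral_union (Set.Ioc_disjoint_Ioi le_rfl) measurableSet_Ioi (hq'.mono_set Set.Ioc_subset_Ioi_self)
    (hq'.mono_set (Set.Ioi_subset_Ioi hst))]
  ring

namespace RewardProcess

variable {S Ω : Type*} [Fintype S] [DecidableEq S] [MeasurableSpace S] [MeasurableSingletonClass S]
variable [MeasurableSpace Ω] {p : RewardProcess Ω S} {m : RewardModel S} {Pr : Measure Ω} [IsProbabilityMeasure Pr]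
  {P : ℝ≥0 → ℝ≥0 → Matrix S S ℝ} {s t : ℝ≥0} {A : Set Ω}

theorem history_mono (p : RewardProcess Ω S) (m : RewardModel S) : Monotone (p.history m) :=
  fun _ _ hst => biSup_mono fun _ hv => le_trans hv hst

theorem sigmaXUpTo_le_history (t : ℝ≥0) : p.sigmaXUpTo t ≤ p.history m t :=
  iSup₂_mono fun _ _ => (le_sup_left.trans (le_sup_left.trans (le_sup_left.trans le_sup_left)))

/-- The Markov property holds on cells, hence on the history: collected rewards do not help to
predict `X`. -/
theorem HasLumpLaws.measureReal_inter_history (hL : p.HasLumpLaws m Pr) (hX : p.IsMarkovJump P Pr)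
    (hP : IsTransitionFamily m.Q P) (hN : p.IsCoxCounting m.β Pr) (h1 : m.A1) (hst : s ≤ t)
    (hA : MeasurableSet[p.history m s] A) (y : S) :
    Pr.real (A ∩ p.X t ⁻¹' {y}) = ∑ z, Pr.real (A ∩ p.X s ⁻¹' {z}) * P s t z y := by
  have hy := hX.measurable t (measurableSet_singleton y)
  have h := hL.setLIntegral_history_congr hX hN
    (by rw [lintegral_indicator_one hy]; exact measure_ne_top _ _)
    (fun a c E u hE => hL.setLIntegral_cell_markov hX hN h1 a c hE u hst y) hA
  rw [lintegral_indicator_one hy, Measure.restrict_apply hy, Set.inter_comm] at h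
  have h5 := ofReal_integral_eq_lintegral_ofReal (hX.integrable_comp_X s fun x => P s t x y).integrableOn
    (ae_of_all (Pr.restrict A) fun ω => hP.nonneg hst (p.X s ω) y)
  rw [Measure.real, h, ← h5, ENNReal.toReal_ofReal (integral_nonneg fun ω => hP.nonneg hst _ _),
    hX.setIntegral_comp_X s fun x => P s t x y]
  exact Finset.sum_congr rfl fun z _ => mul_comm _ _

/-- The Markov property with respect to the history. -/
theorem HasLumpLaws.setIntegral_comp_X_eq_condMean (hL : p.HasLumpLaws m Pr) (hX : p.IsMarkovJump P Pr)
    (hP : IsTransitionFamily m.Q P) (hN : p.IsCoxCounting m.β Pr) (h1 : m.A1) (hst : s ≤ t)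
    (hA : MeasurableSet[p.history m s] A) (f : S → ℝ) :
    ∫ ω in A, f (p.X t ω) ∂Pr = ∑ z, condMean P s z t f * Pr.real (A ∩ p.X s ⁻¹' {z}) := by
  rw [hX.setIntegral_comp_X]
  simp only [hL.measureReal_inter_history hX hP hN h1 hst hA, condMean, Finset.mul_sum, Finset.sum_mul]
  rw [Finset.sum_comm]
  exact Finset.sum_congr rfl fun z _ => Finset.sum_congr rfl fun y _ => by ring

/-- Integration over an event of the history undoes the conditional means in `ν₁`, and the shift by
`t` leaves the integral over `[t, ∞)` of a function of `u` that no longer involves `t`. Values at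
two times therefore differ by the integral over the interval between them. -/
theorem HasLumpLaws.setIntegral_nu1 (hL : p.HasLumpLaws m Pr) (hX : p.IsMarkovJump P Pr)
    (hP : IsTransitionFamily m.Q P) (hN : p.IsCoxCounting m.β Pr) (h1 : m.A1) (h2 : m.A2) (h3 : m.A3) (h4 : m.A4)
    (h5 : m.A5) (hA : MeasurableSet[p.history m t] A) :
    IntegrableOn (fun u => ∫ ω in A, p.rTildeC m Pr u (p.X u ω) ∂Pr) (Set.Ici t) leb ∧
      ∫ ω in A, p.nu1 m P Pr t (p.X t ω) ∂Pr
        = ∫ u in Set.Ici t, ∫ ω in A, p.rTildeC m Pr u (p.X u ω) ∂Pr ∂leb := by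
  set q : ℝ≥0 → ℝ := fun u => ∫ ω in A, p.rTildeC m Pr u (p.X u ω) ∂Pr with hq
  have hqm : Measurable q := by
    simp only [hq, fun u => hX.setIntegral_comp_X u (p.rTildeC m Pr u) A]
    exact Finset.measurable_fun_sum _ fun z _ => (hX.measurable_rTildeC h1 z).mul (hX.measurable_measureReal_inter A z)
  have hqe : ∀ u, q (t + u) = ∑ z, p.nu1Integrand m P Pr t z u * Pr.real (A ∩ p.X t ⁻¹' {z}) := fun u =>
    hL.setIntegral_comp_X_eq_condMean hX hP hN h1 le_self_add hA _
  have hint := fun z => (hX.integrable_nu1Integrand hP hN h1 h2 h3 h4 h5 t z).mul_const (Pr.real (A ∩ p.X t ⁻¹' {z}))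
  have hadd : Measurable fun u : ℝ≥0 => t + u := measurable_const_add t
  rw [IntegrableOn, ← map_add_leb, integrable_map_measure hqm.aestronglyMeasurable hadd.aemeasurable,
    integral_map hadd.aemeasurable hqm.aestronglyMeasurable]
  simp only [Function.comp_def, hqe]
  refine ⟨integrable_finsetSum _ fun z _ => hint z, ?_⟩
  rw [hX.setIntegral_comp_X t (p.nu1 m P Pr t), integral_finsetSum _ fun z _ => hint z]
  exact Finset.sum_congr rfl fun z _ => (integral_mul_const _ _).symm

/-- The discrete counterpart: the tail, from index `n(t) + 1` on, of a sequence that does not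
involve `t`. -/
theorem HasLumpLaws.setIntegral_nu2 (hL : p.HasLumpLaws m Pr) (hX : p.IsMarkovJump P Pr)
    (hP : IsTransitionFamily m.Q P) (hN : p.IsCoxCounting m.β Pr) (h1 : m.A1) (h2 : m.A2) (h3 : m.A3) (h4 : m.A4)
    (h5 : m.A5) (hA : MeasurableSet[p.history m t] A) :
    Summable (fun k => ∫ ω in A, p.hC m Pr (m.τ (k + (m.numScheduled t + 1))) (p.X (m.τ (k + (m.numScheduled t + 1))) ω) ∂Pr) ∧
      ∫ ω in A, p.nu2 m P Pr t (p.X t ω) ∂Pr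
        = ∑' k, ∫ ω in A, p.hC m Pr (m.τ (k + (m.numScheduled t + 1))) (p.X (m.τ (k + (m.numScheduled t + 1))) ω) ∂Pr := by
  have he : ∀ k, ∫ ω in A, p.hC m Pr (m.τ (k + (m.numScheduled t + 1))) (p.X (m.τ (k + (m.numScheduled t + 1))) ω) ∂Pr
      = ∑ z, p.nu2Term m P Pr t z (m.schedEquiv t k) * Pr.real (A ∩ p.X t ⁻¹' {z}) := fun k =>
    hL.setIntegral_comp_X_eq_condMean hX hP hN h1 (m.schedEquiv t k).2.le hA _
  have hs := fun z => (hX.summable_nu2Term_schedEquiv hP hN h1 h2 h3 h4 h5 t z).mul_right (Pr.real (A ∩ p.X t ⁻¹' {z}))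
  simp only [he]
  refine ⟨summable_sum fun z _ => hs z, ?_⟩
  rw [hX.setIntegral_comp_X t (p.nu2 m P Pr t), Summable.tsum_finsetSum fun z _ => hs z]
  exact Finset.sum_congr rfl fun z _ => by rw [nu2_eq_tsum, tsum_mul_right]

theorem HasLumpLaws.setIntegral_nu_sub (hL : p.HasLumpLaws m Pr) (hX : p.IsMarkovJump P Pr)
    (hP : IsTransitionFamily m.Q P) (hN : p.IsCoxCounting m.β Pr) (h1 : m.A1) (h2 : m.A2) (h3 : m.A3) (h4 : m.A4)
    (h5 : m.A5) (hst : s ≤ t) (hA : MeasurableSet[p.history m s] A) :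
    (∫ ω in A, p.nu m P Pr s (p.X s ω) ∂Pr) - ∫ ω in A, p.nu m P Pr t (p.X t ω) ∂Pr
      = (∫ u in Set.Ioc s t, ∫ ω in A, p.rTildeC m Pr u (p.X u ω) ∂Pr ∂leb)
        + ∑ i ∈ Finset.Ioc (m.numScheduled s) (m.numScheduled t), ∫ ω in A, p.hC m Pr (m.τ i) (p.X (m.τ i) ω) ∂Pr := by
  -- `A` lies in the history at both times, so both tail representations apply and the tails after
  -- `t` cancel.
  have hA' := history_mono p m hst A hA
  have hsplit : ∀ u, ∫ ω in A, p.nu m P Pr u (p.X u ω) ∂Pr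
      = (∫ ω in A, p.nu1 m P Pr u (p.X u ω) ∂Pr) + ∫ ω in A, p.nu2 m P Pr u (p.X u ω) ∂Pr := fun u =>
    integral_add (hX.integrable_comp_X u (p.nu1 m P Pr u)).integrableOn
      (hX.integrable_comp_X u (p.nu2 m P Pr u)).integrableOn
  obtain ⟨hi, he⟩ := hL.setIntegral_nu1 hX hP hN h1 h2 h3 h4 h5 hA
  obtain ⟨hsum, hes⟩ := hL.setIntegral_nu2 hX hP hN h1 h2 h3 h4 h5 hA
  rw [hsplit, hsplit, he, (hL.setIntegral_nu1 hX hP hN h1 h2 h3 h4 h5 hA').2, hes,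
    (hL.setIntegral_nu2 hX hP hN h1 h2 h3 h4 h5 hA').2, ← setIntegral_leb_Ici_sub hst hi]
  obtain ⟨d, hd⟩ := Nat.exists_eq_add_of_le (m.tau_le_iff.1 ((m.tau_le_iff.2 (le_refl (m.numScheduled s))).trans hst))
  set w : ℕ → ℝ := fun i => ∫ ω in A, p.hC m Pr (m.τ i) (p.X (m.τ i) ω) ∂Pr with hw
  have h6 := hsum.sum_add_tsum_nat_add d
  have h7 : ∑ i ∈ Finset.Ioc (m.numScheduled s) (m.numScheduled t), w i
      = ∑ k ∈ Finset.range d, w (k + (m.numScheduled s + 1)) := by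
    rw [← Finset.Ico_succ_succ_eq_Ioc, Finset.sum_Ico_eq_sum_range, hd]
    refine Finset.sum_congr (congrArg _ (by simp only [Order.succ_eq_add_one]; omega)) fun k _ => congrArg w ?_
    simp only [Order.succ_eq_add_one]
    omega
  have h8 : ∀ k, k + d + (m.numScheduled s + 1) = k + (m.numScheduled t + 1) := fun k => by omega
  simp only [h8] at h6
  rw [h7, ← h6]
  ring

/-- At time `0` there is no jump and no event, and scheduled rewards begin with `t_1`. Integrability
of `R t` is thereby that of an increment. -/
theorem R_zero (p : RewardProcess Ω S) (m : RewardModel S) (hN : p.IsCoxCounting m.β Pr) (ω : Ω) : p.R m 0 ω = 0 := by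
  have h0 : m.numScheduled 0 = 0 := by
    by_contra h
    have h5 : m.τ 1 ≤ 0 := m.tau_le_iff.2 (Nat.one_le_iff_ne_zero.2 h)
    have h6 : m.τ 0 < m.τ 1 := m.τ_strictMono one_pos
    exact absurd h5 (not_le.2 (zero_le.trans_lt h6))
  have hJ : p.J 0 ω = 0 := jumpCount_zero _
  simp [R, jumpSum, schedSum, extSum, h0, hJ, hN.zero ω]

theorem HasLumpLaws.integrable_R (hL : p.HasLumpLaws m Pr) (hX : p.IsMarkovJump P Pr)
    (hP : IsTransitionFamily m.Q P) (hN : p.IsCoxCounting m.β Pr) (h1 : m.A1) (h2 : m.A2) (h3 : m.A3) (h4 : m.A4)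
    (t : ℝ≥0) : Integrable (p.R m t) Pr := by
  have h := (hL.R_increment hX hP hN h1 h2 h3 h4 (zero_le : 0 ≤ t)).1
  simpa only [R_zero p m hN, sub_zero] using h

theorem HasLumpLaws.integrable_M (hL : p.HasLumpLaws m Pr) (hX : p.IsMarkovJump P Pr)
    (hP : IsTransitionFamily m.Q P) (hN : p.IsCoxCounting m.β Pr) (h1 : m.A1) (h2 : m.A2) (h3 : m.A3) (h4 : m.A4)
    (t : ℝ≥0) : Integrable (p.M m P Pr t) Pr :=
  ((hL.integrable_R hX hP hN h1 h2 h3 h4 t).sub (integrable_const _)).add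
    (hX.integrable_comp_X t (p.nu m P Pr t))

theorem IsMarkovJump.measurable_M (hX : p.IsMarkovJump P Pr) (h1 : m.A1) (t : ℝ≥0) :
    Measurable[p.history m t] (p.M m P Pr t) := by
  have hle : ∀ {n : MeasurableSpace Ω}, n ≤ MeasurableSpace.comap (p.X t) inferInstance ⊔
      MeasurableSpace.comap (p.N t) inferInstance ⊔ MeasurableSpace.comap (p.jumpSum t) inferInstance ⊔
      MeasurableSpace.comap (p.schedSum m t) inferInstance ⊔ MeasurableSpace.comap (p.extSum t) inferInstance →
      n ≤ p.history m t := fun hn => hn.trans (le_iSup₂_of_le t (le_refl t) le_rfl)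
  have e1 : Measurable[p.history m t] fun ω => ∫ u in Set.Ioc 0 t, m.r u (p.X u ω) ∂leb :=
    (hX.measurable_setIntegral_upTo h1.r 0 le_rfl).mono (sigmaXUpTo_le_history t) le_rfl
  have e2 : Measurable[p.history m t] (p.jumpSum t) :=
    (comap_measurable (p.jumpSum t)).mono (hle (le_sup_right.trans (le_sup_left.trans le_sup_left))) le_rfl
  have e3 : Measurable[p.history m t] (p.schedSum m t) :=
    (comap_measurable (p.schedSum m t)).mono (hle (le_sup_right.trans le_sup_left)) le_rfl
  have e4 : Measurable[p.history m t] (p.extSum t) :=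
    (comap_measurable (p.extSum t)).mono (hle le_sup_right) le_rfl
  have e5 : Measurable[p.history m t] fun ω => p.nu m P Pr t (p.X t ω) :=
    (measurable_of_finite (p.nu m P Pr t)).comp ((measurable_X_sigmaXUpTo le_rfl).mono (sigmaXUpTo_le_history t) le_rfl)
  exact ((((e1.add e2).add e3).add e4).sub_const _).add e5

theorem HasLumpLaws.setIntegral_M (hL : p.HasLumpLaws m Pr) (hX : p.IsMarkovJump P Pr)
    (hP : IsTransitionFamily m.Q P) (hN : p.IsCoxCounting m.β Pr) (h1 : m.A1) (h2 : m.A2) (h3 : m.A3) (h4 : m.A4)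
    (h5 : m.A5) (hst : s ≤ t) (hA : MeasurableSet[p.history m s] A) :
    ∫ ω in A, p.M m P Pr s ω ∂Pr = ∫ ω in A, p.M m P Pr t ω ∂Pr := by
  obtain ⟨C, hC⟩ := RewardModel.exists_osc_bound h2 h3 h4
  have hM : ∀ u, ∫ ω in A, p.M m P Pr u ω ∂Pr = (∫ ω in A, p.R m u ω ∂Pr) - Pr.real A * (∫ ω, p.R m u ω ∂Pr)
      + ∫ ω in A, p.nu m P Pr u (p.X u ω) ∂Pr := by
    intro u
    have hR := hL.integrable_R hX hP hN h1 h2 h3 h4 u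
    have hR' : Integrable (fun ω => p.R m u ω - ∫ ω', p.R m u ω' ∂Pr) Pr := hR.sub (integrable_const _)
    simp only [M]
    rw [integral_add hR'.integrableOn (hX.integrable_comp_X u (p.nu m P Pr u)).integrableOn,
      integral_sub hR.integrableOn (integrable_const _), setIntegral_const, smul_eq_mul]
  have hRs := hL.integrable_R hX hP hN h1 h2 h3 h4 s
  have hRt := hL.integrable_R hX hP hN h1 h2 h3 h4 t
  obtain ⟨-, hinc⟩ := hL.R_increment hX hP hN h1 h2 h3 h4 hst
  have hi1 := hinc A hA
  -- The whole space gives the increment of the mean of `R`. Multiplied by `P(A)` and subtracted, it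
  -- leaves exactly the centred expression by which the mean of `ν` on `A` drops from `s` to `t`.
  have hi2 := hinc Set.univ (@MeasurableSet.univ _ (p.history m s))
  rw [integral_sub hRt.integrableOn hRs.integrableOn] at hi1 hi2
  rw [Measure.restrict_univ] at hi2
  have hnu := hL.setIntegral_nu_sub hX hP hN h1 h2 h3 h4 h5 hst hA
  have hcent : ∀ (u : ℝ≥0) (f : S → ℝ), ∫ ω in A, (f (p.X u ω) - ∫ ω', f (p.X u ω') ∂Pr) ∂Pr
      = (∫ ω in A, f (p.X u ω) ∂Pr) - Pr.real A * ∫ ω, f (p.X u ω) ∂Pr := by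
    intro u f
    rw [integral_sub (hX.integrable_comp_X u f).integrableOn (integrable_const _), setIntegral_const, smul_eq_mul]
  have hq : ∀ B : Set Ω, IntegrableOn (fun u => ∫ ω in B, m.rTilde u (p.X u ω) ∂Pr) (Set.Ioc s t) leb := by
    intro B
    simp only [fun u => hX.setIntegral_comp_X u (m.rTilde u) B]
    exact integrable_finsetSum _ fun z _ =>
      hX.integrableOn_mul_measureReal B z (h1.measurable_rTilde z) (fun u => (hC u z).1) s t
  have hq' := hq Set.univ
  rw [Measure.restrict_univ] at hq'
  have hc1 : ∫ u in Set.Ioc s t, ∫ ω in A, p.rTildeC m Pr u (p.X u ω) ∂Pr ∂leb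
      = (∫ u in Set.Ioc s t, ∫ ω in A, m.rTilde u (p.X u ω) ∂Pr ∂leb)
        - Pr.real A * ∫ u in Set.Ioc s t, ∫ ω, m.rTilde u (p.X u ω) ∂Pr ∂leb := by
    simp only [rTildeC, hcent]
    rw [integral_sub (hq A) (hq'.const_mul _), integral_const_mul]
  have hc2 : ∑ i ∈ Finset.Ioc (m.numScheduled s) (m.numScheduled t), ∫ ω in A, p.hC m Pr (m.τ i) (p.X (m.τ i) ω) ∂Pr
      = (∑ i ∈ Finset.Ioc (m.numScheduled s) (m.numScheduled t), ∫ ω in A, m.h (m.τ i) (p.X (m.τ i) ω) ∂Pr)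
        - Pr.real A * ∑ i ∈ Finset.Ioc (m.numScheduled s) (m.numScheduled t), ∫ ω, m.h (m.τ i) (p.X (m.τ i) ω) ∂Pr := by
    simp only [RewardProcess.hC, hcent]
    rw [Finset.sum_sub_distrib, Finset.mul_sum]
  rw [hc1, hc2] at hnu
  rw [hM, hM]
  have hi3 := congrArg (fun x => Pr.real A * x) hi2
  simp only [mul_sub, mul_add] at hi3
  linarith

end RewardProcess

end MartingaleProof

theorem mainTheorem3 {S Ω : Type*} [Fintype S] [DecidableEq S] [MeasurableSpace S]
    [MeasurableSingletonClass S] [MeasurableSpace Ω] (Pr : Measure Ω) [IsProbabilityMeasure Pr]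
    (m : RewardModel S) (h1 : m.A1) (h2 : m.A2) (h3 : m.A3) (h4 : m.A4) (h5 : m.A5)
    (P : ℝ≥0 → ℝ≥0 → Matrix S S ℝ) (hP : IsTransitionFamily m.Q P)
    (p : RewardProcess Ω S) (hX : p.IsMarkovJump P Pr) (hN : p.IsCoxCounting m.β Pr)
    (hL : p.HasLumpLaws m Pr) :
    (∀ t x, Integrable (p.nu1Integrand m P Pr t x) leb) ∧
    (∀ t x, Summable (p.nu2Term m P Pr t x)) ∧
    BddAbove (Set.range fun q : ℝ≥0 × S => |p.nu m P Pr q.1 q.2|) ∧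
    (∀ t, Integrable (p.R m t) Pr) ∧
    ∃ 𝓕 : Filtration ℝ≥0 (inferInstance : MeasurableSpace Ω),
      (∀ t, 𝓕 t = p.history m t) ∧ Martingale (p.M m P Pr) 𝓕 Pr := by
  refine ⟨hX.integrable_nu1Integrand hP hN h1 h2 h3 h4 h5,
    fun t x => (m.schedEquiv t).summable_iff.1 (hX.summable_nu2Term_schedEquiv hP hN h1 h2 h3 h4 h5 t x),
    hX.bddAbove_abs_nu hP hN h1 h2 h3 h4 h5, hL.integrable_R hX hP hN h1 h2 h3 h4,
    ⟨p.history m, RewardProcess.history_mono p m, hL.history_le hX hN⟩, fun _ => rfl,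
    fun t => (hX.measurable_M h1 t).stronglyMeasurable, fun s t hst => ?_⟩
  have hM := hL.integrable_M hX hP hN h1 h2 h3 h4
  -- Equal integrals over all events of the history at `s`, together with adaptedness, characterise
  -- the conditional expectation.
  exact (ae_eq_condExp_of_forall_setIntegral_eq (hL.history_le hX hN s) (hM t) (fun A _ _ => (hM s).integrableOn)
    (fun A hA _ => hL.setIntegral_M hX hP hN h1 h2 h3 h4 h5 hst hA)
    (hX.measurable_M h1 s).stronglyMeasurable.aestronglyMeasurable).symm
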